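/- Let $E$ be a holomorphic vector bundle of rank $r$ on $\mathbb{P}^1=\mathbb{C}\cup\{\infty\}$ (affine coordinate $x$), let $P\subset\mathbb{C}$ be finite, and let $\nabla$ be a meromorphic connection on $E$ with poles in $P\cup\{\infty\}$ such that: (a) near each $p\in P$, in a suitable holomorphic frame of $E$, $\nabla=d+A^{p}\frac{dx}{x-p}+(\text{holomorphic terms})$ with $A^{p}=\mathrm{diag}(\mu^{p}_1,\dots,\mu^{p}_r)$; (b) near $\infty$, in a suitable holomorphic frame of $E$, $\nabla=d+\bigl(A+\frac{C}{x}+O(x^{-2})\bigr)dx$ with $A=\mathrm{diag}(\alpha_1,\dots,\alpha_r)$ and $C=\mathrm{diag}(\nu_1,\dots,\nu_r)$ constant; (c) (resonance-freeness) for $p\in P$ and all $k,m$ with $\mu^p_k,\mu^p_m\neq0$: $\mathrm{Re}\,\mu^p_k\notin\mathbb{Z}$ and $\mu^p_k-\mu^p_m\notin\mathbb{Z}\setminus\{0\}$; for all $k$: $\mathrm{Re}\,\nu_k\notin\mathbb{Z}$, and $\nu_k-\nu_m\notin\mathbb{Z}\setminus\{0\}$ whenever $\alpha_k=\alpha_m$.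 Put $\widehat P=\{\alpha_1,\dots,\alpha_r\}$. Let $\mathcal{M}=E(*(P\cup\{\infty\}))$ be the associated meromorphic bundle, a $\mathcal{D}_{\mathbb{P}^1}$-module on which a vector field $\partial$ acts by $\nabla_\partial$. A minimal extension of $\mathcal{M}$ is a coherent $\mathcal{D}_{\mathbb{P}^1}$-submodule $\mathcal{N}\subset\mathcal{M}$ with $\mathcal{O}(*(P\cup\{\infty\}))\otimes\mathcal{N}=\mathcal{M}$ that has no non-zero coherent submodule or quotient module supported in a point. Let $F$ be the sheaf of meromorphic $E$-valued $1$-forms, holomorphic outside $P\cup\{\infty\}$, with at most a simple pole at each $p\in P$ whose residue lies in the image of the residue of $\nabla$ at $p$, and with at most a double pole at $\infty$. For $\xi\in\mathbb{C}$ put $\nabla_\xi=\nabla-\xi\,dx$; it maps $E$ to $F$. Then $\mathcal{M}$ has exactly one minimal extension $\mathcal{M}_{\min}$, and $E\subset\mathcal{M}_{\min}$, $F\subset\mathcal{M}_{\min}\,dx$. For every $\xi\in\mathbb{C}\setminus\widehat P$ the inclusion (given by $e\mapsto e$ in degree $0$ and $s\,dx\mapsto s$ in degree $1$) $$\bigl(E\xrightarrow{\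 \nabla_\xi\ }F\bigr)\longrightarrow \mathrm{DR}(\mathcal{M}_{\min},\partial_x-\xi)=\bigl(\mathcal{M}_{\min}\xrightarrow{\ \partial_x-\xi\ }\mathcal{M}_{\min}\bigr)$$ is a quasi-isomorphism of complexes of sheaves on $\mathbb{P}^1$ (in degrees $0$ and $1$), and it induces an isomorphism $\Phi_\xi$ of first hypercohomologies. Furthermore the natural holomorphic structures of the two families of first hypercohomologies over $\mathbb{C}\setminus\widehat P$ agree under $\Phi$: for every open $V\subset\mathbb{C}\setminus\widehat P$, a section $\xi\mapsto\eta(\xi)\in\mathbb{H}^1(E\xrightarrow{\nabla_\xi}F)$ over $V$ is holomorphic if and only if $\xi\mapsto\Phi_\xi(\eta(\xi))$ is a holomorphic section of $\xi\mapsto\mathbb{H}^1(\mathrm{DR}(\mathcal{M}_{\min},\partial_x-\xi))$. Here a section over $V$ is called holomorphic if locally on $V$ it is represented, on a fixed open cover of $\mathbb{P}^1$, by Čech hypercocycles that depend holomorphically on $\xi$, that is, whose components are sections of the pullbacks to $\mathbb{P}^1\times V$ of the sheaves of the complex. -/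

import Mathlib

open CategoryTheory TopologicalSpace Opposite Filter Topology

noncomputable section

namespace TwistedDeRham

/-! ### The Riemann sphere and holomorphic vector bundles on it -/

/-- The local coordinate `t = 1/x` at infinity, as a parametrization `t ↦ 1/t`, `0 ↦ ∞`. -/
def invPt (t : ℂ) : OnePoint ℂ :=
  open Classical in if t = 0 then OnePoint.infty else ((t⁻¹ : ℂ) : OnePoint ℂ)

/-- The standard holomorphic parametrization of the Riemann sphere around `z`:
the coordinate `x` at finite distance, and `t = 1/x` at infinity. -/
def param (z : OnePoint ℂ) : ℂ → OnePoint ℂ :=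
  z.elim invPt fun _ => (fun u : ℂ => (u : OnePoint ℂ))

/-- The value at `z` of the coordinate used in `param z`. -/
def base (z : OnePoint ℂ) : ℂ := z.elim 0 id

/-- `f` is holomorphic in a neighbourhood of the point `z` of the Riemann sphere. -/
def HolAt (f : OnePoint ℂ → ℂ) (z : OnePoint ℂ) : Prop :=
  AnalyticAt ℂ (fun u => f (param z u)) (base z)

/-- `c` is holomorphic in a neighbourhood of `(z, ξ)` in the product of the Riemann sphere
and the `ξ`-line. -/
def HolAt₂ (c : OnePoint ℂ → ℂ → ℂ) (z : OnePoint ℂ) (ξ : ℂ) : Prop :=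
  AnalyticAt ℂ (fun q : ℂ × ℂ => c (param z q.1) q.2) (base z, ξ)

/-- A local equation of the point `z`: `x - z` at finite distance and `1/x` at infinity. -/
def unif (z : OnePoint ℂ) (x : ℂ) : ℂ := z.elim x⁻¹ fun w => x - w

/-- A holomorphic vector bundle of rank `r` on the Riemann sphere, given by its fibres and by
local frames over the members of an open cover whose transition functions are holomorphic.
(Only the values of `frame i` over `dom i` are relevant.) -/
structure HolBundle (r : ℕ) where
  Fib : OnePoint ℂ → Type
  [addCommGroup : ∀ x, AddCommGroup (Fib x)]
  [module : ∀ x, Module ℂ (Fib x)]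
  ι : Type
  dom : ι → Opens (OnePoint ℂ)
  cover : ∀ x, ∃ i, x ∈ dom i
  frame : ι → ∀ x, Module.Basis (Fin r) ℂ (Fib x)
  transition : ∀ i j k l, ∀ z ∈ dom i ⊓ dom j,
    HolAt (fun x => (frame i x).repr (frame j x l) k) z

attribute [instance] HolBundle.addCommGroup HolBundle.module

namespace HolBundle

variable {r : ℕ} (E : HolBundle r)

/-- The (set-theoretic) section `σ` is holomorphic near `z`. -/
def HolSec (σ : ∀ x, E.Fib x) (z : OnePoint ℂ) : Prop :=
  ∀ i, z ∈ E.dom i → ∀ k, HolAt (fun x => (E.frame i x).repr (σ x) k) z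

/-- The section `s` over the affine line is holomorphic near `w`. -/
def HolSecC (s : ∀ x : ℂ, E.Fib x) (w : ℂ) : Prop :=
  ∀ i, (w : OnePoint ℂ) ∈ E.dom i →
    ∀ k, AnalyticAt ℂ (fun u : ℂ => (E.frame i u).repr (s u) k) w

/-- `e` is a holomorphic frame (a local trivialization) of `E` near `z`: the `e k` are
holomorphic, independent at `z`, and every section that is holomorphic near `z` is near `z` a
combination of them with holomorphic coefficients. -/
structure IsFrameAt (e : Fin r → ∀ x, E.Fib x) (z : OnePoint ℂ) : Prop where
  hol : ∀ k, E.HolSec (e k) z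
  indep : LinearIndependent ℂ fun k => e k z
  gen : ∀ σ, E.HolSec σ z → ∃ c : Fin r → OnePoint ℂ → ℂ, (∀ k, HolAt (c k) z) ∧
    ∀ᶠ x in 𝓝 z, σ x = ∑ k, c k x • e k x

end HolBundle

/-- A meromorphic connection on the holomorphic bundle `E` over the Riemann sphere, with poles in
the finite set `P` and at infinity, logarithmic with semi-simple residues at the points of `P`,
and with a pole of Poincaré rank one and diagonalizable polar part at infinity. -/
structure SingConn {r : ℕ} (E : HolBundle r) where
  /-- the singular locus at finite distance -/
  P : Finset ℂ
  /-- the operator `∇_{∂/∂x}`; its values are only relevant on sections that are holomorphic near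
  the point of evaluation, and at points outside `P` -/
  D : (∀ x : ℂ, E.Fib x) → ∀ x : ℂ, E.Fib x
  D_congr : ∀ s t, ∀ x ∉ P, (∀ᶠ y in 𝓝 x, s y = t y) → D s x = D t x
  D_add : ∀ s t, ∀ x ∉ P, E.HolSecC s x → E.HolSecC t x → D (s + t) x = D s x + D t x
  D_smul : ∀ (f : ℂ → ℂ) s, ∀ x ∉ P, AnalyticAt ℂ f x → E.HolSecC s x →
    D (fun y => f y • s y) x = deriv f x • s x + f x • D s x
  D_hol : ∀ s, ∀ x ∉ P, E.HolSecC s x → E.HolSecC (D s) x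
  /-- the eigenvalues of the residue at `p ∈ P`, with multiplicities -/
  μ : ℂ → Fin r → ℂ
  /-- near `p`, in a suitable frame, `∇ = d + diag(μ p) dx/(x-p) +` holomorphic terms -/
  log_form : ∀ p ∈ P, ∃ e, E.IsFrameAt e p ∧
    ∃ H : Fin r → Fin r → OnePoint ℂ → ℂ, (∀ k l, HolAt (H k l) p) ∧
      ∀ k, ∀ᶠ x : ℂ in 𝓝[≠] p, D (fun y => e k y) x =
        (μ p k / (x - p)) • e k x + ∑ l, H l k x • e l x
  /-- the eigenvalues of the leading polar coefficient `A` at infinity, with multiplicities -/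
  α : Fin r → ℂ
  /-- the diagonal entries of the matrix `C` at infinity -/
  ν : Fin r → ℂ
  /-- near infinity, in a suitable frame, `∇ = d + (diag α + diag ν / x + O(x⁻²)) dx` -/
  irr_form : ∃ e, E.IsFrameAt e OnePoint.infty ∧
    ∃ H : Fin r → Fin r → OnePoint ℂ → ℂ, (∀ k l, HolAt (H k l) OnePoint.infty) ∧
      ∀ k, ∀ᶠ x : ℂ in cocompact ℂ, D (fun y => e k y) x =
        (α k + ν k / x) • e k x + ∑ l, ((x⁻¹) ^ 2 * H l k x) • e l x

namespace SingConn

variable {r : ℕ} {E : HolBundle r} (C : SingConn E)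

/-- The part of resonance-freeness that does not involve parabolic weights. -/
structure ResonanceFree : Prop where
  re_fin : ∀ p ∈ C.P, ∀ k, C.μ p k ≠ 0 → ∀ n : ℤ, (C.μ p k).re ≠ n
  sub_fin : ∀ p ∈ C.P, ∀ k m, C.μ p k ≠ 0 → C.μ p m ≠ 0 →
    ∀ n : ℤ, n ≠ 0 → C.μ p k - C.μ p m ≠ n
  re_inf : ∀ k, ∀ n : ℤ, (C.ν k).re ≠ n
  sub_inf : ∀ k m, C.α k = C.α m → ∀ n : ℤ, n ≠ 0 → C.ν k - C.ν m ≠ n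

/-- The set of eigenvalues of the leading polar coefficient at infinity. -/
def Phat : Set ℂ := Set.range C.α

/-- The singular points: `P` and infinity. -/
def IsSing (z : OnePoint ℂ) : Prop := z = OnePoint.infty ∨ ∃ p ∈ C.P, z = (p : OnePoint ℂ)

/-- Points of `U` outside the singular points. -/
abbrev Punct (U : Opens (OnePoint ℂ)) : Type := {x : ℂ // (x : OnePoint ℂ) ∈ U ∧ x ∉ C.P}

/-- Set-theoretic sections of `E` over the complement of the singular points in `U`. All sheaves
below are sheaves of such sections; a `1`-form `s dx` is represented by its coefficient `s`. -/
abbrev Sec (U : Opens (OnePoint ℂ)) : Type := ∀ x : C.Punct U, E.Fib (x.1 : ℂ)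

/-- Extension by zero of a section. -/
def extend {U : Opens (OnePoint ℂ)} (s : C.Sec U) : ∀ x : ℂ, E.Fib x :=
  fun x => open Classical in
    if h : (x : OnePoint ℂ) ∈ U ∧ x ∉ C.P then s ⟨x, h⟩ else 0

/-- Restriction of sections. -/
def restr {U V : Opens (OnePoint ℂ)} (h : V ≤ U) : C.Sec U →ₗ[ℂ] C.Sec V where
  toFun s := fun x => s ⟨x.1, h x.2.1, x.2.2⟩
  map_add' _ _ := rfl
  map_smul' _ _ := rfl

/-- Multiplication of sections by a function. -/
def mulFun {U : Opens (OnePoint ℂ)} (f : ℂ → ℂ) (s : C.Sec U) : C.Sec U :=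
  fun x => f x.1 • s x

/-- The action of `∂_x`, that is `∇_{∂/∂x}`, on sections. -/
def del {U : Opens (OnePoint ℂ)} (s : C.Sec U) : C.Sec U := fun x => C.D (C.extend s) x.1

/-- The twisted operator `∂_x - ξ`, that is the coefficient of `dx` in `∇_ξ = ∇ - ξ dx`. -/
def nabla (ξ : ℂ) {U : Opens (OnePoint ℂ)} (s : C.Sec U) : C.Sec U :=
  fun x => C.del s x - ξ • s x

/-- Nonsingular points of the affine line tending to `z`. -/
def near (z : OnePoint ℂ) : Filter ℂ :=
  comap (fun u : ℂ => (u : OnePoint ℂ)) (𝓝 z) ⊓ 𝓟 {x | x ∉ C.P}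

/-- `σ` is a holomorphic section of `E` near `z`, equal to `s` at the nonsingular points. -/
def ExtendsTo (s : ∀ x : ℂ, E.Fib x) (z : OnePoint ℂ) (σ : ∀ x, E.Fib x) : Prop :=
  E.HolSec σ z ∧ ∀ᶠ x in C.near z, s x = σ x

/-- `s` extends to a holomorphic section of `E` near `z`. -/
def ExtendsAt (s : ∀ x : ℂ, E.Fib x) (z : OnePoint ℂ) : Prop := ∃ σ, C.ExtendsTo s z σ

/-- `s dx` has at most a simple pole at `p`, with residue `v`. -/
def HasResidue (s : ∀ x : ℂ, E.Fib x) (p : ℂ) (v : E.Fib p) : Prop :=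
  ∃ σ, C.ExtendsTo (fun x => (x - p) • s x) p σ ∧ σ p = v

/-- `v` is in the image of the residue endomorphism `σ(p) ↦ Res_p (∇σ)` of the fibre at `p`. -/
def InResidueImage (p : ℂ) (v : E.Fib p) : Prop :=
  ∃ σ, E.HolSec σ p ∧ C.HasResidue (C.D fun x => σ x) p v

/-- `s` is a section over `U` of `E(*(P ∪ ∞))`. -/
def IsMero {U : Opens (OnePoint ℂ)} (s : C.Sec U) : Prop :=
  ∀ z ∈ U, ∃ k : ℕ, (¬ C.IsSing z → k = 0) ∧
    C.ExtendsAt (fun x => unif z x ^ k • C.extend s x) z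

end SingConn

/-! ### Elementary facts needed for the constructions -/

lemma HolAt.add {f g : OnePoint ℂ → ℂ} {z : OnePoint ℂ} (hf : HolAt f z) (hg : HolAt g z) :
    HolAt (fun x => f x + g x) z := AnalyticAt.fun_add hf hg

lemma HolAt.mul {f g : OnePoint ℂ → ℂ} {z : OnePoint ℂ} (hf : HolAt f z) (hg : HolAt g z) :
    HolAt (fun x => f x * g x) z := AnalyticAt.fun_mul hf hg

lemma HolAt.const (c : ℂ) (z : OnePoint ℂ) : HolAt (fun _ => c) z := analyticAt_const

lemma HolAt.sum {ι : Type*} (t : Finset ι) {f : ι → OnePoint ℂ → ℂ} {z : OnePoint ℂ}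
    (hf : ∀ i ∈ t, HolAt (f i) z) : HolAt (fun x => ∑ i ∈ t, f i x) z :=
  Finset.analyticAt_fun_sum t hf

lemma holAt_coe {f : OnePoint ℂ → ℂ} {w : ℂ} :
    HolAt f w ↔ AnalyticAt ℂ (fun u : ℂ => f u) w := Iff.rfl

lemma holAt_infty {f : OnePoint ℂ → ℂ} :
    HolAt f OnePoint.infty ↔ AnalyticAt ℂ (fun t => f (invPt t)) 0 := Iff.rfl

lemma invPt_of_ne {t : ℂ} (h : t ≠ 0) : invPt t = ((t⁻¹ : ℂ) : OnePoint ℂ) := if_neg h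

lemma invPt_zero : invPt 0 = OnePoint.infty := if_pos rfl

lemma comap_infty :
    comap (fun u : ℂ => (u : OnePoint ℂ)) (𝓝 OnePoint.infty) = cocompact ℂ := by
  rw [OnePoint.comap_coe_nhds_infty, coclosedCompact_eq_cocompact]

lemma comap_coe (w : ℂ) : comap (fun u : ℂ => (u : OnePoint ℂ)) (𝓝 (w : OnePoint ℂ)) = 𝓝 w :=
  OnePoint.comap_coe_nhds w

lemma tendsto_inv_cocompact : Tendsto (fun x : ℂ => x⁻¹) (cocompact ℂ) (𝓝[≠] 0) := by
  rw [← Metric.cobounded_eq_cocompact]; exact tendsto_inv₀_cobounded'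

lemma eventually_ne_cocompact (c : ℂ) : ∀ᶠ x in cocompact ℂ, x ≠ c := by
  have := (isCompact_singleton (x := c)).compl_mem_cocompact
  filter_upwards [this] with x hx using hx

lemma HolAt.eventually {f : OnePoint ℂ → ℂ} {z : OnePoint ℂ} (hf : HolAt f z) :
    ∀ᶠ x : ℂ in comap (fun u : ℂ => (u : OnePoint ℂ)) (𝓝 z), HolAt f x := by
  induction z using OnePoint.rec with
  | infty =>
    rw [comap_infty]
    have h := (holAt_infty.1 hf).eventually_analyticAt
    have h' := (tendsto_inv_cocompact.mono_right nhdsWithin_le_nhds).eventually h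
    filter_upwards [h', eventually_ne_cocompact 0] with x hx hx0
    rw [holAt_coe]
    have h2 : AnalyticAt ℂ (fun u : ℂ => f (invPt u⁻¹)) x :=
      AnalyticAt.fun_comp (g := fun t => f (invPt t)) (f := fun u : ℂ => u⁻¹) hx (analyticAt_inv hx0)
    refine h2.congr ?_
    filter_upwards [eventually_ne_nhds hx0] with u hu
    rw [invPt_of_ne (inv_ne_zero hu), inv_inv]
  | coe w =>
    rw [comap_coe]
    exact (holAt_coe.1 hf).eventually_analyticAt

lemma HolAt.congr {f g : OnePoint ℂ → ℂ} {z : OnePoint ℂ} (hf : HolAt f z)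
    (h : ∀ᶠ x in 𝓝 z, f x = g x) : HolAt g z := by
  refine AnalyticAt.congr hf ?_
  induction z using OnePoint.rec with
  | infty =>
    have ht : Tendsto invPt (𝓝 0) (𝓝 OnePoint.infty) := by
      rw [← nhdsNE_sup_pure, tendsto_sup]
      constructor
      · have h1 : Tendsto (fun t : ℂ => ((t⁻¹ : ℂ) : OnePoint ℂ)) (𝓝[≠] 0)
            (𝓝 OnePoint.infty) := by
          rw [← Function.comp_def, ← tendsto_comap_iff, comap_infty,
            ← Metric.cobounded_eq_cocompact]
          exact tendsto_inv₀_nhdsNE_zero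
        refine h1.congr' ?_
        filter_upwards [self_mem_nhdsWithin] with t ht
        exact (invPt_of_ne ht).symm
      · rw [tendsto_pure_left]
        intro s hs
        rw [invPt_zero]; exact mem_of_mem_nhds hs
    exact ht.eventually h
  | coe w => exact (OnePoint.continuous_coe.tendsto w).eventually h

/-- The function `x - p`, with an irrelevant value at infinity. -/
def subFun (p : ℂ) (z : OnePoint ℂ) : ℂ := z.elim 0 fun x => x - p

/-- The function `1/x`, with value zero at infinity. -/
def invFun (z : OnePoint ℂ) : ℂ := z.elim 0 fun x => x⁻¹

/-- The derivative with respect to `x`, with value zero at infinity. -/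
def derivFun (c : OnePoint ℂ → ℂ) (z : OnePoint ℂ) : ℂ :=
  z.elim 0 fun x => deriv (fun u : ℂ => c u) x

lemma holAt_subFun (p w : ℂ) : HolAt (subFun p) w := by
  rw [holAt_coe]
  exact analyticAt_id.fun_sub analyticAt_const

lemma holAt_invFun : HolAt invFun OnePoint.infty := by
  rw [holAt_infty]
  refine analyticAt_id.congr (Eventually.of_forall fun t => ?_)
  change t = invFun (invPt t)
  by_cases ht : t = 0
  · subst ht; rw [invPt_zero]; rfl
  · rw [invPt_of_ne ht]; exact (inv_inv t).symm

lemma HolAt.derivFun_coe {c : OnePoint ℂ → ℂ} {w : ℂ} (hc : HolAt c w) :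
    HolAt (derivFun c) w := (holAt_coe.1 hc).deriv

lemma HolAt.derivFun_infty {c : OnePoint ℂ → ℂ} (hc : HolAt c OnePoint.infty) :
    HolAt (derivFun c) OnePoint.infty := by
  rw [holAt_infty] at hc ⊢
  have h1 : AnalyticAt ℂ (fun t => -t ^ 2 * deriv (fun t => c (invPt t)) t) 0 :=
    ((analyticAt_id.fun_pow 2).fun_neg).fun_mul hc.deriv
  refine h1.congr ?_
  filter_upwards [hc.eventually_analyticAt] with t ht
  by_cases h0 : t = 0
  · subst h0; rw [invPt_zero]; simp [derivFun]
  · rw [invPt_of_ne h0]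
    change _ = deriv (fun u : ℂ => c u) t⁻¹
    have e : (fun u : ℂ => c u) =ᶠ[𝓝 t⁻¹] ((fun t => c (invPt t)) ∘ fun u : ℂ => u⁻¹) := by
      filter_upwards [eventually_ne_nhds (inv_ne_zero h0)] with u hu
      simp [invPt_of_ne (inv_ne_zero hu)]
    rw [e.deriv_eq]
    have h2 : HasDerivAt (fun t => c (invPt t)) (deriv (fun t => c (invPt t)) t) (t⁻¹)⁻¹ := by
      rw [inv_inv]; exact ht.differentiableAt.hasDerivAt
    rw [(h2.comp (t⁻¹) (hasDerivAt_inv (inv_ne_zero h0))).deriv]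
    field_simp

namespace HolBundle

variable {r : ℕ} {E : HolBundle r}

lemma holSec_coe {σ : ∀ x, E.Fib x} {w : ℂ} : E.HolSec σ w ↔ E.HolSecC (fun x => σ x) w :=
  Iff.rfl

lemma HolSec.add {σ τ : ∀ x, E.Fib x} {z : OnePoint ℂ} (h : E.HolSec σ z) (h' : E.HolSec τ z) :
    E.HolSec (fun x => σ x + τ x) z := fun i hi k => by
  simpa using (h i hi k).add (h' i hi k)

lemma HolSec.smul {f : OnePoint ℂ → ℂ} {σ : ∀ x, E.Fib x} {z : OnePoint ℂ} (hf : HolAt f z)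
    (h : E.HolSec σ z) : E.HolSec (fun x => f x • σ x) z := fun i hi k => by
  simpa using hf.mul (h i hi k)

lemma HolSec.zero (z : OnePoint ℂ) : E.HolSec (fun _ => 0) z := fun i hi k => by
  simpa using HolAt.const 0 z

lemma HolSec.sum {ι : Type*} (t : Finset ι) {σ : ι → ∀ x, E.Fib x} {z : OnePoint ℂ}
    (h : ∀ j ∈ t, E.HolSec (σ j) z) : E.HolSec (fun x => ∑ j ∈ t, σ j x) z := fun i hi k => by
  simpa using HolAt.sum t fun j hj => h j hj i hi k

lemma HolSecC.congr {s t : ∀ x : ℂ, E.Fib x} {w : ℂ} (h : E.HolSecC s w)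
    (e : ∀ᶠ y in 𝓝 w, s y = t y) : E.HolSecC t w := fun i hi k =>
  (h i hi k).congr (e.mono fun y hy => by simp only [hy])

lemma HolSecC.add {s t : ∀ x : ℂ, E.Fib x} {w : ℂ} (h : E.HolSecC s w) (h' : E.HolSecC t w) :
    E.HolSecC (fun x => s x + t x) w := fun i hi k => by
  simpa using (h i hi k).fun_add (h' i hi k)

lemma HolSecC.smul {f : ℂ → ℂ} {s : ∀ x : ℂ, E.Fib x} {w : ℂ} (hf : AnalyticAt ℂ f w)
    (h : E.HolSecC s w) : E.HolSecC (fun x => f x • s x) w := fun i hi k => by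
  simpa using hf.fun_mul (h i hi k)

lemma HolSecC.zero (w : ℂ) : E.HolSecC (fun _ => 0) w := fun i hi k => by
  simpa using (analyticAt_const (𝕜 := ℂ) (v := (0 : ℂ)) (x := w))

lemma HolSec.eventually {σ : ∀ x, E.Fib x} {z : OnePoint ℂ} (h : E.HolSec σ z) :
    ∀ᶠ x : ℂ in comap (fun u : ℂ => (u : OnePoint ℂ)) (𝓝 z), E.HolSecC (fun x => σ x) x := by
  obtain ⟨i, hi⟩ := E.cover z
  have h1 : ∀ᶠ x : ℂ in comap (fun u : ℂ => (u : OnePoint ℂ)) (𝓝 z),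
      ∀ k, HolAt (fun x => (E.frame i x).repr (σ x) k) x :=
    eventually_all.2 fun k => (h i hi k).eventually
  have h2 : ∀ᶠ x : ℂ in comap (fun u : ℂ => (u : OnePoint ℂ)) (𝓝 z),
      (x : OnePoint ℂ) ∈ E.dom i := tendsto_comap.eventually ((E.dom i).isOpen.mem_nhds hi)
  filter_upwards [h1, h2] with x hx hxi j hj k
  have h3 : HolAt (fun y => ∑ l, (E.frame i y).repr (σ y) l *
      (E.frame j y).repr (E.frame i y l) k) x :=
    HolAt.sum _ fun l _ => (hx l).mul (E.transition j i k l x ⟨hj, hxi⟩)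
  refine (holAt_coe.1 h3).congr (Eventually.of_forall fun y => ?_)
  have h4 := congrArg (fun v => (E.frame j y).repr v k) ((E.frame i y).sum_repr (σ y))
  simp only [map_sum, map_smul, Finsupp.finsetSum_apply, Finsupp.smul_apply, smul_eq_mul] at h4
  exact h4

end HolBundle

namespace SingConn

variable {r : ℕ} {E : HolBundle r} (C : SingConn E)

lemma near_le (z : OnePoint ℂ) :
    C.near z ≤ comap (fun u : ℂ => (u : OnePoint ℂ)) (𝓝 z) := inf_le_left

lemma near_notMem (z : OnePoint ℂ) : ∀ᶠ x in C.near z, x ∉ C.P :=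
  mem_inf_of_right (mem_principal_self _)

lemma eventually_notMem {w : ℂ} (h : w ∉ C.P) : ∀ᶠ x in 𝓝 w, x ∉ C.P :=
  C.P.finite_toSet.isClosed.isOpen_compl.mem_nhds h

lemma near_coe {w : ℂ} (h : w ∉ C.P) : C.near w = 𝓝 w := by
  rw [near, comap_coe, inf_eq_left, le_principal_iff]
  exact C.eventually_notMem h

/-- A property valid near `z` is valid locally at all nonsingular points near `z`. -/
lemma near_eventually {z : OnePoint ℂ} {p : ℂ → Prop} (h : ∀ᶠ x in C.near z, p x) :
    ∀ᶠ x in C.near z, ∀ᶠ y in 𝓝 x, p y := by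
  rw [near, eventually_inf_principal] at h
  obtain ⟨V, hV, hVp⟩ := mem_comap.1 h
  obtain ⟨W, hW, hWo, hzW⟩ := mem_nhds_iff.1 hV
  have h2 : ∀ᶠ x : ℂ in C.near z, (x : OnePoint ℂ) ∈ W :=
    C.near_le z (tendsto_comap.eventually (hWo.mem_nhds hzW))
  filter_upwards [h2, C.near_notMem z] with x hx hxP
  have h3 : ∀ᶠ y : ℂ in 𝓝 x, (y : OnePoint ℂ) ∈ W :=
    (OnePoint.continuous_coe.tendsto x).eventually (hWo.mem_nhds hx)
  filter_upwards [h3, C.eventually_notMem hxP] with y hy hyP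
  exact hVp (hW hy) hyP

variable {C}

lemma near_mem {U : Opens (OnePoint ℂ)} {z : OnePoint ℂ} (hz : z ∈ U) :
    ∀ᶠ x : ℂ in C.near z, (x : OnePoint ℂ) ∈ U :=
  C.near_le z (tendsto_comap.eventually (U.isOpen.mem_nhds hz))

lemma extend_apply {U : Opens (OnePoint ℂ)} (s : C.Sec U) (x : C.Punct U) :
    C.extend s x.1 = s x := dif_pos x.2

lemma extend_add {U : Opens (OnePoint ℂ)} (s t : C.Sec U) (x : ℂ) :
    C.extend (s + t) x = C.extend s x + C.extend t x := by
  unfold extend; split_ifs <;> simp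

lemma extend_smul {U : Opens (OnePoint ℂ)} (a : ℂ) (s : C.Sec U) (x : ℂ) :
    C.extend (a • s) x = a • C.extend s x := by
  unfold extend; split_ifs <;> simp

lemma extend_zero {U : Opens (OnePoint ℂ)} (x : ℂ) : C.extend (0 : C.Sec U) x = 0 := by
  unfold extend; split_ifs <;> simp

lemma extend_mulFun {U : Opens (OnePoint ℂ)} (f : ℂ → ℂ) (s : C.Sec U) (x : ℂ) :
    C.extend (C.mulFun f s) x = f x • C.extend s x := by
  unfold extend mulFun; split_ifs <;> simp

lemma extend_restr {U V : Opens (OnePoint ℂ)} (h : V ≤ U) (s : C.Sec U) {x : ℂ}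
    (hx : (x : OnePoint ℂ) ∈ V) : C.extend (C.restr h s) x = C.extend s x := by
  unfold extend
  by_cases hP : x ∈ C.P
  · rw [dif_neg (by tauto), dif_neg (by tauto)]
  · rw [dif_pos ⟨hx, hP⟩, dif_pos ⟨h hx, hP⟩]; rfl

lemma extend_restr_near {U V : Opens (OnePoint ℂ)} (h : V ≤ U) (s : C.Sec U) {z : OnePoint ℂ}
    (hz : z ∈ V) : ∀ᶠ x in C.near z, C.extend (C.restr h s) x = C.extend s x :=
  (near_mem hz).mono fun _ hx => extend_restr h s hx

lemma extend_nabla {U : Opens (OnePoint ℂ)} (ξ : ℂ) (s : C.Sec U) {z : OnePoint ℂ} (hz : z ∈ U) :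
    ∀ᶠ x in C.near z, C.extend (C.nabla ξ s) x = C.D (C.extend s) x - ξ • C.extend s x := by
  filter_upwards [near_mem (C := C) hz, C.near_notMem z] with x hx hxP
  rw [extend_apply (C.nabla ξ s) ⟨x, hx, hxP⟩, extend_apply s ⟨x, hx, hxP⟩]; rfl

lemma ExtendsTo.congr {s t : ∀ x : ℂ, E.Fib x} {z : OnePoint ℂ} {σ : ∀ x, E.Fib x}
    (h : C.ExtendsTo s z σ) (e : ∀ᶠ x in C.near z, s x = t x) : C.ExtendsTo t z σ :=
  ⟨h.1, by filter_upwards [h.2, e] with x hx hx'; rw [← hx', hx]⟩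

lemma ExtendsTo.add {s t : ∀ x : ℂ, E.Fib x} {z : OnePoint ℂ} {σ τ : ∀ x, E.Fib x}
    (h : C.ExtendsTo s z σ) (h' : C.ExtendsTo t z τ) :
    C.ExtendsTo (fun x => s x + t x) z (fun x => σ x + τ x) :=
  ⟨h.1.add h'.1, by filter_upwards [h.2, h'.2] with x hx hx'; rw [← hx', hx]⟩

lemma ExtendsTo.smul {f : OnePoint ℂ → ℂ} {s : ∀ x : ℂ, E.Fib x} {z : OnePoint ℂ}
    {σ : ∀ x, E.Fib x} (hf : HolAt f z) (h : C.ExtendsTo s z σ) :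
    C.ExtendsTo (fun x => f x • s x) z (fun x => f x • σ x) :=
  ⟨HolBundle.HolSec.smul hf h.1, by filter_upwards [h.2] with x hx; rw [hx]⟩

lemma ExtendsAt.congr {s t : ∀ x : ℂ, E.Fib x} {z : OnePoint ℂ}
    (h : C.ExtendsAt s z) (e : ∀ᶠ x in C.near z, s x = t x) : C.ExtendsAt t z :=
  let ⟨σ, hσ⟩ := h; ⟨σ, hσ.congr e⟩

lemma ExtendsAt.holSecC {s : ∀ x : ℂ, E.Fib x} {w : ℂ} (hw : w ∉ C.P) (h : C.ExtendsAt s w) :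
    E.HolSecC s w := by
  obtain ⟨σ, h1, h2⟩ := h
  rw [C.near_coe hw] at h2
  exact HolBundle.HolSecC.congr (HolBundle.holSec_coe.1 h1) (h2.mono fun x hx => hx.symm)

lemma holSecC_near {z : OnePoint ℂ} {σ : ∀ x, E.Fib x} (h : E.HolSec σ z) :
    ∀ᶠ x in C.near z, E.HolSecC (fun x => σ x) x := C.near_le z h.eventually

lemma D_const_smul (a : ℂ) {s : ∀ x : ℂ, E.Fib x} {x : ℂ} (hx : x ∉ C.P) (h : E.HolSecC s x) :
    C.D (fun y => a • s y) x = a • C.D s x := by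
  rw [C.D_smul (fun _ => a) s x hx analyticAt_const h]; simp

lemma D_zero {x : ℂ} (hx : x ∉ C.P) : C.D (fun _ => 0) x = 0 := by
  have := D_const_smul (C := C) 0 hx (HolBundle.HolSecC.zero (E := E) x)
  simpa using this

lemma D_add' {s t : ∀ x : ℂ, E.Fib x} {x : ℂ} (hx : x ∉ C.P) (h : E.HolSecC s x)
    (h' : E.HolSecC t x) : C.D (fun y => s y + t y) x = C.D s x + C.D t x :=
  C.D_add s t x hx h h'

lemma D_sum {ι : Type*} (T : Finset ι) {s : ι → ∀ x : ℂ, E.Fib x} {x : ℂ} (hx : x ∉ C.P)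
    (h : ∀ j ∈ T, E.HolSecC (s j) x) :
    C.D (fun y => ∑ j ∈ T, s j y) x = ∑ j ∈ T, C.D (s j) x ∧
      E.HolSecC (fun y => ∑ j ∈ T, s j y) x := by
  classical
  induction T using Finset.induction_on with
  | empty => simpa using ⟨D_zero hx, HolBundle.HolSecC.zero x⟩
  | insert a T ha ih =>
    obtain ⟨h1, h2⟩ := ih fun j hj => h j (Finset.mem_insert_of_mem hj)
    have h3 := h a (Finset.mem_insert_self a T)
    simp only [Finset.sum_insert ha]
    exact ⟨by rw [D_add' hx h3 h2, h1], h3.add h2⟩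

lemma D_near {z : OnePoint ℂ} {s : ∀ x : ℂ, E.Fib x} {σ : ∀ x, E.Fib x}
    (h : C.ExtendsTo s z σ) : ∀ᶠ x in C.near z, C.D s x = C.D (fun y => σ y) x := by
  filter_upwards [C.near_eventually h.2, C.near_notMem z] with x hx hxP
  exact C.D_congr _ _ x hxP hx

/-- Computation of `∇σ` in a frame near a singular point. -/
lemma D_frame {z : OnePoint ℂ} {e : Fin r → ∀ x, E.Fib x} (he : E.IsFrameAt e z)
    {σ : ∀ x, E.Fib x} (hσ : E.HolSec σ z) :
    ∃ c : Fin r → OnePoint ℂ → ℂ, (∀ k, HolAt (c k) z) ∧ ∀ᶠ x in C.near z,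
      C.D (fun y => σ y) x =
        ∑ k, (derivFun (c k) x • e k x + c k x • C.D (fun y => e k y) x) := by
  obtain ⟨c, hc, hs⟩ := he.gen σ hσ
  refine ⟨c, hc, ?_⟩
  have h1 : ∀ᶠ x : ℂ in C.near z, σ x = ∑ k, c k x • e k x :=
    C.near_le z (tendsto_comap.eventually hs)
  have h2 : ∀ᶠ x in C.near z, ∀ k, AnalyticAt ℂ (fun u : ℂ => c k u) x :=
    eventually_all.2 fun k => C.near_le z (hc k).eventually
  have h3 : ∀ᶠ x in C.near z, ∀ k, E.HolSecC (fun y => e k y) x :=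
    eventually_all.2 fun k => holSecC_near (he.hol k)
  filter_upwards [C.near_eventually h1, h2, h3, C.near_notMem z] with x hx hc' he' hxP
  rw [C.D_congr _ (fun y => ∑ k, c k y • e k y) x hxP hx,
    (D_sum (s := fun k y => c k y • e k y) Finset.univ hxP fun k _ =>
      HolBundle.HolSecC.smul (hc' k) (he' k)).1]
  refine Finset.sum_congr rfl fun k _ => ?_
  rw [C.D_smul (fun y => c k y) (fun y => e k y) x hxP (hc' k) (he' k)]
  rfl

lemma exists_residue {p : ℂ} (hp : p ∈ C.P) {σ : ∀ x, E.Fib x} (hσ : E.HolSec σ p) :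
    ∃ v, C.HasResidue (C.D fun x => σ x) p v := by
  obtain ⟨e, he, H, hH, hD⟩ := C.log_form p hp
  obtain ⟨c, hc, hs⟩ := D_frame (C := C) he hσ
  let τ : ∀ x, E.Fib x := fun x => ∑ k, ((subFun p x * derivFun (c k) x + c k x * C.μ p k) • e k x
    + ∑ l, (subFun p x * (c k x * H l k x)) • e l x)
  refine ⟨_, τ, ⟨?_, ?_⟩, rfl⟩
  · refine HolBundle.HolSec.sum _ fun k _ => (HolBundle.HolSec.smul (((holAt_subFun p p).mul
      (hc k).derivFun_coe).add ((hc k).mul (HolAt.const _ _))) (he.hol k)).add ?_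
    exact HolBundle.HolSec.sum _ fun l _ => HolBundle.HolSec.smul
      ((holAt_subFun p p).mul ((hc k).mul (hH l k))) (he.hol l)
  · have hn : C.near p ≤ 𝓝[≠] p := by
      rw [near, comap_coe]
      exact inf_le_inf_left _ (principal_mono.2 fun x hx => by rintro rfl; exact hx hp)
    filter_upwards [hs, eventually_all.2 fun k => hn (hD k), C.near_notMem p] with x hx hx' hxP
    have hxp : x - p ≠ 0 := sub_ne_zero.2 fun h => hxP (h ▸ hp)
    rw [hx, Finset.smul_sum]
    refine Finset.sum_congr rfl fun k _ => ?_
    rw [hx' k]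
    simp only [smul_add, smul_smul, Finset.smul_sum, add_smul]
    rw [← add_assoc]
    congr 2
    congr 1
    field_simp

lemma D_extends_infty {σ : ∀ x, E.Fib x} (hσ : E.HolSec σ OnePoint.infty) :
    C.ExtendsAt (C.D fun x => σ x) OnePoint.infty := by
  obtain ⟨e, he, H, hH, hD⟩ := C.irr_form
  obtain ⟨c, hc, hs⟩ := D_frame (C := C) he hσ
  let τ : ∀ x, E.Fib x := fun x => ∑ k, ((derivFun (c k) x
    + c k x * (C.α k + C.ν k * invFun x)) • e k x
    + ∑ l, (c k x * ((invFun x * invFun x) * H l k x)) • e l x)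
  refine ⟨τ, ?_, ?_⟩
  · refine HolBundle.HolSec.sum _ fun k _ => (HolBundle.HolSec.smul ((hc k).derivFun_infty.add ((hc k).mul
      ((HolAt.const _ _).add ((HolAt.const _ _).mul holAt_invFun)))) (he.hol k)).add ?_
    exact HolBundle.HolSec.sum _ fun l _ => HolBundle.HolSec.smul
      ((hc k).mul ((holAt_invFun.mul holAt_invFun).mul (hH l k))) (he.hol l)
  · have hn : C.near OnePoint.infty ≤ cocompact ℂ := by
      rw [← comap_infty]; exact C.near_le _
    filter_upwards [hs, eventually_all.2 fun k => hn (hD k)] with x hx hx'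
    rw [hx]
    refine Finset.sum_congr rfl fun k _ => ?_
    rw [hx' k]
    simp only [smul_add, smul_smul, Finset.smul_sum, add_smul]
    rw [← add_assoc]
    refine congrArg₂ (· + ·) ?_ (Finset.sum_congr rfl fun l _ => ?_)
    · congr 1
      rw [← add_smul, ← mul_add]
      rfl
    congr 2
    change x⁻¹ ^ 2 * _ = x⁻¹ * x⁻¹ * _
    ring

end SingConn

namespace SingConn

variable {r : ℕ} {E : HolBundle r} (C : SingConn E)

/-! ### Sheaves of sections -/

/-- A sheaf of `𝒪`-modules on the Riemann sphere consisting of holomorphic sections of `E` over the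
complement of the singular points, that is a sub-`𝒪`-module of `j_* j^* E`, where `j` is the
inclusion of this complement. -/
@[ext]
structure OSub where
  carrier : ∀ U : Opens (OnePoint ℂ), Submodule ℂ (C.Sec U)
  hol : ∀ U, ∀ s ∈ carrier U, ∀ x : C.Punct U, E.HolSecC (C.extend s) x.1
  res_mem : ∀ U V (h : V ≤ U), ∀ s ∈ carrier U, C.restr h s ∈ carrier V
  glue : ∀ U (s : C.Sec U), (∀ z ∈ U, ∃ V, ∃ h : V ≤ U, z ∈ V ∧ C.restr h s ∈ carrier V) →
    s ∈ carrier U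
  smul_mem : ∀ U (f : OnePoint ℂ → ℂ), (∀ z ∈ U, HolAt f z) → ∀ s ∈ carrier U,
    C.mulFun (fun x => f x) s ∈ carrier U

variable {C} in
/-- Inclusion of subsheaves. -/
def OSub.Le (A B : C.OSub) : Prop := ∀ U, A.carrier U ≤ B.carrier U

/-- The sheaf of holomorphic sections of `E`. -/
def sheafE : C.OSub where
  carrier U :=
    { carrier := {s | ∀ z ∈ U, C.ExtendsAt (C.extend s) z}
      add_mem' := fun {s t} hs ht z hz => by
        obtain ⟨σ, hσ⟩ := hs z hz
        obtain ⟨τ, hτ⟩ := ht z hz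
        exact ⟨_, (hσ.add hτ).congr (Eventually.of_forall fun x => (extend_add s t x).symm)⟩
      zero_mem' := fun z _ => ⟨_, HolBundle.HolSec.zero z,
        Eventually.of_forall fun x => extend_zero x⟩
      smul_mem' := fun a s hs z hz => by
        obtain ⟨σ, hσ⟩ := hs z hz
        exact ⟨_, (hσ.smul (HolAt.const a z)).congr
          (Eventually.of_forall fun x => (extend_smul a s x).symm)⟩ }
  hol U s hs x := (hs x.1 x.2.1).holSecC x.2.2
  res_mem U V h s hs z hz := (hs z (h hz)).congr
    ((extend_restr_near h s hz).mono fun _ hx => hx.symm)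
  glue U s hs z hz := by
    obtain ⟨V, h, hzV, hV⟩ := hs z hz
    exact (hV z hzV).congr (extend_restr_near h s hzV)
  smul_mem U f hf s hs z hz := by
    obtain ⟨σ, hσ⟩ := hs z hz
    exact ⟨_, (hσ.smul (hf z hz)).congr
      (Eventually.of_forall fun x => (extend_mulFun (fun x => f x) s x).symm)⟩

/-- The local condition at `z` on a `1`-form `s dx` to be a section of `F`: it is holomorphic at the
nonsingular points, has at most a simple pole at `p ∈ P`, with residue in the image of the residue
of `∇`, and at most a double pole at infinity (where `s dx = - x² s dt` for `t = 1/x`). -/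
structure FCond (s : ∀ x : ℂ, E.Fib x) (z : OnePoint ℂ) : Prop where
  reg : ¬ C.IsSing z → C.ExtendsAt s z
  fin : ∀ p ∈ C.P, z = (p : OnePoint ℂ) → ∃ v, C.HasResidue s p v ∧ C.InResidueImage p v
  inf : z = OnePoint.infty →
    C.ExtendsAt (fun x => (x⁻¹) ^ 2 • (-(x ^ 2)) • s x) OnePoint.infty

variable {C}

lemma FCond.congr {s t : ∀ x : ℂ, E.Fib x} {z : OnePoint ℂ} (h : C.FCond s z)
    (e : ∀ᶠ x in C.near z, s x = t x) : C.FCond t z where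
  reg hz := (h.reg hz).congr e
  fin p hp hz := by
    subst hz
    obtain ⟨v, ⟨σ, hσ, hv⟩, h'⟩ := h.fin p hp rfl
    exact ⟨v, ⟨σ, hσ.congr (e.mono fun x hx => by simp only [hx]), hv⟩, h'⟩
  inf hz := by
    subst hz
    exact (h.inf rfl).congr (e.mono fun x hx => by simp only [hx])

lemma InResidueImage.add {p : ℂ} {v w : E.Fib p} (hv : C.InResidueImage p v)
    (hw : C.InResidueImage p w) : C.InResidueImage p (v + w) := by
  obtain ⟨σ, hσ, σ', h1, rfl⟩ := hv
  obtain ⟨τ, hτ, τ', h2, rfl⟩ := hw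
  refine ⟨_, hσ.add hτ, _, (h1.add h2).congr ?_, rfl⟩
  filter_upwards [holSecC_near (C := C) hσ, holSecC_near (C := C) hτ, C.near_notMem p]
    with x hx hx' hxP
  rw [D_add' hxP hx hx', smul_add]

lemma InResidueImage.smul {p : ℂ} (a : ℂ) {v : E.Fib p} (hv : C.InResidueImage p v) :
    C.InResidueImage p (a • v) := by
  obtain ⟨σ, hσ, σ', h1, rfl⟩ := hv
  refine ⟨_, HolBundle.HolSec.smul (HolAt.const a p) hσ, _, (h1.smul (HolAt.const a p)).congr ?_,
    rfl⟩
  filter_upwards [holSecC_near (C := C) hσ, C.near_notMem p] with x hx hxP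
  rw [D_const_smul a hxP hx, smul_comm]

lemma FCond.add {s t : ∀ x : ℂ, E.Fib x} {z : OnePoint ℂ} (h : C.FCond s z) (h' : C.FCond t z) :
    C.FCond (fun x => s x + t x) z where
  reg hz := by
    obtain ⟨σ, hσ⟩ := h.reg hz
    obtain ⟨τ, hτ⟩ := h'.reg hz
    exact ⟨_, hσ.add hτ⟩
  fin p hp hz := by
    obtain ⟨v, ⟨σ, hσ, rfl⟩, hv⟩ := h.fin p hp hz
    obtain ⟨w, ⟨τ, hτ, rfl⟩, hw⟩ := h'.fin p hp hz
    exact ⟨_, ⟨_, (hσ.add hτ).congr (Eventually.of_forall fun x => (smul_add _ _ _).symm), rfl⟩,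
      hv.add hw⟩
  inf hz := by
    obtain ⟨σ, hσ⟩ := h.inf hz
    obtain ⟨τ, hτ⟩ := h'.inf hz
    exact ⟨_, (hσ.add hτ).congr (Eventually.of_forall fun x => by simp only [smul_add])⟩

lemma FCond.smul {f : OnePoint ℂ → ℂ} {s : ∀ x : ℂ, E.Fib x} {z : OnePoint ℂ} (hf : HolAt f z)
    (h : C.FCond s z) : C.FCond (fun x => f x • s x) z where
  reg hz := by
    obtain ⟨σ, hσ⟩ := h.reg hz
    exact ⟨_, hσ.smul hf⟩
  fin p hp hz := by
    subst hz
    obtain ⟨v, ⟨σ, hσ, rfl⟩, hv⟩ := h.fin p hp rfl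
    exact ⟨_, ⟨_, (hσ.smul hf).congr (Eventually.of_forall fun x => smul_comm _ _ _), rfl⟩,
      hv.smul _⟩
  inf hz := by
    subst hz
    obtain ⟨σ, hσ⟩ := h.inf rfl
    exact ⟨_, (hσ.smul hf).congr (Eventually.of_forall fun x => by
      simp only [smul_comm (f x)])⟩

lemma ExtendsAt.fCond {s : ∀ x : ℂ, E.Fib x} {z : OnePoint ℂ} (hs : C.ExtendsAt s z)
    (hz : ∀ p ∈ C.P, z ≠ (p : OnePoint ℂ)) : C.FCond s z where
  reg _ := hs
  fin p hp h := absurd h (hz p hp)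
  inf h := by
    subst h
    obtain ⟨σ, hσ⟩ := hs
    refine ⟨_, (hσ.smul (HolAt.const (-1) _)).congr ?_⟩
    have hn : C.near OnePoint.infty ≤ cocompact ℂ := by
      rw [← comap_infty]; exact C.near_le _
    filter_upwards [hn (eventually_ne_cocompact 0)] with x hx
    rw [smul_smul]
    congr 1
    field_simp

lemma ExtendsAt.fCond_nabla {s : ∀ x : ℂ, E.Fib x} {z : OnePoint ℂ} (ξ : ℂ)
    (hs : C.ExtendsAt s z) : C.FCond (fun x => C.D s x - ξ • s x) z := by
  obtain ⟨σ, hσ⟩ := hs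
  by_cases h : ∃ p ∈ C.P, z = (p : OnePoint ℂ)
  · obtain ⟨p, hp, rfl⟩ := h
    obtain ⟨v, τ, hτ, rfl⟩ := exists_residue (C := C) hp hσ.1
    refine ⟨fun h => absurd (Or.inr ⟨p, hp, rfl⟩) h, fun q hq hqp => ?_,
      fun h => absurd h (OnePoint.coe_ne_infty p)⟩
    obtain rfl := OnePoint.coe_injective hqp
    refine ⟨τ p, ⟨_, (hτ.add (hσ.smul ((HolAt.const (-ξ) _).mul (holAt_subFun p p)))).congr ?_, ?_⟩,
      ⟨σ, hσ.1, τ, hτ, rfl⟩⟩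
    · filter_upwards [D_near hσ] with x hx
      change _ + (-ξ * (x - p)) • s x = _
      rw [hx, smul_sub, smul_smul, mul_comm (x - p) ξ, neg_mul, neg_smul, ← sub_eq_add_neg]
    · simp [subFun]
  · push Not at h
    refine ExtendsAt.fCond ?_ h
    have h1 : C.ExtendsAt (C.D fun x => σ x) z := by
      induction z using OnePoint.rec with
      | infty => exact D_extends_infty hσ.1
      | coe w =>
        have hw : w ∉ C.P := fun hw => h w hw rfl
        refine ⟨@OnePoint.rec ℂ (fun x => E.Fib x) 0 fun u => C.D (fun x => σ x) u,
          HolBundle.holSec_coe.2 (C.D_hol _ w hw (HolBundle.holSec_coe.1 hσ.1)),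
          Eventually.of_forall fun x => rfl⟩
    obtain ⟨τ, hτ⟩ := h1
    refine ⟨_, (hτ.add (hσ.smul (HolAt.const (-ξ) _))).congr ?_⟩
    filter_upwards [D_near hσ] with x hx
    rw [hx, neg_smul, sub_eq_add_neg]

variable (C)

/-- The sheaf `F` of `E`-valued `1`-forms with at most simple poles in `P`, with residue at `p ∈ P`
in the image of the residue of `∇`, and at most a double pole at infinity. The form `s dx` is
represented by `s`. -/
def sheafF : C.OSub where
  carrier U :=
    { carrier := {s | ∀ z ∈ U, C.FCond (C.extend s) z}
      add_mem' := fun {s t} hs ht z hz => ((hs z hz).add (ht z hz)).congr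
        (Eventually.of_forall fun x => (extend_add s t x).symm)
      zero_mem' := fun z _ => by
        have h0 : ∀ x, C.extend (0 : C.Sec U) x = 0 := extend_zero
        have hz : C.ExtendsAt (C.extend (0 : C.Sec U)) z :=
          ⟨_, HolBundle.HolSec.zero z, Eventually.of_forall h0⟩
        refine (hz.fCond_nabla 0).congr ?_
        filter_upwards [C.near_notMem z] with x hx
        rw [h0, smul_zero, sub_zero]
        exact (C.D_congr _ (fun _ => 0) x hx (Eventually.of_forall h0)).trans (D_zero hx)
      smul_mem' := fun a s hs z hz => ((hs z hz).smul (HolAt.const a z)).congr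
        (Eventually.of_forall fun x => (extend_smul a s x).symm) }
  hol U s hs x := ((hs x.1 x.2.1).reg fun h => by
    rcases h with h | ⟨p, hp, h⟩
    · exact OnePoint.coe_ne_infty _ h
    · exact x.2.2 (OnePoint.coe_injective h ▸ hp)).holSecC x.2.2
  res_mem U V h s hs z hz := (hs z (h hz)).congr
    ((extend_restr_near h s hz).mono fun _ hx => hx.symm)
  glue U s hs z hz := by
    obtain ⟨V, h, hzV, hV⟩ := hs z hz
    exact (hV z hzV).congr (extend_restr_near h s hzV)
  smul_mem U f hf s hs z hz := ((hs z hz).smul (hf z hz)).congr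
    (Eventually.of_forall fun x => (extend_mulFun (fun x => f x) s x).symm)

/-! ### Submodules over differential operators, and minimal extensions -/

/-- A `𝒟`-submodule of the meromorphic bundle `E(*(P ∪ ∞))`: a sub-`𝒪`-module stable under the
action of the vector fields `∂_x` at finite distance and `∂_t = - x² ∂_x`, `t = 1/x`, away from
`x = 0`. -/
@[ext]
structure DSub extends C.OSub where
  mero : ∀ U, ∀ s ∈ carrier U, C.IsMero s
  del_mem : ∀ U, OnePoint.infty ∉ U → ∀ s ∈ carrier U, C.del s ∈ carrier U
  del_mem' : ∀ U, ((0 : ℂ) : OnePoint ℂ) ∉ U → ∀ s ∈ carrier U,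
    C.mulFun (fun x => -(x ^ 2)) (C.del s) ∈ carrier U

namespace DSub

variable {C}

/-- The `𝒟`-module `N` is coherent, that is locally generated by finitely many sections. -/
def IsCoherent (N : C.DSub) : Prop :=
  ∀ z, ∃ W : Opens (OnePoint ℂ), z ∈ W ∧ ∃ T : Finset (C.Sec W), (∀ s ∈ T, s ∈ N.carrier W) ∧
    ∀ N' : C.DSub, (∀ s ∈ T, s ∈ N'.carrier W) → ∀ V ≤ W, N.carrier V ≤ N'.carrier V

/-- `N` is an extension of the meromorphic bundle: `𝒪(*(P ∪ ∞)) ⊗ N` is all of it. -/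
def IsExtension (N : C.DSub) : Prop :=
  ∀ U (s : C.Sec U), C.IsMero s → ∀ z ∈ U, ∃ W, ∃ h : W ≤ U, z ∈ W ∧
    ∃ k : ℕ, (¬ C.IsSing z → k = 0) ∧ C.mulFun (fun x => unif z x ^ k) (C.restr h s) ∈ N.carrier W

/-- `N` is a minimal extension of the meromorphic bundle: a (coherent) extension without nonzero
coherent submodule or quotient module supported in a point. -/
structure IsMinimalExtension (N : C.DSub) : Prop where
  coherent : N.IsCoherent
  extension : N.IsExtension
  no_sub : ∀ K : C.DSub, K.IsCoherent → K.Le N.toOSub → ∀ z : OnePoint ℂ,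
    (∀ U, z ∉ U → K.carrier U = ⊥) → ∀ U, K.carrier U = ⊥
  no_quot : ∀ K : C.DSub, K.IsCoherent → K.Le N.toOSub → ∀ z : OnePoint ℂ,
    (∀ U, z ∉ U → K.carrier U = N.carrier U) → K = N

end DSub

variable {C}

lemma restr_nabla (ξ : ℂ) {U V : Opens (OnePoint ℂ)} (h : V ≤ U) (s : C.Sec U) :
    C.restr h (C.nabla ξ s) = C.nabla ξ (C.restr h s) := by
  funext x
  change C.D (C.extend s) x.1 - _ = C.D (C.extend (C.restr h s)) x.1 - _
  congr 1
  refine C.D_congr _ _ x.1 x.2.2 ?_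
  have : ∀ᶠ y : ℂ in 𝓝 x.1, (y : OnePoint ℂ) ∈ V :=
    (OnePoint.continuous_coe.tendsto x.1).eventually (V.isOpen.mem_nhds x.2.1)
  exact this.mono fun y hy => (extend_restr h s hy).symm

variable (C) in
/-- `∇_ξ` maps the sheaf `A` to the sheaf `B`. -/
def MapsTo (ξ : ℂ) (A B : C.OSub) : Prop :=
  ∀ U, ∀ s ∈ A.carrier U, C.nabla ξ s ∈ B.carrier U

variable (C) in
lemma mapsTo_E_F (ξ : ℂ) : C.MapsTo ξ C.sheafE C.sheafF := fun _ s hs z hz =>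
  ((hs z hz).fCond_nabla ξ).congr ((extend_nabla ξ s hz).mono fun _ hx => hx.symm)

lemma DSub.mapsTo (N : C.DSub) (ξ : ℂ) : C.MapsTo ξ N.toOSub N.toOSub := by
  intro U s hs
  have key : ∀ V (h : V ≤ U), C.del (C.restr h s) ∈ N.carrier V →
      C.restr h (C.nabla ξ s) ∈ N.carrier V := fun V h hV => by
    rw [restr_nabla]
    exact sub_mem hV (Submodule.smul_mem _ ξ (N.res_mem U V h s hs))
  refine N.glue U _ fun z hz => ?_
  induction z using OnePoint.rec with
  | infty =>
    let V : Opens (OnePoint ℂ) := U ⊓ ⟨{((0 : ℂ) : OnePoint ℂ)}ᶜ, isOpen_compl_singleton⟩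
    have h0 : ((0 : ℂ) : OnePoint ℂ) ∉ V := fun h => h.2 rfl
    refine ⟨V, inf_le_left, ⟨hz, OnePoint.infty_ne_coe 0⟩, key _ _ ?_⟩
    have h1 := N.del_mem' V h0 _ (N.res_mem U V inf_le_left s hs)
    have h2 := N.smul_mem V (fun x => -1 * (invFun x * invFun x)) (fun w hw => by
      refine (HolAt.const _ _).mul ?_
      have : HolAt invFun w := by
        induction w using OnePoint.rec with
        | infty => exact holAt_invFun
        | coe w => exact analyticAt_inv fun h => h0 (h ▸ hw)
      exact this.mul this) _ h1
    convert h2 using 1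
    funext x
    have hx : x.1 ≠ 0 := fun h => h0 (h ▸ x.2.1)
    change _ = (-1 * (x.1⁻¹ * x.1⁻¹)) • (-(x.1 ^ 2)) • C.del _ x
    rw [smul_smul]
    have : -1 * (x.1⁻¹ * x.1⁻¹) * -(x.1 ^ 2) = 1 := by field_simp
    rw [this, one_smul]
  | coe w =>
    let V : Opens (OnePoint ℂ) := U ⊓ ⟨{OnePoint.infty}ᶜ, isOpen_compl_singleton⟩
    refine ⟨V, inf_le_left, ⟨hz, OnePoint.coe_ne_infty w⟩, key _ _ ?_⟩
    exact N.del_mem V (fun h => h.2 rfl) _ (N.res_mem U V inf_le_left s hs)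

end SingConn

namespace SingConn

variable {r : ℕ} {E : HolBundle r} {C : SingConn E}

/-! ### The sheaves of complex vector spaces and the two-term complexes -/

/-- The presheaf of complex vector spaces underlying `A`. -/
def OSub.toPresheaf (A : C.OSub) : TopCat.Presheaf (ModuleCat.{0} ℂ) (TopCat.of (OnePoint ℂ)) where
  obj U := ModuleCat.of ℂ (A.carrier U.unop)
  map f := ModuleCat.ofHom ((C.restr f.unop.le).restrict fun s hs => A.res_mem _ _ _ s hs)
  map_id _ := rfl
  map_comp _ _ := rfl

lemma OSub.isSheaf (A : C.OSub) : A.toPresheaf.IsSheaf := by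
  rw [TopCat.Presheaf.isSheaf_iff_isSheafUniqueGluing]
  intro ι U sf hsf
  have hc : ∀ i j (x : ℂ) (hi : (x : OnePoint ℂ) ∈ U i) (hj : (x : OnePoint ℂ) ∈ U j)
      (hP : x ∉ C.P), (sf i).1 ⟨x, hi, hP⟩ = (sf j).1 ⟨x, hj, hP⟩ := fun i j x hi hj hP =>
    congrFun (congrArg Subtype.val (hsf i j)) ⟨x, ⟨hi, hj⟩, hP⟩
  have hm : ∀ x : C.Punct (iSup U), ∃ i, (x.1 : OnePoint ℂ) ∈ U i := fun x => Opens.mem_iSup.1 x.2.1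
  choose φ hφ using hm
  let s : C.Sec (iSup U) := fun x => (sf (φ x)).1 ⟨x.1, hφ x, x.2.2⟩
  have hr : ∀ i, C.restr (le_iSup U i) s = (sf i).1 := fun i =>
    funext fun x => hc _ i x.1 (hφ ⟨x.1, le_iSup U i x.2.1, x.2.2⟩) x.2.1 x.2.2
  have hs : s ∈ A.carrier (iSup U) := A.glue _ _ fun z hz => by
    obtain ⟨i, hi⟩ := Opens.mem_iSup.1 hz
    exact ⟨U i, le_iSup U i, hi, by rw [hr i]; exact (sf i).2⟩
  refine ⟨⟨s, hs⟩, fun i => Subtype.ext (hr i), fun t ht => Subtype.ext (funext fun x => ?_)⟩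
  exact congrFun (congrArg Subtype.val (ht (φ x))) ⟨x.1, hφ x, x.2.2⟩

/-- The sheaf of complex vector spaces underlying `A`. -/
def OSub.toSheaf (A : C.OSub) : TopCat.Sheaf (ModuleCat.{0} ℂ) (TopCat.of (OnePoint ℂ)) :=
  ⟨A.toPresheaf, A.isSheaf⟩

/-- The inclusion of subsheaves. -/
def OSub.incl {A B : C.OSub} (h : A.Le B) : A.toSheaf ⟶ B.toSheaf :=
  ⟨{ app := fun U => ModuleCat.ofHom (Submodule.inclusion (h U.unop))
     naturality := fun _ _ _ => rfl }⟩

/-- The operator `∇_ξ` as a linear map between spaces of sections. -/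
def MapsTo.linearMap {ξ : ℂ} {A B : C.OSub} (h : C.MapsTo ξ A B) (U : Opens (OnePoint ℂ)) :
    A.carrier U →ₗ[ℂ] B.carrier U where
  toFun s := ⟨C.nabla ξ s.1, h U s.1 s.2⟩
  map_add' s t := Subtype.ext (funext fun x => by
    change C.D (C.extend (s.1 + t.1)) x.1 - ξ • (s.1 x + t.1 x) =
      (C.D (C.extend s.1) x.1 - ξ • s.1 x) + (C.D (C.extend t.1) x.1 - ξ • t.1 x)
    rw [C.D_congr _ _ x.1 x.2.2 (Eventually.of_forall (extend_add s.1 t.1)),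
      D_add' x.2.2 (A.hol U _ s.2 x) (A.hol U _ t.2 x), smul_add]
    abel)
  map_smul' a s := Subtype.ext (funext fun x => by
    change C.D (C.extend (a • s.1)) x.1 - ξ • (a • s.1 x) =
      a • (C.D (C.extend s.1) x.1 - ξ • s.1 x)
    rw [C.D_congr _ _ x.1 x.2.2 (Eventually.of_forall (extend_smul a s.1)),
      D_const_smul a x.2.2 (A.hol U _ s.2 x), smul_sub, smul_comm])

/-- The operator `∇_ξ` as a morphism of sheaves. -/
def MapsTo.hom {ξ : ℂ} {A B : C.OSub} (h : C.MapsTo ξ A B) : A.toSheaf ⟶ B.toSheaf :=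
  ⟨{ app := fun U => ModuleCat.ofHom (h.linearMap U.unop)
     naturality := fun _ _ f => by
      ext s
      exact Subtype.ext (restr_nabla ξ f.unop.le s.1).symm }⟩

lemma MapsTo.hom_incl {ξ : ℂ} {A B A' B' : C.OSub} (h : C.MapsTo ξ A B) (h' : C.MapsTo ξ A' B')
    (hA : A.Le A') (hB : B.Le B') : OSub.incl hA ≫ h'.hom = h.hom ≫ OSub.incl hB := rfl

end SingConn

section TwoTerm

variable {X : TopCat.{0}} {A B A' B' : TopCat.Sheaf (ModuleCat.{0} ℂ) X}

lemma rel_zero_one : (ComplexShape.up ℤ).Rel 0 1 := by simp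

/-- The complex `A → B` of sheaves, with `A` in degree `0` and `B` in degree `1`. -/
abbrev twoTerm (d : A ⟶ B) : CochainComplex (TopCat.Sheaf (ModuleCat.{0} ℂ) X) ℤ :=
  HomologicalComplex.double d rel_zero_one

/-- The morphism of two-term complexes given by a commutative square. -/
def twoTermMap {d : A ⟶ B} {d' : A' ⟶ B'} (α : A ⟶ A') (β : B ⟶ B') (w : α ≫ d' = d ≫ β) :
    twoTerm d ⟶ twoTerm d' :=
  HomologicalComplex.mkHomFromDouble rel_zero_one zero_ne_one
    (α ≫ (HomologicalComplex.doubleXIso₀ d' rel_zero_one).inv)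
    (β ≫ (HomologicalComplex.doubleXIso₁ d' rel_zero_one zero_ne_one).inv)
    (by
      rw [HomologicalComplex.double_d d' rel_zero_one zero_ne_one]
      simp [reassoc_of% w])
    (fun k hk => by
      rw [HomologicalComplex.double_d_eq_zero₀ _ _ _ _ one_ne_zero, Limits.comp_zero])

/-! ### First hypercohomology of a two-term complex, by Čech cocycles -/

/-- Open covers of `X`, in the form of a choice of an open neighbourhood of every point. They are
ordered by reverse pointwise inclusion. -/
structure PCover (X : TopCat.{0}) where
  nbhd : X → Opens X
  mem : ∀ x, x ∈ nbhd x

instance : Preorder (PCover X) where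
  le 𝒰 𝒱 := ∀ x, 𝒱.nbhd x ≤ 𝒰.nbhd x
  le_refl _ _ := le_rfl
  le_trans _ _ _ h h' x := (h' x).trans (h x)

/-- Restriction of sections of a sheaf. -/
def rho (A : TopCat.Sheaf (ModuleCat.{0} ℂ) X) {U V : Opens X} (h : V ≤ U) :
    A.obj.obj (op U) →ₗ[ℂ] A.obj.obj (op V) := (A.obj.map (homOfLE h).op).hom

/-- The map on sections given by a morphism of sheaves. -/
def onSec (d : A ⟶ B) (U : Opens X) : A.obj.obj (op U) →ₗ[ℂ] B.obj.obj (op U) :=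
  (d.hom.app (op U)).hom

lemma rho_rho {U V W : Opens X} (h : V ≤ U) (h' : W ≤ V) (a : A.obj.obj (op U)) :
    rho A h' (rho A h a) = rho A (h'.trans h) a := by
  have := A.obj.map_comp (homOfLE h).op (homOfLE h').op
  exact (congrArg (fun f => f.hom a) this).symm

lemma onSec_rho (d : A ⟶ B) {U V : Opens X} (h : V ≤ U) (a : A.obj.obj (op U)) :
    onSec d V (rho A h a) = rho B h (onSec d U a) :=
  congrArg (fun f => f.hom a) (d.hom.naturality (homOfLE h).op)

/-- Čech cochains of total degree one of the complex `A → B`: sections of `B` over the members of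
the cover, and sections of `A` over the intersections of two of them. -/
abbrev Cochain1 (A B : TopCat.Sheaf (ModuleCat.{0} ℂ) X) (𝒰 : PCover X) : Type :=
  (∀ x, B.obj.obj (op (𝒰.nbhd x))) × (∀ x y, A.obj.obj (op (𝒰.nbhd x ⊓ 𝒰.nbhd y)))

/-- The Čech `1`-cocycles `(b, a)`: `a_xy + a_yz = a_xz` and `b_y - b_x = d a_xy`. -/
def cocycles (d : A ⟶ B) (𝒰 : PCover X) : Submodule ℂ (Cochain1 A B 𝒰) where
  carrier := {c | (∀ x y, rho B inf_le_right (c.1 y) - rho B inf_le_left (c.1 x) =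
        onSec d _ (c.2 x y)) ∧
      ∀ x y z, rho A (V := 𝒰.nbhd x ⊓ 𝒰.nbhd y ⊓ 𝒰.nbhd z) inf_le_left (c.2 x y) +
        rho A (le_inf (inf_le_left.trans inf_le_right) inf_le_right) (c.2 y z) =
          rho A (le_inf (inf_le_left.trans inf_le_left) inf_le_right) (c.2 x z)}
  add_mem' {c c'} h h' := by
    refine ⟨fun x y => ?_, fun x y z => ?_⟩
    · simp only [Prod.fst_add, Prod.snd_add, Pi.add_apply, map_add, ← h.1 x y, ← h'.1 x y]; abel
    · simp only [Prod.snd_add, Pi.add_apply, map_add, ← h.2 x y z, ← h'.2 x y z]; abel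
  zero_mem' := by
    refine ⟨fun x y => ?_, fun x y z => ?_⟩ <;> simp
  smul_mem' t c h := by
    refine ⟨fun x y => ?_, fun x y z => ?_⟩
    · simp only [Prod.smul_fst, Prod.smul_snd, Pi.smul_apply, map_smul, ← h.1 x y, smul_sub]
    · simp only [Prod.smul_snd, Pi.smul_apply, map_smul, ← h.2 x y z, smul_add]

/-- The Čech coboundary `(a_x) ↦ (d a_x, a_y - a_x)`. -/
def coboundary (d : A ⟶ B) (𝒰 : PCover X) :
    (∀ x, A.obj.obj (op (𝒰.nbhd x))) →ₗ[ℂ] cocycles d 𝒰 where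
  toFun a := ⟨(fun x => onSec d _ (a x), fun x y => rho A inf_le_right (a y) -
      rho A inf_le_left (a x)), by
    refine ⟨fun x y => ?_, fun x y z => ?_⟩
    · simp only [map_sub, onSec_rho]
    · simp only [map_sub, rho_rho]; abel⟩
  map_add' a a' := by
    refine Subtype.ext (Prod.ext (funext fun x => ?_) (funext fun x => funext fun y => ?_))
    · simp
    · simp only [Pi.add_apply, map_add, Submodule.coe_add, Prod.snd_add]; abel
  map_smul' t a := by
    refine Subtype.ext (Prod.ext (funext fun x => ?_) (funext fun x => funext fun y => ?_))
    · simp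
    · simp [smul_sub]

/-- First Čech hypercohomology of `A → B` with respect to the cover `𝒰`. -/
abbrev CoverH1 (d : A ⟶ B) (𝒰 : PCover X) : Type :=
  cocycles d 𝒰 ⧸ LinearMap.range (coboundary d 𝒰)

/-- Restriction of cocycles to a finer cover. -/
def cocyclesRes (d : A ⟶ B) {𝒰 𝒱 : PCover X} (h : 𝒰 ≤ 𝒱) : cocycles d 𝒰 →ₗ[ℂ] cocycles d 𝒱 where
  toFun c := ⟨(fun x => rho B (h x) (c.1.1 x),
      fun x y => rho A (inf_le_inf (h x) (h y)) (c.1.2 x y)), by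
    refine ⟨fun x y => ?_, fun x y z => ?_⟩
    · have := congrArg (rho B (inf_le_inf (h x) (h y))) (c.2.1 x y)
      simp only [map_sub, rho_rho, ← onSec_rho] at this ⊢
      exact this
    · have := congrArg (rho A (inf_le_inf (inf_le_inf (h x) (h y)) (h z))) (c.2.2 x y z)
      simp only [map_add, rho_rho] at this ⊢
      exact this⟩
  map_add' _ _ := Subtype.ext (by
    refine Prod.ext (funext fun x => ?_) (funext fun x => funext fun y => ?_) <;> simp)
  map_smul' _ _ := Subtype.ext (by
    refine Prod.ext (funext fun x => ?_) (funext fun x => funext fun y => ?_) <;> simp)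

/-- The refinement map in Čech hypercohomology. -/
def coverH1Res (d : A ⟶ B) (𝒰 𝒱 : PCover X) (h : 𝒰 ≤ 𝒱) : CoverH1 d 𝒰 →ₗ[ℂ] CoverH1 d 𝒱 :=
  Submodule.mapQ _ _ (cocyclesRes d h) (by
    rintro _ ⟨a, rfl⟩
    refine ⟨fun x => rho A (h x) (a x), Subtype.ext (Prod.ext (funext fun x => ?_)
      (funext fun x => funext fun y => ?_))⟩
    · exact onSec_rho d (h x) (a x)
    · change rho A _ (rho A _ (a y)) - rho A _ (rho A _ (a x)) =
        rho A _ (rho A _ (a y) - rho A _ (a x))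
      simp only [map_sub, rho_rho])

open Classical in
/-- The first hypercohomology of the complex `A → B`: the colimit of the Čech hypercohomologies over
all open covers. -/
abbrev H1 (d : A ⟶ B) : Type := Module.DirectLimit (CoverH1 d) (coverH1Res d)

open Classical in
/-- The class in hypercohomology of a Čech cocycle. -/
def H1.mk (d : A ⟶ B) (𝒰 : PCover X) (c : cocycles d 𝒰) : H1 d :=
  Module.DirectLimit.of ℂ (PCover X) (CoverH1 d) (coverH1Res d) 𝒰 (Submodule.Quotient.mk c)

lemma onSec_comm {d : A ⟶ B} {d' : A' ⟶ B'} {α : A ⟶ A'} {β : B ⟶ B'} (w : α ≫ d' = d ≫ β)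
    (U : Opens X) (a : A.obj.obj (op U)) :
    onSec d' U (onSec α U a) = onSec β U (onSec d U a) :=
  congrArg (fun f => (f.hom.app (op U)).hom a) w

/-- The map on cocycles induced by a commutative square. -/
def cocyclesMap {d : A ⟶ B} {d' : A' ⟶ B'} (α : A ⟶ A') (β : B ⟶ B') (w : α ≫ d' = d ≫ β)
    (𝒰 : PCover X) : cocycles d 𝒰 →ₗ[ℂ] cocycles d' 𝒰 where
  toFun c := ⟨(fun x => onSec β _ (c.1.1 x), fun x y => onSec α _ (c.1.2 x y)), by
    refine ⟨fun x y => ?_, fun x y z => ?_⟩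
    · have := congrArg (onSec β _) (c.2.1 x y)
      simp only [map_sub, onSec_rho, ← onSec_comm w] at this ⊢
      exact this
    · have := congrArg (onSec α _) (c.2.2 x y z)
      simp only [map_add, onSec_rho] at this ⊢
      exact this⟩
  map_add' _ _ := Subtype.ext (by
    refine Prod.ext (funext fun x => ?_) (funext fun x => funext fun y => ?_) <;> simp)
  map_smul' _ _ := Subtype.ext (by
    refine Prod.ext (funext fun x => ?_) (funext fun x => funext fun y => ?_) <;> simp)

/-- The map on Čech hypercohomology induced by a commutative square. -/
def coverH1Map {d : A ⟶ B} {d' : A' ⟶ B'} (α : A ⟶ A') (β : B ⟶ B') (w : α ≫ d' = d ≫ β)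
    (𝒰 : PCover X) : CoverH1 d 𝒰 →ₗ[ℂ] CoverH1 d' 𝒰 :=
  Submodule.mapQ _ _ (cocyclesMap α β w 𝒰) (by
    rintro _ ⟨a, rfl⟩
    refine ⟨fun x => onSec α _ (a x), Subtype.ext (Prod.ext (funext fun x => ?_)
      (funext fun x => funext fun y => ?_))⟩
    · exact onSec_comm w _ (a x)
    · change rho A' _ (onSec α _ (a y)) - rho A' _ (onSec α _ (a x)) =
        onSec α _ (rho A _ (a y) - rho A _ (a x))
      simp only [map_sub, onSec_rho])

open Classical in
/-- The map on first hypercohomology induced by a commutative square, that is by a morphism of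
two-term complexes. -/
def H1.map {d : A ⟶ B} {d' : A' ⟶ B'} (α : A ⟶ A') (β : B ⟶ B') (w : α ≫ d' = d ≫ β) :
    H1 d →ₗ[ℂ] H1 d' :=
  Module.DirectLimit.map (coverH1Map α β w) (fun 𝒰 𝒱 h => by
    refine LinearMap.ext fun c => ?_
    obtain ⟨c, rfl⟩ := Submodule.Quotient.mk_surjective _ c
    refine congrArg Submodule.Quotient.mk (Subtype.ext (Prod.ext (funext fun x => ?_)
      (funext fun x => funext fun y => ?_)))
    · exact onSec_rho β (h x) (c.1.1 x)
    · exact onSec_rho α (inf_le_inf (h x) (h y)) (c.1.2 x y))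

end TwoTerm

namespace SingConn

variable {r : ℕ} {E : HolBundle r} {C : SingConn E}

/-! ### The holomorphic structure on the family of hypercohomologies -/

/-- The family `m ξ` of sections of `A` over `U` depends holomorphically on `ξ ∈ V`: it is a section
over `U × V` of the pullback of `A` to the product, that is, locally on `U × V` a finite combination
of sections of `A` with coefficients that are holomorphic on the product. -/
def OSub.HolFamily (A : C.OSub) (U : Opens (OnePoint ℂ)) (V : Set ℂ)
    (m : ℂ → A.carrier U) : Prop :=
  ∀ z ∈ U, ∀ ξ₀ ∈ V, ∃ W : Opens (OnePoint ℂ), ∃ h : W ≤ U, z ∈ W ∧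
    ∃ (n : ℕ) (s : Fin n → A.carrier W) (c : Fin n → OnePoint ℂ → ℂ → ℂ),
      (∀ k, HolAt₂ (c k) z ξ₀) ∧
        ∀ᶠ ξ in 𝓝 ξ₀, ∀ x : C.Punct W,
          C.restr h (m ξ).1 x = ∑ k, c k (x.1 : OnePoint ℂ) ξ • (s k).1 x

/-- The section `ξ ↦ η ξ` over `V` of the family of first hypercohomologies of the complexes
`∇_ξ : A → B` is holomorphic: locally on `V` it is represented by Čech cocycles which depend
holomorphically on `ξ`. -/
def IsHolSection {A B : C.OSub} (h : ∀ ξ, C.MapsTo ξ A B) (V : Set ℂ)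
    (η : ∀ ξ, H1 (h ξ).hom) : Prop :=
  ∀ ξ₀ ∈ V, ∃ V' ⊆ V, IsOpen V' ∧ ξ₀ ∈ V' ∧ ∃ 𝒰 : PCover (TopCat.of (OnePoint ℂ)),
    ∃ (b : ∀ x, ℂ → B.carrier (𝒰.nbhd x))
      (a : ∀ x y, ℂ → A.carrier (𝒰.nbhd x ⊓ 𝒰.nbhd y)),
      (∀ x, B.HolFamily (𝒰.nbhd x) V' (b x)) ∧
      (∀ x y, A.HolFamily (𝒰.nbhd x ⊓ 𝒰.nbhd y) V' (a x y)) ∧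
      ∀ ξ ∈ V', ∃ hc : ((fun x => b x ξ, fun x y => a x y ξ) :
          Cochain1 A.toSheaf B.toSheaf 𝒰) ∈ cocycles (h ξ).hom 𝒰,
        η ξ = H1.mk (h ξ).hom 𝒰 ⟨_, hc⟩

/-! ### The two complexes and the comparison map -/

variable (C) in
/-- The complex `∇_ξ : E → F`. -/
abbrev complexEF (ξ : ℂ) :
    CochainComplex (TopCat.Sheaf (ModuleCat.{0} ℂ) (TopCat.of (OnePoint ℂ))) ℤ :=
  twoTerm (C.mapsTo_E_F ξ).hom

/-- The twisted de Rham complex `∂_x - ξ : N → N` of a `𝒟`-module `N`. -/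
abbrev DSub.DR (N : C.DSub) (ξ : ℂ) :
    CochainComplex (TopCat.Sheaf (ModuleCat.{0} ℂ) (TopCat.of (OnePoint ℂ))) ℤ :=
  twoTerm (N.mapsTo ξ).hom

/-- The inclusion of `∇_ξ : E → F` in the twisted de Rham complex of a `𝒟`-module `N` that contains
`E` and `F` (the latter by means of `s dx ↦ s`). -/
def DSub.compare (N : C.DSub) (hE : C.sheafE.Le N.toOSub) (hF : C.sheafF.Le N.toOSub) (ξ : ℂ) :
    C.complexEF ξ ⟶ N.DR ξ :=
  twoTermMap (OSub.incl hE) (OSub.incl hF) ((C.mapsTo_E_F ξ).hom_incl (N.mapsTo ξ) hE hF)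

/-- The map induced by `DSub.compare` on first hypercohomology. -/
def DSub.compareH1 (N : C.DSub) (hE : C.sheafE.Le N.toOSub) (hF : C.sheafF.Le N.toOSub) (ξ : ℂ) :
    H1 (C.mapsTo_E_F ξ).hom →ₗ[ℂ] H1 (N.mapsTo ξ).hom :=
  H1.map (OSub.incl hE) (OSub.incl hF) ((C.mapsTo_E_F ξ).hom_incl (N.mapsTo ξ) hE hF)

end SingConn

end TwistedDeRham

end

/-! The proof describes the minimal extension explicitly as the 𝒟-module `minExt` generated by E and
reduces everything else to leading coefficients of poles.

At a finite point p, applying ∂ to (x-p)^(n+1) e_k produces (n+1+μ_k)(x-p)^n e_k up to terms in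
(x-p)^(n+1) E. No μ_k is a nonzero integer, so a 𝒟-module containing (x-p)^n E for some n contains E
(`germ_of_pow_smul`). At infinity, -x²∂ sends x^m e_k to -(m+ν_k) x^(m+1) e_k - α_k x^(m+2) e_k up
to terms in x^m E. If α_k ≠ 0 the second term, divided by x, yields x^(m+1) e_k; if α_k = 0 the
first does, because ν_k is not an integer (`germ_zpow_smul`). So a 𝒟-module containing x^(-n) E
contains every meromorphic germ at infinity. Consequently `minExt` lies in every extension, and it
is coherent, a local frame being a set of generators.

There are no nonzero submodules supported in a point, since holomorphic sections are determined off
a point. A coherent submodule K that agrees with `minExt` off z still contains E at z up to a power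
of the local equation (`IsCoherent.exists_germ`): derivatives of its generators span the fibres near
z, and the matrix expressing r of them in a frame has a meromorphic inverse. Hence K is all of
`minExt`. Conversely, a minimal extension N contains `minExt`; replacing its germs at one point z by
those of `minExt` gives a coherent submodule agreeing with N off z, which must therefore be N. As z
is arbitrary, N = `minExt` (`IsMinimalExtension.eq_minExt`).

For the comparison of complexes, filter the germs of `minExt` at a finite point by the number n of
derivations applied to E (`Fil`). Step 0 is E and step 1 is F (`FCond.fil`, `fCond_of_fil`). At
infinity E and F have the same germs, because dx itself has a double pole there. Two facts are
needed. A germ of `minExt` with ∇_ξ-image in F is in E (`extendsAt_of_fCond_nabla`): on a pole of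
order n the leading coefficient is multiplied by μ_k - n at a finite singular point and by α_k - ξ
at infinity, both nonzero, so poles can be lowered one at a time. And each germ of `minExt` is ∇_ξ γ
+ β with β in F (`Fam.solvable`): at finite distance an outermost derivation is moved into γ, at
infinity one divides by α_k - ξ. These constructions work for families depending holomorphically on
ξ.

Together the two facts give the quasi-isomorphism (`quasiIso_twoTermMap_of_sections`). For Čech
classes, the local solutions γ modify a cocycle of the de Rham complex, on a finer cover, into one
of E → F depending holomorphically on ξ (`exists_family`). This yields surjectivity on
hypercohomology and the agreement of holomorphic structures; injectivity uses only the first fact.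
-/

noncomputable section

namespace TwistedDeRham

/-! ### Quasi-isomorphisms of two-term complexes of sheaves. -/

section TwoTerm

open Limits

variable {X : TopCat.{0}} {A B A' B' : TopCat.Sheaf (ModuleCat.{0} ℂ) X}

lemma isZero_twoTerm_X (d : A ⟶ B) (i : ℤ) (h0 : i ≠ 0) (h1 : i ≠ 1) :
    IsZero ((twoTerm d).X i) :=
  HomologicalComplex.isZero_double_X _ _ _ h0 h1

/-- A morphism of two-term complexes is a quasi-isomorphism if its square is bicartesian in the
sense that it is cartesian with monomorphic first component, and that the target is the sum of the
images of the two incoming morphisms. -/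
lemma quasiIso_twoTermMap {d : A ⟶ B} {d' : A' ⟶ B'} (α : A ⟶ A') (β : B ⟶ B')
    (w : α ≫ d' = d ≫ β) (hp : IsPullback α d d' β) (hα : Mono α)
    (he : Epi (biprod.desc d' β)) : QuasiIso (twoTermMap α β w) := by
  set a := HomologicalComplex.doubleXIso₀ d rel_zero_one with ha
  set b := HomologicalComplex.doubleXIso₁ d rel_zero_one zero_ne_one with hb
  set a' := HomologicalComplex.doubleXIso₀ d' rel_zero_one with ha'
  set b' := HomologicalComplex.doubleXIso₁ d' rel_zero_one zero_ne_one with hb'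
  have f0 : (twoTermMap α β w).f 0 = a.hom ≫ α ≫ a'.inv :=
    HomologicalComplex.mkHomFromDouble_f₀ _ _ _ _ _ _
  have f1 : (twoTermMap α β w).f 1 = b.hom ≫ β ≫ b'.inv :=
    HomologicalComplex.mkHomFromDouble_f₁ _ _ _ _ _ _
  have d0 : (twoTerm d).d 0 1 = a.hom ≫ d ≫ b.inv :=
    HomologicalComplex.double_d d rel_zero_one zero_ne_one
  have d0' : (twoTerm d').d 0 1 = a'.hom ≫ d' ≫ b'.inv :=
    HomologicalComplex.double_d d' rel_zero_one zero_ne_one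
  refine ⟨fun i => ?_⟩
  rw [quasiIsoAt_iff_isIso_homologyMap]
  by_cases h0 : i = 0
  · subst h0
    have hm : Mono (HomologicalComplex.homologyMap (twoTermMap α β w) 0) := by
      rw [HomologicalComplex.mono_homologyMap_iff_up_to_refinements _ (-1) 0 1 (by simp) (by simp)]
      intro T x _ y hy
      -- Nothing lives in degree -1, so a class in degree 0 vanishes only if its cycle does, and
      -- this is detected by the monomorphism α.
      have hy0 : y = 0 := (isZero_twoTerm_X d' (-1) (by decide) (by decide)).eq_of_tgt _ _
      refine ⟨T, 𝟙 T, inferInstance, 0, ?_⟩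
      rw [hy0, zero_comp, f0] at hy
      have : Mono (a.hom ≫ α ≫ a'.inv) := inferInstance
      rw [zero_comp, Category.id_comp]
      exact (cancel_mono (a.hom ≫ α ≫ a'.inv)).1 (by rw [hy, zero_comp])
    have hep : Epi (HomologicalComplex.homologyMap (twoTermMap α β w) 0) := by
      rw [HomologicalComplex.epi_homologyMap_iff_up_to_refinements _ (-1) 0 1 (by simp) (by simp)]
      intro T x hx
      have hx' : (x ≫ a'.hom) ≫ d' = (0 : T ⟶ B) ≫ β := by
        rw [d0'] at hx
        rw [zero_comp, ← cancel_mono b'.inv, zero_comp]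
        simpa using hx
      refine ⟨T, 𝟙 T, inferInstance, hp.lift _ _ hx' ≫ a.inv, ?_, 0, ?_⟩
      · rw [d0]; simp
      · rw [f0]; simp [hp.lift_fst_assoc]
    exact isIso_of_mono_of_epi _
  by_cases h1 : i = 1
  · subst h1
    have hm : Mono (HomologicalComplex.homologyMap (twoTermMap α β w) 1) := by
      rw [HomologicalComplex.mono_homologyMap_iff_up_to_refinements _ 0 1 2 (by simp) (by simp)]
      intro T x _ y hy
      rw [f1, d0'] at hy
      have hy' : (y ≫ a'.hom) ≫ d' = (x ≫ b.hom) ≫ β := by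
        rw [← cancel_mono b'.inv]; simpa using hy.symm
      -- If β x is the boundary of y, the cartesian square provides an element of A over both y and
      -- x, so x is itself a boundary.
      refine ⟨T, 𝟙 T, inferInstance, hp.lift _ _ hy' ≫ a.inv, ?_⟩
      rw [d0]; simp [hp.lift_snd_assoc]
    have hep : Epi (HomologicalComplex.homologyMap (twoTermMap α β w) 1) := by
      rw [HomologicalComplex.epi_homologyMap_iff_up_to_refinements _ 0 1 2 (by simp) (by simp)]
      intro T x _
      obtain ⟨T', π, hπ, y, hy⟩ := surjective_up_to_refinements_of_epi (biprod.desc d' β)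
        (x ≫ b'.hom)
      refine ⟨T', π, hπ, y ≫ biprod.snd ≫ b.inv,
        (isZero_twoTerm_X d 2 (by decide) (by decide)).eq_of_tgt _ _,
        y ≫ biprod.fst ≫ a'.inv, ?_⟩
      rw [f1, d0', ← cancel_mono b'.hom]
      have : biprod.desc d' β = biprod.fst ≫ d' + biprod.snd ≫ β := by ext <;> simp
      rw [this] at hy
      simp only [Category.assoc, Preadditive.add_comp, Preadditive.comp_add] at hy ⊢
      simp only [Iso.inv_hom_id, Iso.inv_hom_id_assoc, Category.comp_id]
      rw [hy, add_comm]
    exact isIso_of_mono_of_epi _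
  · have z1 : IsZero ((twoTerm d).homology i) :=
      (HomologicalComplex.exactAt_iff_isZero_homology _ _).1
        (ShortComplex.exact_of_isZero_X₂ _ (isZero_twoTerm_X d i h0 h1))
    have z2 : IsZero ((twoTerm d').homology i) :=
      (HomologicalComplex.exactAt_iff_isZero_homology _ _).1
        (ShortComplex.exact_of_isZero_X₂ _ (isZero_twoTerm_X d' i h0 h1))
    have : HomologicalComplex.homologyMap (twoTermMap α β w) i =
      (z1.isoZero ≪≫ z2.isoZero.symm).hom := z2.eq_of_tgt _ _
    rw [this]
    infer_instance

/-- A criterion for the quasi-isomorphism property in terms of sections. -/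
lemma quasiIso_twoTermMap_of_sections {d : A ⟶ B} {d' : A' ⟶ B'} (α : A ⟶ A') (β : B ⟶ B')
    (w : α ≫ d' = d ≫ β)
    (hα : ∀ U, Function.Injective (onSec α U)) (hβ : ∀ U, Function.Injective (onSec β U))
    (hinj : ∀ U (a' : A'.obj.obj (op U)) (b : B.obj.obj (op U)),
      onSec d' U a' = onSec β U b → ∃ a, onSec α U a = a')
    (hsurj : ∀ U (b' : B'.obj.obj (op U)), ∀ x ∈ U, ∃ V, ∃ h : V ≤ U, x ∈ V ∧
      ∃ a' b, rho B' h b' = onSec d' V a' + onSec β V b) :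
    QuasiIso (twoTermMap α β w) := by
  have happ : ∀ {Y Z : TopCat.Sheaf (ModuleCat.{0} ℂ) X} {f g : Y ⟶ Z},
      (∀ U (y : Y.obj.obj (op U)), onSec f U y = onSec g U y) → f = g := by
    intro Y Z f g h
    refine ObjectProperty.hom_ext _ (NatTrans.ext (funext fun U => ?_))
    exact ModuleCat.hom_ext (LinearMap.ext fun y => h U.unop y)
  have hmono : ∀ {Y Z : TopCat.Sheaf (ModuleCat.{0} ℂ) X} (f : Y ⟶ Z),
      (∀ U, Function.Injective (onSec f U)) → Mono f := by
    intro Y Z f hf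
    refine ⟨fun {T} g h e => happ fun U t => hf U ?_⟩
    exact congrArg (fun k => onSec k U t) e
  have hmα := hmono α hα
  have hmβ := hmono β hβ
  -- Preimages under α are unique on sections; uniqueness makes the chosen ones linear and
  -- compatible with restriction, so they form a morphism of sheaves.
  have hlift : ∀ {T : TopCat.Sheaf (ModuleCat.{0} ℂ) X} (f : T ⟶ A') (g : T ⟶ B),
      f ≫ d' = g ≫ β → ∃ l : T ⟶ A, l ≫ α = f := by
    intro T f g e
    have hl : ∀ U (t : T.obj.obj (op U)), ∃ a, onSec α U a = onSec f U t := fun U t =>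
      hinj U _ (onSec g U t) (congrArg (fun k => onSec k U t) e)
    choose l hl using hl
    refine ⟨⟨{ app := fun U => ModuleCat.ofHom
                { toFun := l U.unop
                  map_add' := fun t t' => hα _ (by simp only [map_add, hl])
                  map_smul' := fun c t => hα _ (by simp only [map_smul, hl, RingHom.id_apply]) }
               naturality := fun U V φ => ?_ }⟩, happ fun U t => hl U t⟩
    refine ModuleCat.hom_ext (LinearMap.ext fun t => hα V.unop ?_)
    change onSec α V.unop (l V.unop (rho T φ.unop.le t)) =
      onSec α V.unop (rho A φ.unop.le (l U.unop t))
    rw [hl, onSec_rho, onSec_rho, hl]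
  refine quasiIso_twoTermMap α β w ?_ hmα ?_
  · refine ⟨⟨w⟩, ⟨PullbackCone.IsLimit.mk w (fun s => (hlift _ _ s.condition).choose)
      (fun s => (hlift _ _ s.condition).choose_spec) (fun s => ?_) (fun s m hm1 hm2 => ?_)⟩⟩
    · have h := (hlift _ _ s.condition).choose_spec
      rw [← cancel_mono β, Category.assoc, ← w, ← s.condition, ← Category.assoc, h]
    · rw [← cancel_mono α, hm1, (hlift _ _ s.condition).choose_spec]
  -- A morphism out of B' that kills the images of d' and β kills every section locally by `hsurj`,
  -- hence vanishes because its target is a sheaf.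
  · rw [Preadditive.epi_iff_cancel_zero]
    intro Z g hg
    have h1 : d' ≫ g = 0 := by
      have := congrArg (fun k => biprod.inl ≫ k) hg; simpa using this
    have h2 : β ≫ g = 0 := by
      have := congrArg (fun k => biprod.inr ≫ k) hg; simpa using this
    refine happ fun U b' => ?_
    refine TopCat.Sheaf.eq_of_locally_eq' Z
      (fun x : U => (hsurj U b' x.1 x.2).choose) U
      (fun x => homOfLE (hsurj U b' x.1 x.2).choose_spec.choose) ?_ _ _ ?_
    · intro x hx
      exact Opens.mem_iSup.2 ⟨⟨x, hx⟩, (hsurj U b' x hx).choose_spec.choose_spec.1⟩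
    · intro x
      obtain ⟨-, a', b, h⟩ := (hsurj U b' x.1 x.2).choose_spec.choose_spec
      change rho Z _ (onSec g U b') = rho Z _ (onSec (0 : B' ⟶ Z) U b')
      rw [← onSec_rho, ← onSec_rho, h, map_add]
      have e1 := congrArg (fun k => onSec k _ a') h1
      have e2 := congrArg (fun k => onSec k _ b) h2
      change onSec g _ (onSec d' _ a') = 0 at e1
      change onSec g _ (onSec β _ b) = 0 at e2
      rw [e1, e2, add_zero]
      rfl

end TwoTerm

/-! ### Local coordinates -/

/-- The local coordinate at `z`: `x` at finite distance, `1/x` at infinity. -/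
def coord (z x : OnePoint ℂ) : ℂ := z.elim (invFun x) fun _ => x.elim 0 id

lemma coord_param (z : OnePoint ℂ) (u : ℂ) : coord z (param z u) = u := by
  induction z using OnePoint.rec with
  | infty =>
    change invFun (invPt u) = u
    by_cases hu : u = 0
    · subst hu; rw [invPt_zero]; rfl
    · rw [invPt_of_ne hu]; exact inv_inv u
  | coe w => rfl

lemma param_base (z : OnePoint ℂ) : param z (base z) = z := by
  induction z using OnePoint.rec with
  | infty => exact invPt_zero
  | coe w => rfl

lemma coord_self (z : OnePoint ℂ) : coord z z = base z := by
  conv_lhs => rw [← param_base z, param_base z]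
  have := coord_param z (base z)
  rwa [param_base] at this

lemma param_coord (z : OnePoint ℂ) : ∀ᶠ x in 𝓝 z, param z (coord z x) = x := by
  induction z using OnePoint.rec with
  | infty =>
    have h : ∀ᶠ x in 𝓝 (OnePoint.infty : OnePoint ℂ), x ≠ ((0 : ℂ) : OnePoint ℂ) :=
      eventually_ne_nhds (OnePoint.infty_ne_coe 0)
    filter_upwards [h] with x hx
    induction x using OnePoint.rec with
    | infty => exact invPt_zero
    | coe y =>
      have hy : y ≠ 0 := fun h => hx (h ▸ rfl)
      change invPt y⁻¹ = y
      rw [invPt_of_ne (inv_ne_zero hy), inv_inv]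
  | coe w =>
    filter_upwards [eventually_ne_nhds (OnePoint.coe_ne_infty w)] with x hx
    induction x using OnePoint.rec with
    | infty => exact absurd rfl hx
    | coe y => rfl

lemma tendsto_invPt : Tendsto invPt (𝓝 0) (𝓝 OnePoint.infty) := by
  rw [← nhdsNE_sup_pure, tendsto_sup]
  constructor
  · have h1 : Tendsto (fun t : ℂ => ((t⁻¹ : ℂ) : OnePoint ℂ)) (𝓝[≠] 0) (𝓝 OnePoint.infty) := by
      rw [← Function.comp_def, ← tendsto_comap_iff, comap_infty, ← Metric.cobounded_eq_cocompact]
      exact tendsto_inv₀_nhdsNE_zero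
    refine h1.congr' ?_
    filter_upwards [self_mem_nhdsWithin] with t ht
    exact (invPt_of_ne ht).symm
  · rw [tendsto_pure_left]
    intro s hs
    rw [invPt_zero]; exact mem_of_mem_nhds hs

lemma tendsto_param (z : OnePoint ℂ) : Tendsto (param z) (𝓝 (base z)) (𝓝 z) := by
  induction z using OnePoint.rec with
  | infty => exact tendsto_invPt
  | coe w => exact OnePoint.continuous_coe.tendsto w

lemma tendsto_coord (z : OnePoint ℂ) : Tendsto (coord z) (𝓝 z) (𝓝 (base z)) := by
  induction z using OnePoint.rec with
  | infty =>
    have h1 : Tendsto invFun (𝓝 OnePoint.infty) (𝓝 0) := by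
      rw [OnePoint.tendsto_nhds_infty', coclosedCompact_eq_cocompact]
      exact ⟨tendsto_pure_left.2 fun s hs => mem_of_mem_nhds hs,
        tendsto_inv_cocompact.mono_right nhdsWithin_le_nhds⟩
    exact h1
  | coe w =>
    rw [OnePoint.nhds_coe_eq]
    exact tendsto_map'_iff.2 tendsto_id

lemma HolAt.of_coord {z : OnePoint ℂ} {g : ℂ → ℂ} (hg : AnalyticAt ℂ g (base z)) :
    HolAt (fun x => g (coord z x)) z := by
  refine hg.congr (Eventually.of_forall fun u => ?_)
  simp only [coord_param]

/-- The local equation `unif z` as a function on the sphere. -/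
def unifFun (z x : OnePoint ℂ) : ℂ := coord z x - base z

lemma unifFun_coe (z : OnePoint ℂ) (x : ℂ) : unifFun z x = unif z x := by
  induction z using OnePoint.rec with
  | infty => exact sub_zero _
  | coe w => rfl

lemma unifFun_self (z : OnePoint ℂ) : unifFun z z = 0 := by
  rw [unifFun, coord_self, sub_self]

lemma holAt_unifFun (z : OnePoint ℂ) : HolAt (unifFun z) z :=
  HolAt.of_coord (g := fun u => u - base z) (analyticAt_id.fun_sub analyticAt_const)

lemma HolAt.pow {f : OnePoint ℂ → ℂ} {z : OnePoint ℂ} (hf : HolAt f z) (n : ℕ) :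
    HolAt (fun x => f x ^ n) z := AnalyticAt.fun_pow hf n

lemma HolAt.neg {f : OnePoint ℂ → ℂ} {z : OnePoint ℂ} (hf : HolAt f z) :
    HolAt (fun x => -f x) z := AnalyticAt.fun_neg hf

/-- A holomorphic function vanishing at `z` is divisible by the local equation of `z`. -/
lemma HolAt.exists_div {f : OnePoint ℂ → ℂ} {z : OnePoint ℂ} (hf : HolAt f z) (h0 : f z = 0) :
    ∃ g, HolAt g z ∧ ∀ᶠ x in 𝓝 z, f x = unifFun z x * g x := by
  have h : ((1 : ℕ) : ℕ∞) ≤ analyticOrderAt (fun u => f (param z u)) (base z) := by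
    rw [Nat.cast_one, Order.one_le_iff_ne_zero]
    exact (AnalyticAt.analyticOrderAt_ne_zero hf).2 (by rw [param_base, h0])
  obtain ⟨g, hg, e⟩ := (natCast_le_analyticOrderAt hf).1 h
  refine ⟨_, HolAt.of_coord hg, ?_⟩
  filter_upwards [(tendsto_coord z).eventually e, param_coord z] with x hx hx'
  rw [hx'] at hx
  rw [hx, pow_one, smul_eq_mul, unifFun]

/-! ### Nonsingular points near z, in the local coordinate. -/

namespace SingConn

variable {r : ℕ} {E : HolBundle r} {C : SingConn E}

/-- The affine coordinate as a function of the local coordinate at `z`. -/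
def affine (z : OnePoint ℂ) (u : ℂ) : ℂ := z.elim u⁻¹ fun _ => u

lemma param_eq_affine {z : OnePoint ℂ} {u : ℂ} (hu : u ≠ base z) :
    param z u = (affine z u : OnePoint ℂ) := by
  induction z using OnePoint.rec with
  | infty => exact invPt_of_ne hu
  | coe w => rfl

variable (C) in
-- Transfers statements about nonsingular affine points near `z` to a punctured disc in the local
-- coordinate, where identity theorems for analytic and meromorphic functions apply.
lemma tendsto_affine (z : OnePoint ℂ) : Tendsto (affine z) (𝓝[≠] base z) (C.near z) := by
  have h1 : Tendsto (affine z) (𝓝[≠] base z) (comap (fun u : ℂ => (u : OnePoint ℂ)) (𝓝 z)) := by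
    rw [tendsto_comap_iff]
    refine ((tendsto_param z).mono_left nhdsWithin_le_nhds).congr' ?_
    filter_upwards [self_mem_nhdsWithin] with u hu using param_eq_affine hu
  refine tendsto_inf.2 ⟨h1, tendsto_principal.2 ?_⟩
  induction z using OnePoint.rec with
  | infty =>
    rw [comap_infty] at h1
    have : ∀ᶠ x in cocompact ℂ, x ∉ C.P :=
      (C.P.finite_toSet.isCompact).compl_mem_cocompact
    exact h1.eventually this
  | coe w =>
    have h2 : ∀ᶠ x in 𝓝[≠] w, x ∉ C.P := by
      have h3 : ((C.P : Set ℂ) \ {w}).Finite := C.P.finite_toSet.subset Set.sdiff_subset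
      filter_upwards [nhdsWithin_le_nhds (h3.isClosed.isOpen_compl.mem_nhds
        (fun h => h.2 rfl)), self_mem_nhdsWithin] with x hx hx' hxP
      exact hx ⟨hxP, hx'⟩
    exact h2

/-- Holomorphic functions that agree at the nonsingular points near `z` agree at `z`. -/
lemma eq_of_near {f g : OnePoint ℂ → ℂ} {z : OnePoint ℂ} (hf : HolAt f z) (hg : HolAt g z)
    (h : ∀ᶠ x : ℂ in C.near z, f x = g x) : f z = g z := by
  have h1 : ∀ᶠ u in 𝓝[≠] base z, f (param z u) = g (param z u) := by
    filter_upwards [(tendsto_affine C z).eventually h, self_mem_nhdsWithin] with u hu hu'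
    rw [param_eq_affine hu', hu]
  have h2 := (AnalyticAt.continuousAt hf).eventuallyEq_nhds_iff_eventuallyEq_nhdsNE
    (AnalyticAt.continuousAt hg) |>.1 h1
  have h3 : f (param z (base z)) = g (param z (base z)) := h2.self_of_nhds
  rwa [param_base] at h3

lemma near_infty_le : C.near OnePoint.infty ≤ cocompact ℂ := by
  rw [← comap_infty]; exact C.near_le _

lemma near_le_nhdsNE {p : ℂ} (hp : p ∈ C.P) : C.near p ≤ 𝓝[≠] p := by
  rw [near, comap_coe]
  exact inf_le_inf_left _ (principal_mono.2 fun x hx => by rintro rfl; exact hx hp)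

lemma near_of_nhds {z : OnePoint ℂ} {p : OnePoint ℂ → Prop} (h : ∀ᶠ x in 𝓝 z, p x) :
    ∀ᶠ x : ℂ in C.near z, p x := C.near_le z (tendsto_comap.eventually h)

lemma exists_opens_of_near {z : OnePoint ℂ} {p : ℂ → Prop} (h : ∀ᶠ x in C.near z, p x) :
    ∃ W : Opens (OnePoint ℂ), z ∈ W ∧ ∀ x : ℂ, (x : OnePoint ℂ) ∈ W → x ∉ C.P → p x := by
  rw [near, eventually_inf_principal] at h
  obtain ⟨V, hV, hVp⟩ := mem_comap.1 h
  obtain ⟨W, hW, hWo, hzW⟩ := mem_nhds_iff.1 hV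
  exact ⟨⟨W, hWo⟩, hzW, fun x hx hxP => hVp (hW hx) hxP⟩

variable (C) in
/-- The singular points other than `z` are bounded away from `z`. -/
lemma exists_opens_isSing (z : OnePoint ℂ) :
    ∃ W : Opens (OnePoint ℂ), z ∈ W ∧ ∀ y ∈ W, C.IsSing y → y = z := by
  have hf : {y | C.IsSing y ∧ y ≠ z}.Finite := by
    refine ((C.P.finite_toSet.image (fun u : ℂ => (u : OnePoint ℂ))).insert OnePoint.infty).subset ?_
    rintro y ⟨h | ⟨p, hp, h⟩, -⟩
    · exact Or.inl h
    · exact Or.inr ⟨p, hp, h.symm⟩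
  exact ⟨⟨_, hf.isClosed.isOpen_compl⟩, fun h => h.2 rfl, fun y hy hs => by
    by_contra h; exact hy ⟨hs, h⟩⟩

lemma not_isSing_coe {w : ℂ} : ¬ C.IsSing w ↔ w ∉ C.P := by
  constructor
  · exact fun h hw => h (Or.inr ⟨w, hw, rfl⟩)
  · rintro h (h' | ⟨p, hp, h'⟩)
    · exact OnePoint.coe_ne_infty w h'
    · exact h (OnePoint.coe_injective h' ▸ hp)

lemma exists_coe_of_not_isSing {z : OnePoint ℂ} (h : ¬ C.IsSing z) : ∃ w : ℂ, z = w ∧ w ∉ C.P := by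
  induction z using OnePoint.rec with
  | infty => exact absurd (Or.inl rfl) h
  | coe w => exact ⟨w, rfl, not_isSing_coe.1 h⟩

end SingConn

/-! ### Holomorphic sections in local frames. -/

namespace HolBundle

variable {r : ℕ} {E : HolBundle r}

/-- Holomorphy may be tested in one local frame. -/
lemma holSec_of_frame {σ : ∀ x, E.Fib x} {z : OnePoint ℂ} {i : E.ι} (hi : z ∈ E.dom i)
    (h : ∀ k, HolAt (fun x => (E.frame i x).repr (σ x) k) z) : E.HolSec σ z := by
  intro j hj k
  have h3 : HolAt (fun y => ∑ l, (E.frame i y).repr (σ y) l *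
      (E.frame j y).repr (E.frame i y l) k) z :=
    HolAt.sum _ fun l _ => (h l).mul (E.transition j i k l z ⟨hj, hi⟩)
  refine h3.congr (Eventually.of_forall fun y => ?_)
  have h4 := congrArg (fun v => (E.frame j y).repr v k) ((E.frame i y).sum_repr (σ y))
  simp only [map_sum, map_smul, Finsupp.finsetSum_apply, Finsupp.smul_apply, smul_eq_mul] at h4
  exact h4

lemma isFrameAt_frame {z : OnePoint ℂ} {i : E.ι} (hi : z ∈ E.dom i) :
    E.IsFrameAt (fun k x => E.frame i x k) z where
  hol k := holSec_of_frame hi fun l => by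
    have : (fun x => (E.frame i x).repr (E.frame i x k) l) =
        fun _ => (Finsupp.single k (1 : ℂ)) l := funext fun x => by rw [Module.Basis.repr_self]
    rw [this]; exact HolAt.const _ _
  indep := (E.frame i z).linearIndependent
  gen σ hσ := ⟨fun k x => (E.frame i x).repr (σ x) k, fun k => hσ i hi k,
    Eventually.of_forall fun x => ((E.frame i x).sum_repr (σ x)).symm⟩

end HolBundle

/-! ### Holomorphic and meromorphic germs and their derivatives. -/

namespace SingConn

variable {r : ℕ} {E : HolBundle r} {C : SingConn E}

lemma ExtendsAt.add {s t : ∀ x : ℂ, E.Fib x} {z : OnePoint ℂ} (h : C.ExtendsAt s z)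
    (h' : C.ExtendsAt t z) : C.ExtendsAt (fun x => s x + t x) z :=
  let ⟨_, hσ⟩ := h; let ⟨_, hτ⟩ := h'; ⟨_, hσ.add hτ⟩

lemma ExtendsAt.smul {f : OnePoint ℂ → ℂ} {s : ∀ x : ℂ, E.Fib x} {z : OnePoint ℂ} (hf : HolAt f z)
    (h : C.ExtendsAt s z) : C.ExtendsAt (fun x => f x • s x) z :=
  let ⟨_, hσ⟩ := h; ⟨_, hσ.smul hf⟩

lemma ExtendsAt.zero (z : OnePoint ℂ) : C.ExtendsAt (fun _ => 0) z :=
  ⟨_, HolBundle.HolSec.zero z, Eventually.of_forall fun _ => rfl⟩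

lemma ExtendsAt.holSecC_near {s : ∀ x : ℂ, E.Fib x} {z : OnePoint ℂ} (h : C.ExtendsAt s z) :
    ∀ᶠ x in C.near z, E.HolSecC s x := by
  obtain ⟨σ, h1, h2⟩ := h
  filter_upwards [SingConn.holSecC_near (C := C) h1, C.near_eventually h2] with x hx hx'
  exact hx.congr (hx'.mono fun y hy => hy.symm)

lemma extendsAt_coe {w : ℂ} (hw : w ∉ C.P) {s : ∀ x : ℂ, E.Fib x} :
    C.ExtendsAt s w ↔ E.HolSecC s w :=
  ⟨fun h => h.holSecC hw, fun h => ⟨@OnePoint.rec ℂ (fun x => E.Fib x) 0 fun u => s u, h,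
    Eventually.of_forall fun _ => rfl⟩⟩

/-- Sections that extend holomorphically are the holomorphic combinations of a frame. -/
lemma ExtendsAt.exists_coeff {s : ∀ x : ℂ, E.Fib x} {z : OnePoint ℂ} {e : Fin r → ∀ x, E.Fib x}
    (he : E.IsFrameAt e z) (h : C.ExtendsAt s z) :
    ∃ c : Fin r → OnePoint ℂ → ℂ, (∀ k, HolAt (c k) z) ∧
      ∀ᶠ x : ℂ in C.near z, s x = ∑ k, c k x • e k x := by
  obtain ⟨σ, h1, h2⟩ := h
  obtain ⟨c, hc, h3⟩ := he.gen σ h1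
  refine ⟨c, hc, ?_⟩
  filter_upwards [h2, near_of_nhds h3] with x hx hx'
  rw [hx, hx']

lemma extendsAt_of_coeff {s : ∀ x : ℂ, E.Fib x} {z : OnePoint ℂ} {e : Fin r → ∀ x, E.Fib x}
    (he : E.IsFrameAt e z) {c : Fin r → OnePoint ℂ → ℂ} (hc : ∀ k, HolAt (c k) z)
    (h : ∀ᶠ x : ℂ in C.near z, s x = ∑ k, c k x • e k x) : C.ExtendsAt s z :=
  ⟨fun x => ∑ k, c k x • e k x,
    HolBundle.HolSec.sum _ fun k _ => HolBundle.HolSec.smul (hc k) (he.hol k), h⟩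

lemma extendsAt_frame {z : OnePoint ℂ} {e : Fin r → ∀ x, E.Fib x} (he : E.IsFrameAt e z)
    (k : Fin r) : C.ExtendsAt (fun x => e k x) z := ⟨e k, he.hol k, Eventually.of_forall fun _ => rfl⟩

variable (C) in
/-- The section `s` is meromorphic at `z` with poles at the singular points only. -/
def MeroAt (s : ∀ x : ℂ, E.Fib x) (z : OnePoint ℂ) : Prop :=
  ∃ k : ℕ, (¬ C.IsSing z → k = 0) ∧ C.ExtendsAt (fun x => unif z x ^ k • s x) z

lemma ExtendsAt.unif_pow_smul {s : ∀ x : ℂ, E.Fib x} {z : OnePoint ℂ} (h : C.ExtendsAt s z)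
    (n : ℕ) : C.ExtendsAt (fun x => unif z x ^ n • s x) z := by
  have := h.smul ((holAt_unifFun z).pow n)
  simpa only [unifFun_coe] using this

lemma ExtendsAt.unif_pow_mono {s : ∀ x : ℂ, E.Fib x} {z : OnePoint ℂ} {m n : ℕ} (hmn : m ≤ n)
    (h : C.ExtendsAt (fun x => unif z x ^ m • s x) z) :
    C.ExtendsAt (fun x => unif z x ^ n • s x) z := by
  refine (h.unif_pow_smul (n - m)).congr (Eventually.of_forall fun x => ?_)
  rw [smul_smul, ← pow_add, Nat.sub_add_cancel hmn]

lemma unif_ne_zero (z : OnePoint ℂ) (hz : C.IsSing z) : ∀ᶠ x in C.near z, unif z x ≠ 0 := by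
  rcases hz with rfl | ⟨p, hp, rfl⟩
  · filter_upwards [near_infty_le (eventually_ne_cocompact 0)] with x hx using inv_ne_zero hx
  · filter_upwards [C.near_notMem p] with x hx
    exact sub_ne_zero.2 fun h => hx (h ▸ hp)

lemma holSecC_of_unif {s : ∀ x : ℂ, E.Fib x} {z : OnePoint ℂ} {n : ℕ} (hz : C.IsSing z)
    (h : C.ExtendsAt (fun x => unif z x ^ n • s x) z) : ∀ᶠ x in C.near z, E.HolSecC s x := by
  have hz' := unif_ne_zero z hz
  filter_upwards [h.holSecC_near, hz', C.near_eventually hz'] with x hx hx' hx''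
  have hu : AnalyticAt ℂ (unif z) x := by
    induction z using OnePoint.rec with
    | infty => exact analyticAt_inv fun h => hx' (inv_eq_zero.2 h)
    | coe w => exact analyticAt_id.fun_sub analyticAt_const
  have h2 := HolBundle.HolSecC.smul ((hu.fun_pow n).fun_inv (pow_ne_zero n hx')) hx
  refine h2.congr ?_
  filter_upwards [hx''] with y hy
  rw [smul_smul, inv_mul_cancel₀ (pow_ne_zero n hy), one_smul]

lemma MeroAt.holSecC_near {s : ∀ x : ℂ, E.Fib x} {z : OnePoint ℂ} (h : C.MeroAt s z) :
    ∀ᶠ x in C.near z, E.HolSecC s x := by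
  obtain ⟨k, hk, h⟩ := h
  by_cases hz : C.IsSing z
  · exact holSecC_of_unif hz h
  · rw [hk hz] at h
    simp only [pow_zero, one_smul] at h
    exact h.holSecC_near

lemma MeroAt.extendsAt {s : ∀ x : ℂ, E.Fib x} {z : OnePoint ℂ} (h : C.MeroAt s z)
    (hz : ¬ C.IsSing z) : C.ExtendsAt s z := by
  obtain ⟨k, hk, h⟩ := h
  rw [hk hz] at h
  simpa only [pow_zero, one_smul] using h

lemma ExtendsAt.meroAt {s : ∀ x : ℂ, E.Fib x} {z : OnePoint ℂ} (h : C.ExtendsAt s z) :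
    C.MeroAt s z := ⟨0, fun _ => rfl, by simpa only [pow_zero, one_smul] using h⟩

lemma MeroAt.congr {s t : ∀ x : ℂ, E.Fib x} {z : OnePoint ℂ} (h : C.MeroAt s z)
    (e : ∀ᶠ x in C.near z, s x = t x) : C.MeroAt t z := by
  obtain ⟨k, hk, h⟩ := h
  exact ⟨k, hk, h.congr (e.mono fun x hx => by simp only [hx])⟩

lemma MeroAt.add {s t : ∀ x : ℂ, E.Fib x} {z : OnePoint ℂ} (h : C.MeroAt s z) (h' : C.MeroAt t z) :
    C.MeroAt (fun x => s x + t x) z := by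
  obtain ⟨k, hk, h⟩ := h
  obtain ⟨l, hl, h'⟩ := h'
  refine ⟨max k l, fun hz => by rw [hk hz, hl hz]; rfl, ?_⟩
  exact ((h.unif_pow_mono (le_max_left k l)).add (h'.unif_pow_mono (le_max_right k l))).congr
    (Eventually.of_forall fun x => (smul_add _ _ _).symm)

lemma MeroAt.smul {f : OnePoint ℂ → ℂ} {s : ∀ x : ℂ, E.Fib x} {z : OnePoint ℂ} (hf : HolAt f z)
    (h : C.MeroAt s z) : C.MeroAt (fun x => f x • s x) z := by
  obtain ⟨k, hk, h⟩ := h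
  exact ⟨k, hk, (h.smul hf).congr (Eventually.of_forall fun x => smul_comm _ _ _)⟩

/-- The derivative of a section that extends holomorphically has at most a simple pole. -/
lemma ExtendsAt.unif_smul_D {s : ∀ x : ℂ, E.Fib x} {z : OnePoint ℂ} (h : C.ExtendsAt s z) :
    C.ExtendsAt (fun x => unif z x • C.D s x) z := by
  by_cases hz : ∃ p ∈ C.P, z = (p : OnePoint ℂ)
  · obtain ⟨p, hp, rfl⟩ := hz
    obtain ⟨σ, hσ⟩ := h
    obtain ⟨v, τ, hτ, -⟩ := exists_residue (C := C) hp hσ.1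
    exact ⟨τ, hτ.congr ((D_near hσ).mono fun x hx => by rw [hx]; rfl)⟩
  · have h1 : C.ExtendsAt (C.D s) z := by
      have h2 := h.fCond_nabla (C := C) 0
      simp only [zero_smul, sub_zero] at h2
      induction z using OnePoint.rec with
      | infty =>
        refine ((h2.inf rfl).smul (HolAt.const (-1) _)).congr ?_
        filter_upwards [near_infty_le (eventually_ne_cocompact 0)] with x hx
        rw [smul_smul, smul_smul]
        convert one_smul ℂ _
        field_simp
      | coe w =>
        exact h2.reg fun h => by
          rcases h with h | h
          · exact OnePoint.coe_ne_infty w h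
          · exact hz h
    simpa only [pow_one] using h1.unif_pow_smul 1

lemma ExtendsAt.D {s : ∀ x : ℂ, E.Fib x} {z : OnePoint ℂ} (hz : ¬ C.IsSing z)
    (h : C.ExtendsAt s z) : C.ExtendsAt (C.D s) z := by
  obtain ⟨w, rfl, hw⟩ := exists_coe_of_not_isSing hz
  rw [extendsAt_coe hw] at h ⊢
  exact C.D_hol s w hw h

lemma ExtendsAt.D_infty {s : ∀ x : ℂ, E.Fib x} (h : C.ExtendsAt s OnePoint.infty) :
    C.ExtendsAt (C.D s) OnePoint.infty := by
  obtain ⟨σ, hσ⟩ := h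
  exact (D_extends_infty hσ.1).congr ((D_near hσ).mono fun x hx => hx.symm)

lemma D_congr_near {s t : ∀ x : ℂ, E.Fib x} {z : OnePoint ℂ} (e : ∀ᶠ x in C.near z, s x = t x) :
    ∀ᶠ x in C.near z, C.D s x = C.D t x := by
  filter_upwards [C.near_eventually e, C.near_notMem z] with x hx hxP
  exact C.D_congr _ _ x hxP hx

/-- With u = x - w, one has u^(k+1) ∂s = u ∂(u^k s) - k u^k s, and u ∂ preserves holomorphic
sections because ∇ is logarithmic. So the pole order rises by at most one. -/
lemma MeroAt.D_coe {s : ∀ x : ℂ, E.Fib x} {w : ℂ} (h : C.MeroAt s w) : C.MeroAt (C.D s) w := by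
  by_cases hw : w ∈ C.P
  · obtain ⟨k, -, hk⟩ := id h
    refine ⟨k + 1, fun hz => absurd (Or.inr ⟨w, hw, rfl⟩) hz, ?_⟩
    have h1 := hk.unif_smul_D
    have h2 := hk.smul (HolAt.const (-(k : ℂ)) w)
    refine (h1.add h2).congr ?_
    filter_upwards [h.holSecC_near, C.near_notMem w] with x hx hxP
    have hd : HasDerivAt (fun y => unif (w : OnePoint ℂ) y ^ k) (k * (x - w) ^ (k - 1) * 1) x :=
      ((hasDerivAt_id x).sub_const w).fun_pow k
    have ha : AnalyticAt ℂ (fun y => unif (w : OnePoint ℂ) y ^ k) x :=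
      (analyticAt_id.fun_sub analyticAt_const).fun_pow k
    rw [C.D_smul _ s x hxP ha hx, hd.deriv, mul_one]
    change (x - w) • (((k : ℂ) * (x - w) ^ (k - 1)) • s x + (x - w) ^ k • C.D s x) +
      (-(k : ℂ)) • (x - w) ^ k • s x = (x - w) ^ (k + 1) • C.D s x
    rcases k with _ | k
    · simp
    · simp only [Nat.add_sub_cancel]
      module
  · exact ((h.extendsAt (not_isSing_coe.2 hw)).D (not_isSing_coe.2 hw)).meroAt

/-- Written in terms of ∂_x the connection is holomorphic at infinity, so ∂_x does not raise the
pole order there; only the factor x² costs two orders. -/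
lemma MeroAt.D_infty {s : ∀ x : ℂ, E.Fib x} (h : C.MeroAt s OnePoint.infty) :
    C.MeroAt (fun x => (-(x ^ 2)) • C.D s x) OnePoint.infty := by
  obtain ⟨k, -, hk⟩ := id h
  refine ⟨k + 2, fun hz => absurd (Or.inl rfl) hz, ?_⟩
  have h1 := hk.D_infty
  have h2 := hk.smul ((HolAt.const (k : ℂ) _).mul holAt_invFun)
  refine ((h1.add h2).smul (HolAt.const (-1) _)).congr ?_
  filter_upwards [h.holSecC_near, C.near_notMem _,
    near_infty_le (eventually_ne_cocompact 0)] with x hx hxP hx0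
  have hd : HasDerivAt (fun y => unif OnePoint.infty y ^ k)
      (k * (x⁻¹) ^ (k - 1) * (-(x ^ 2)⁻¹)) x := (hasDerivAt_inv hx0).fun_pow k
  have ha : AnalyticAt ℂ (fun y => unif OnePoint.infty y ^ k) x := (analyticAt_inv hx0).fun_pow k
  rw [C.D_smul _ s x hxP ha hx, hd.deriv]
  change (-1 : ℂ) • ((((k : ℂ) * (x⁻¹) ^ (k - 1) * (-(x ^ 2)⁻¹)) • s x + (x⁻¹) ^ k • C.D s x) +
    ((k : ℂ) * x⁻¹) • (x⁻¹) ^ k • s x) = (x⁻¹) ^ (k + 2) • (-(x ^ 2)) • C.D s x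
  have e1 : (x⁻¹) ^ (k + 2) * (-(x ^ 2)) = -(x⁻¹) ^ k := by
    rw [pow_add]; field_simp
  rw [smul_smul _ (-(x ^ 2)), e1]
  rcases k with _ | k
  · simp
  · simp only [Nat.add_sub_cancel]
    rw [← inv_pow]
    module

end SingConn

namespace SingConn

variable {r : ℕ} {E : HolBundle r} {C : SingConn E}

/-! ### Germs of sections -/

variable (C) in
/-- Restriction of a section over the affine line to the nonsingular points of `U`. -/
def ofFun (U : Opens (OnePoint ℂ)) (s : ∀ x : ℂ, E.Fib x) : C.Sec U := fun x => s x.1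

lemma extend_ofFun {U : Opens (OnePoint ℂ)} (s : ∀ x : ℂ, E.Fib x) {x : ℂ}
    (hx : (x : OnePoint ℂ) ∈ U) (hxP : x ∉ C.P) : C.extend (C.ofFun U s) x = s x :=
  extend_apply (C.ofFun U s) ⟨x, hx, hxP⟩

lemma extend_ofFun_near {U : Opens (OnePoint ℂ)} (s : ∀ x : ℂ, E.Fib x) {z : OnePoint ℂ}
    (hz : z ∈ U) : ∀ᶠ x in C.near z, C.extend (C.ofFun U s) x = s x := by
  filter_upwards [near_mem (C := C) hz, C.near_notMem z] with x hx hxP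
  exact extend_ofFun s hx hxP

lemma extend_del {U : Opens (OnePoint ℂ)} (s : C.Sec U) {z : OnePoint ℂ} (hz : z ∈ U) :
    ∀ᶠ x in C.near z, C.extend (C.del s) x = C.D (C.extend s) x := by
  filter_upwards [near_mem (C := C) hz, C.near_notMem z] with x hx hxP
  exact extend_apply (C.del s) ⟨x, hx, hxP⟩

/-- `s` represents the germ at `z` of a section of `A`. -/
def OSub.Germ (A : C.OSub) (z : OnePoint ℂ) (s : ∀ x : ℂ, E.Fib x) : Prop :=
  ∃ W : Opens (OnePoint ℂ), z ∈ W ∧ ∃ s' ∈ A.carrier W, ∀ᶠ x in C.near z, C.extend s' x = s x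

namespace OSub

variable {A B : C.OSub}

lemma germ_of_mem {U : Opens (OnePoint ℂ)} {s : C.Sec U} (hs : s ∈ A.carrier U) {z : OnePoint ℂ}
    (hz : z ∈ U) : A.Germ z (C.extend s) := ⟨U, hz, s, hs, Eventually.of_forall fun _ => rfl⟩

lemma Germ.exists_ofFun {z : OnePoint ℂ} {s : ∀ x : ℂ, E.Fib x} (h : A.Germ z s) :
    ∃ W : Opens (OnePoint ℂ), z ∈ W ∧ C.ofFun W s ∈ A.carrier W := by
  obtain ⟨W, hz, s', hs', e⟩ := h
  obtain ⟨W', hz', h'⟩ := exists_opens_of_near e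
  refine ⟨W ⊓ W', ⟨hz, hz'⟩, ?_⟩
  convert A.res_mem W (W ⊓ W') inf_le_left s' hs' using 1
  funext x
  exact (h' x.1 x.2.1.2 x.2.2).symm.trans (extend_apply s' ⟨x.1, x.2.1.1, x.2.2⟩)

lemma Germ.exists_ofFun_le {z : OnePoint ℂ} {s : ∀ x : ℂ, E.Fib x} (h : A.Germ z s)
    {U : Opens (OnePoint ℂ)} (hU : z ∈ U) :
    ∃ W ≤ U, z ∈ W ∧ C.ofFun W s ∈ A.carrier W := by
  obtain ⟨W, hz, hs⟩ := h.exists_ofFun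
  exact ⟨W ⊓ U, inf_le_right, ⟨hz, hU⟩, A.res_mem W (W ⊓ U) inf_le_left _ hs⟩

lemma germ_of_ofFun {z : OnePoint ℂ} {s : ∀ x : ℂ, E.Fib x} {W : Opens (OnePoint ℂ)} (hz : z ∈ W)
    (h : C.ofFun W s ∈ A.carrier W) : A.Germ z s := ⟨W, hz, _, h, extend_ofFun_near s hz⟩

lemma mem_of_germ {U : Opens (OnePoint ℂ)} {s : C.Sec U} (h : ∀ z ∈ U, A.Germ z (C.extend s)) :
    s ∈ A.carrier U := A.glue U s fun z hz => by
  obtain ⟨W, hWU, hzW, hW⟩ := (h z hz).exists_ofFun_le hz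
  refine ⟨W, hWU, hzW, ?_⟩
  convert hW using 1
  funext x
  exact (extend_apply s ⟨x.1, hWU x.2.1, x.2.2⟩).symm

lemma le_of_germ (h : ∀ z s, A.Germ z s → B.Germ z s) : A.Le B := fun _ _ hs =>
  mem_of_germ fun z hz => h z _ (germ_of_mem hs hz)

lemma Germ.congr {z : OnePoint ℂ} {s t : ∀ x : ℂ, E.Fib x} (h : A.Germ z s)
    (e : ∀ᶠ x in C.near z, s x = t x) : A.Germ z t := by
  obtain ⟨W, hz, s', hs', e'⟩ := h
  exact ⟨W, hz, s', hs', by filter_upwards [e, e'] with x h1 h2; rw [h2, h1]⟩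

lemma Germ.zero (z : OnePoint ℂ) : A.Germ z (fun _ => 0) :=
  ⟨⊤, trivial, 0, zero_mem _, Eventually.of_forall extend_zero⟩

lemma Germ.add {z : OnePoint ℂ} {s t : ∀ x : ℂ, E.Fib x} (h : A.Germ z s) (h' : A.Germ z t) :
    A.Germ z (fun x => s x + t x) := by
  obtain ⟨W, hz, hs⟩ := h.exists_ofFun
  obtain ⟨W', hW', hz', ht⟩ := h'.exists_ofFun_le hz
  exact germ_of_ofFun hz' (add_mem (A.res_mem W W' hW' _ hs) ht)

lemma _root_.TwistedDeRham.HolAt.exists_opens {f : OnePoint ℂ → ℂ} {z : OnePoint ℂ}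
    (hf : HolAt f z) : ∃ W : Opens (OnePoint ℂ), z ∈ W ∧ ∀ y ∈ W, HolAt f y := by
  have h := hf.eventually
  obtain ⟨V, hV, hVp⟩ := mem_comap.1 h
  obtain ⟨W, hW, hWo, hzW⟩ := mem_nhds_iff.1 hV
  -- The neighbourhood found so far controls affine points only: infinity is either `z` itself,
  -- where holomorphy is given, or can be removed.
  by_cases hz : z = OnePoint.infty
  · subst hz
    refine ⟨⟨W, hWo⟩, hzW, fun y hy => ?_⟩
    induction y using OnePoint.rec with
    | infty => exact hf
    | coe w => exact hVp (hW hy)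
  · refine ⟨⟨W, hWo⟩ ⊓ ⟨{OnePoint.infty}ᶜ, isOpen_compl_singleton⟩, ⟨hzW, hz⟩, fun y hy => ?_⟩
    induction y using OnePoint.rec with
    | infty => exact absurd rfl hy.2
    | coe w => exact hVp (hW hy.1)

lemma Germ.smul {f : OnePoint ℂ → ℂ} {z : OnePoint ℂ} {s : ∀ x : ℂ, E.Fib x} (hf : HolAt f z)
    (h : A.Germ z s) : A.Germ z (fun x => f x • s x) := by
  obtain ⟨W, hz, hW⟩ := hf.exists_opens
  obtain ⟨W', hW', hz', hs⟩ := h.exists_ofFun_le hz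
  exact germ_of_ofFun hz' (A.smul_mem W' f (fun y hy => hW y (hW' hy)) _ hs)

lemma Germ.sum {ι : Type*} (T : Finset ι) {s : ι → ∀ x : ℂ, E.Fib x} {z : OnePoint ℂ}
    (h : ∀ j ∈ T, A.Germ z (s j)) : A.Germ z (fun x => ∑ j ∈ T, s j x) := by
  classical
  induction T using Finset.induction_on with
  | empty => simpa using Germ.zero z
  | insert a T ha ih =>
    simp only [Finset.sum_insert ha]
    exact (h a (Finset.mem_insert_self a T)).add
      (ih fun j hj => h j (Finset.mem_insert_of_mem hj))

lemma Le.germ (h : A.Le B) {z : OnePoint ℂ} {s : ∀ x : ℂ, E.Fib x} (hs : A.Germ z s) :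
    B.Germ z s := by
  obtain ⟨W, hz, s', hs', e⟩ := hs
  exact ⟨W, hz, s', h W hs', e⟩

end OSub

lemma DSub.ext_of_le {N K : C.DSub} (h : N.Le K.toOSub) (h' : K.Le N.toOSub) : N = K :=
  DSub.ext (funext fun U => le_antisymm (h U) (h' U))

namespace DSub

variable {N : C.DSub}

lemma meroAt_of_germ {z : OnePoint ℂ} {s : ∀ x : ℂ, E.Fib x} (h : N.Germ z s) : C.MeroAt s z := by
  obtain ⟨W, hz, s', hs', e⟩ := h
  exact MeroAt.congr (N.mero W s' hs' z hz) e

lemma germ_D {w : ℂ} {s : ∀ x : ℂ, E.Fib x} (h : N.Germ w s) : N.Germ w (C.D s) := by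
  obtain ⟨W, hW, hz, hs⟩ := h.exists_ofFun_le
    (U := ⟨{OnePoint.infty}ᶜ, isOpen_compl_singleton⟩) (OnePoint.coe_ne_infty w)
  refine ⟨W, hz, _, N.del_mem W (fun h => hW h rfl) _ hs, ?_⟩
  filter_upwards [extend_del (C.ofFun W s) hz,
    D_congr_near (extend_ofFun_near s hz)] with x h1 h2
  rw [h1, h2]

lemma germ_D_infty {s : ∀ x : ℂ, E.Fib x} (h : N.Germ OnePoint.infty s) :
    N.Germ OnePoint.infty (fun x => (-(x ^ 2)) • C.D s x) := by
  obtain ⟨W, hW, hz, hs⟩ := h.exists_ofFun_le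
    (U := ⟨{((0 : ℂ) : OnePoint ℂ)}ᶜ, isOpen_compl_singleton⟩) (OnePoint.infty_ne_coe 0)
  refine ⟨W, hz, _, N.del_mem' W (fun h => hW h rfl) _ hs, ?_⟩
  filter_upwards [extend_del (C.ofFun W s) hz,
    D_congr_near (extend_ofFun_near s hz)] with x h1 h2
  rw [extend_mulFun, h1, h2]

end DSub

variable (C) in
/-- A system of germs of meromorphic sections, stable under differential operators. -/
structure GermSystem where
  mem : OnePoint ℂ → (∀ x : ℂ, E.Fib x) → Prop
  congr : ∀ {z s t}, mem z s → (∀ᶠ x in C.near z, s x = t x) → mem z t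
  zero : ∀ z, mem z fun _ => 0
  add : ∀ {z s t}, mem z s → mem z t → mem z fun x => s x + t x
  smul : ∀ {z s} {f : OnePoint ℂ → ℂ}, HolAt f z → mem z s → mem z fun x => f x • s x
  mero : ∀ {z s}, mem z s → C.MeroAt s z
  del : ∀ {w : ℂ} {s}, mem w s → mem w (C.D s)
  del' : ∀ {s}, mem OnePoint.infty s → mem OnePoint.infty fun x => (-(x ^ 2)) • C.D s x

namespace GermSystem

/-- The `𝒟`-module of sections with germs in a given system. -/
def toDSub (G : C.GermSystem) : C.DSub where
  carrier U :=
    { carrier := {s | ∀ z ∈ U, G.mem z (C.extend s)}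
      add_mem' := fun {s t} hs ht z hz => G.congr (G.add (hs z hz) (ht z hz))
        (Eventually.of_forall fun x => (extend_add s t x).symm)
      zero_mem' := fun z _ => G.congr (G.zero z)
        (Eventually.of_forall fun x => (extend_zero x).symm)
      smul_mem' := fun a s hs z hz => G.congr (G.smul (HolAt.const a z) (hs z hz))
        (Eventually.of_forall fun x => (extend_smul a s x).symm) }
  hol U s hs x := ((G.mero (hs x.1 x.2.1)).extendsAt (not_isSing_coe.2 x.2.2)).holSecC x.2.2
  res_mem U V h s hs z hz := G.congr (hs z (h hz))
    ((extend_restr_near h s hz).mono fun _ hx => hx.symm)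
  glue U s hs z hz := by
    obtain ⟨V, h, hzV, hV⟩ := hs z hz
    exact G.congr (hV z hzV) (extend_restr_near h s hzV)
  smul_mem U f hf s hs z hz := G.congr (G.smul (hf z hz) (hs z hz))
    (Eventually.of_forall fun x => (extend_mulFun (fun x => f x) s x).symm)
  mero U s hs z hz := G.mero (hs z hz)
  del_mem U hU s hs z hz := by
    induction z using OnePoint.rec with
    | infty => exact absurd hz hU
    | coe w => exact G.congr (G.del (hs w hz)) ((extend_del s hz).mono fun x hx => hx.symm)
  del_mem' U hU s hs z hz := by
    induction z using OnePoint.rec with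
    | infty =>
      refine G.congr (G.del' (hs _ hz)) ((extend_del s hz).mono fun x hx => ?_)
      rw [extend_mulFun, hx]
    | coe w =>
      -- At a finite point -x² is a holomorphic coefficient, so stability under ∂_t follows from
      -- stability under ∂_x.
      have hf : HolAt (fun z => -(subFun 0 z ^ 2)) (w : OnePoint ℂ) := ((holAt_subFun 0 w).pow 2).neg
      refine G.congr (G.smul hf (G.del (hs w hz))) ((extend_del s hz).mono fun x hx => ?_)
      rw [extend_mulFun, hx]
      simp [subFun]

lemma mem_of_germ {G : C.GermSystem} {z : OnePoint ℂ} {s : ∀ x : ℂ, E.Fib x}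
    (h : G.toDSub.Germ z s) : G.mem z s := by
  obtain ⟨W, hz, s', hs', e⟩ := h
  exact G.congr (hs' z hz) e

/-- The intersection of two systems. -/
def inf (G G' : C.GermSystem) : C.GermSystem where
  mem z s := G.mem z s ∧ G'.mem z s
  congr h e := ⟨G.congr h.1 e, G'.congr h.2 e⟩
  zero z := ⟨G.zero z, G'.zero z⟩
  add h h' := ⟨G.add h.1 h'.1, G'.add h.2 h'.2⟩
  smul hf h := ⟨G.smul hf h.1, G'.smul hf h.2⟩
  mero h := G.mero h.1
  del h := ⟨G.del h.1, G'.del h.2⟩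
  del' h := ⟨G.del' h.1, G'.del' h.2⟩

/-- The condition of a system, imposed at the points of `S` only. -/
def on (G : C.GermSystem) (S : Set (OnePoint ℂ)) : C.GermSystem where
  mem z s := C.MeroAt s z ∧ (z ∈ S → G.mem z s)
  congr h e := ⟨h.1.congr e, fun hz => G.congr (h.2 hz) e⟩
  zero z := ⟨(ExtendsAt.zero z).meroAt, fun _ => G.zero z⟩
  add h h' := ⟨h.1.add h'.1, fun hz => G.add (h.2 hz) (h'.2 hz)⟩
  smul hf h := ⟨h.1.smul hf, fun hz => G.smul hf (h.2 hz)⟩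
  mero h := h.1
  del h := ⟨h.1.D_coe, fun hz => G.del (h.2 hz)⟩
  del' h := ⟨h.1.D_infty, fun hz => G.del' (h.2 hz)⟩

/-- The germs of sections of a `𝒟`-module. -/
def ofDSub (N : C.DSub) : C.GermSystem where
  mem z s := N.Germ z s
  congr h e := h.congr e
  zero z := OSub.Germ.zero z
  add h h' := h.add h'
  smul hf h := h.smul hf
  mero h := DSub.meroAt_of_germ h
  del h := DSub.germ_D h
  del' h := DSub.germ_D_infty h

end GermSystem

/-! ### The `𝒟`-module generated by `E` -/

variable (C) in
/-- The germs at `z` obtained from holomorphic sections of `E` by at most `n` derivations. -/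
def Fil (z : OnePoint ℂ) : ℕ → (∀ x : ℂ, E.Fib x) → Prop
  | 0, s => C.ExtendsAt s z
  | n + 1, s => ∃ a b, Fil z n a ∧ Fil z n b ∧ ∀ᶠ x in C.near z, s x = a x + C.D b x

namespace Fil

variable {z : OnePoint ℂ} {n : ℕ} {s t : ∀ x : ℂ, E.Fib x}

lemma congr (h : C.Fil z n s) (e : ∀ᶠ x in C.near z, s x = t x) : C.Fil z n t := by
  cases n with
  | zero => exact ExtendsAt.congr h e
  | succ n =>
    obtain ⟨a, b, ha, hb, h⟩ := h
    exact ⟨a, b, ha, hb, by filter_upwards [h, e] with x h1 h2; rw [← h2, h1]⟩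

lemma zero : C.Fil z n (fun _ => 0) := by
  induction n with
  | zero => exact ExtendsAt.zero z
  | succ n ih =>
    refine ⟨_, _, ih, ih, ?_⟩
    filter_upwards [C.near_notMem z] with x hx
    rw [D_zero hx, add_zero]

lemma succ (h : C.Fil z n s) : C.Fil z (n + 1) s := by
  refine ⟨s, _, h, zero, ?_⟩
  filter_upwards [C.near_notMem z] with x hx
  rw [D_zero hx, add_zero]

lemma mono {m : ℕ} (hmn : n ≤ m) (h : C.Fil z n s) : C.Fil z m s := by
  induction hmn with
  | refl => exact h
  | step _ ih => exact ih.succ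

lemma D (h : C.Fil z n s) : C.Fil z (n + 1) (C.D s) :=
  ⟨_, s, zero, h, Eventually.of_forall fun _ => (zero_add _).symm⟩

lemma holSecC_near (h : C.Fil z n s) : ∀ᶠ x in C.near z, E.HolSecC s x := by
  induction n generalizing s with
  | zero => exact ExtendsAt.holSecC_near h
  | succ n ih =>
    obtain ⟨a, b, ha, hb, h⟩ := h
    filter_upwards [ih ha, ih hb, C.near_eventually h, C.near_notMem z] with x h1 h2 h3 hxP
    exact (h1.add (C.D_hol b x hxP h2)).congr (h3.mono fun y hy => hy.symm)

lemma add (h : C.Fil z n s) (h' : C.Fil z n t) : C.Fil z n (fun x => s x + t x) := by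
  induction n generalizing s t with
  | zero => exact ExtendsAt.add h h'
  | succ n ih =>
    obtain ⟨a, b, ha, hb, h⟩ := h
    obtain ⟨a', b', ha', hb', h'⟩ := h'
    refine ⟨_, _, ih ha ha', ih hb hb', ?_⟩
    filter_upwards [h, h', hb.holSecC_near, hb'.holSecC_near, C.near_notMem z]
      with x h1 h2 h3 h4 hxP
    rw [h1, h2, D_add' hxP h3 h4]
    abel

/-- Leibniz in the form f ∂b = ∂(f b) - f' b: both f b and f' b stay in the step of b, so each step
of the filtration is an 𝒪-module. -/
lemma smul {f : OnePoint ℂ → ℂ} {w : ℂ} (hf : HolAt f w) (h : C.Fil w n s) :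
    C.Fil w n (fun x => f x • s x) := by
  induction n generalizing s f with
  | zero => exact ExtendsAt.smul hf h
  | succ n ih =>
    obtain ⟨a, b, ha, hb, h⟩ := h
    refine ⟨_, _, (ih hf ha).add (ih (hf.derivFun_coe.neg) hb), ih hf hb, ?_⟩
    filter_upwards [h, hb.holSecC_near, C.near_notMem w, C.near_le w hf.eventually]
      with x h1 h2 hxP hfx
    rw [h1, C.D_smul (fun y => f y) b x hxP hfx h2]
    change _ = f x • a x + (-deriv (fun u : ℂ => f u) x) • b x + _
    module

lemma extendsAt {w : ℂ} (hw : w ∉ C.P) (h : C.Fil w n s) : C.ExtendsAt s w := by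
  have := h.holSecC_near
  rw [C.near_coe hw] at this
  exact (extendsAt_coe hw).2 this.self_of_nhds

lemma meroAt {w : ℂ} (h : C.Fil w n s) : C.MeroAt s w := by
  induction n generalizing s with
  | zero => exact ExtendsAt.meroAt h
  | succ n ih =>
    obtain ⟨a, b, ha, hb, h⟩ := h
    exact ((ih ha).add (ih hb).D_coe).congr (h.mono fun x hx => hx.symm)

end Fil

variable (C) in
/-- The germs of sections of the `𝒟`-module generated by `E`. -/
def minSystem : C.GermSystem where
  -- At infinity all meromorphic germs are admitted. That E generates them there under
  -- resonance-freeness is part of `DSub.germ_of_minSystem`.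
  mem z s := (z = OnePoint.infty → C.MeroAt s z) ∧ (z ≠ OnePoint.infty → ∃ n, C.Fil z n s)
  congr h e := ⟨fun hz => (h.1 hz).congr e, fun hz => let ⟨n, hn⟩ := h.2 hz; ⟨n, hn.congr e⟩⟩
  zero z := ⟨fun _ => (ExtendsAt.zero z).meroAt, fun _ => ⟨0, ExtendsAt.zero z⟩⟩
  add h h' := ⟨fun hz => (h.1 hz).add (h'.1 hz), fun hz =>
    let ⟨n, hn⟩ := h.2 hz; let ⟨m, hm⟩ := h'.2 hz
    ⟨max n m, (hn.mono (le_max_left n m)).add (hm.mono (le_max_right n m))⟩⟩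
  smul {z s f} hf h := by
    refine ⟨fun hz => (h.1 hz).smul hf, fun hz => ?_⟩
    obtain ⟨n, hn⟩ := h.2 hz
    induction z using OnePoint.rec with
    | infty => exact absurd rfl hz
    | coe w => exact ⟨n, hn.smul hf⟩
  mero {z s} h := by
    induction z using OnePoint.rec with
    | infty => exact h.1 rfl
    | coe w => exact (h.2 (OnePoint.coe_ne_infty w)).choose_spec.meroAt
  del {w s} h := ⟨fun hz => absurd hz (OnePoint.coe_ne_infty w), fun hz =>
    let ⟨n, hn⟩ := h.2 hz; ⟨n + 1, hn.D⟩⟩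
  del' h := ⟨fun hz => (h.1 hz).D_infty, fun hz => absurd rfl hz⟩

lemma minSystem_coe {w : ℂ} {s : ∀ x : ℂ, E.Fib x} :
    C.minSystem.mem w s ↔ ∃ n, C.Fil w n s :=
  ⟨fun h => h.2 (OnePoint.coe_ne_infty w), fun h =>
    ⟨fun hz => absurd hz (OnePoint.coe_ne_infty w), fun _ => h⟩⟩

lemma minSystem_infty {s : ∀ x : ℂ, E.Fib x} :
    C.minSystem.mem OnePoint.infty s ↔ C.MeroAt s OnePoint.infty :=
  ⟨fun h => h.1 rfl, fun h => ⟨fun _ => h, fun hz => absurd rfl hz⟩⟩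

lemma ExtendsAt.minSystem {z : OnePoint ℂ} {s : ∀ x : ℂ, E.Fib x} (h : C.ExtendsAt s z) :
    C.minSystem.mem z s := ⟨fun _ => h.meroAt, fun _ => ⟨0, h⟩⟩

variable (C) in
/-- The `𝒟`-module generated by `E`. -/
def minExt : C.DSub := C.minSystem.toDSub

/-- A germ satisfying the condition at `z` spreads out to a section: on a small neighbourhood `z` is
the only possible singular point, and at all others the representative is holomorphic, hence in E.
-/
lemma germ_minExt {z : OnePoint ℂ} {s : ∀ x : ℂ, E.Fib x} :
    C.minExt.Germ z s ↔ C.minSystem.mem z s := by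
  refine ⟨GermSystem.mem_of_germ, fun h => ?_⟩
  obtain ⟨W, hz, hW⟩ := exists_opens_of_near (C.minSystem.mero h).holSecC_near
  obtain ⟨W', hz', hW'⟩ := C.exists_opens_isSing z
  refine OSub.germ_of_ofFun (W := W ⊓ W') ⟨hz, hz'⟩ fun y hy => ?_
  by_cases hyz : y = z
  · subst hyz
    exact C.minSystem.congr h ((extend_ofFun_near s hy).mono fun x hx => hx.symm)
  · obtain ⟨w, rfl, hw⟩ := exists_coe_of_not_isSing fun hs => hyz (hW' y hy.2 hs)
    refine ExtendsAt.minSystem (ExtendsAt.congr ((extendsAt_coe hw).2 (hW w hy.1 hw)) ?_)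
    exact (extend_ofFun_near s hy).mono fun x hx => hx.symm

end SingConn

namespace SingConn

variable {r : ℕ} {E : HolBundle r} {C : SingConn E}

/-! ### Adapted frames -/

variable (C) in
/-- A frame near the point `w` of the affine line in which `∇` is logarithmic at `w` with diagonal
residue, none of whose eigenvalues is a nonzero integer. -/
structure LogFrame (w : ℂ) where
  e : Fin r → ∀ x, E.Fib x
  isFrame : E.IsFrameAt e w
  μ : Fin r → ℂ
  μ_ne : ∀ k, ∀ n : ℤ, n ≠ 0 → μ k ≠ n
  H : Fin r → Fin r → OnePoint ℂ → ℂ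
  holAt_H : ∀ k l, HolAt (H k l) w
  D_e : ∀ k, ∀ᶠ x in C.near w, (x - w) • C.D (fun y => e k y) x =
    μ k • e k x + (x - w) • ∑ l, H l k x • e l x

/-- At a point of `P` a nonzero integer eigenvalue would have integral real part. At any other point
an arbitrary frame serves, with residue zero; this allows regular and singular finite points to be
treated alike. -/
lemma ResonanceFree.exists_logFrame (hC : C.ResonanceFree) (w : ℂ) : Nonempty (C.LogFrame w) := by
  by_cases hw : w ∈ C.P
  · obtain ⟨e, he, H, hH, hD⟩ := C.log_form w hw
    refine ⟨⟨e, he, C.μ w, fun k n hn h => ?_, H, hH, fun k => ?_⟩⟩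
    · refine hC.re_fin w hw k ?_ n ?_
      · rw [h]; exact_mod_cast hn
      · rw [h]; exact Complex.intCast_re n
    · filter_upwards [near_le_nhdsNE hw (hD k), C.near_notMem w] with x hx hxP
      have hxw : x - w ≠ 0 := sub_ne_zero.2 fun h => hxP (h ▸ hw)
      rw [hx, smul_add, smul_smul, mul_div_cancel₀ _ hxw]
  · obtain ⟨i, hi⟩ := E.cover w
    have he := HolBundle.isFrameAt_frame hi
    have hD : ∀ k, ∃ c : Fin r → OnePoint ℂ → ℂ, (∀ l, HolAt (c l) w) ∧ ∀ᶠ x : ℂ in C.near w,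
        C.D (fun y => E.frame i y k) x = ∑ l, c l x • E.frame i x l := fun k =>
      ((extendsAt_frame he k).D (not_isSing_coe.2 hw)).exists_coeff he
    choose c hc hD using hD
    refine ⟨⟨_, he, 0, fun k n hn h => hn ?_, fun l k => c k l, fun l k => hc k l, fun k => ?_⟩⟩
    · exact Int.cast_eq_zero.1 (h.symm : (n : ℂ) = 0)
    · filter_upwards [hD k] with x hx
      rw [hx, Pi.zero_apply, zero_smul, zero_add]

variable (C) in
/-- A frame near infinity adapted to `∇`. -/
structure IrrFrame where
  e : Fin r → ∀ x, E.Fib x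
  isFrame : E.IsFrameAt e OnePoint.infty
  H : Fin r → Fin r → OnePoint ℂ → ℂ
  holAt_H : ∀ k l, HolAt (H k l) OnePoint.infty
  D_e : ∀ k, ∀ᶠ x in C.near OnePoint.infty, C.D (fun y => e k y) x =
    (C.α k + C.ν k / x) • e k x + ∑ l, ((x⁻¹) ^ 2 * H l k x) • e l x

variable (C) in
lemma exists_irrFrame : Nonempty C.IrrFrame := by
  obtain ⟨e, he, H, hH, hD⟩ := C.irr_form
  exact ⟨⟨e, he, H, hH, fun k => near_infty_le (hD k)⟩⟩

/-! ### The `𝒟`-module generated by `E` is contained in every extension -/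

lemma LogFrame.D_pow_smul {w : ℂ} (L : C.LogFrame w) (n : ℕ) (k : Fin r) :
    ∀ᶠ x in C.near w, C.D (fun y => (y - w) ^ (n + 1) • L.e k y) x =
      ((n + 1 : ℂ) + L.μ k) • (x - w) ^ n • L.e k x +
        ∑ l, L.H l k x • (x - w) ^ (n + 1) • L.e l x := by
  filter_upwards [L.D_e k, holSecC_near (L.isFrame.hol k), C.near_notMem w] with x hx hxe hxP
  have hd : HasDerivAt (fun y => (y - w) ^ (n + 1)) (((n + 1 : ℕ) : ℂ) * (x - w) ^ n * 1) x :=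
    ((hasDerivAt_id x).sub_const w).fun_pow (n + 1)
  rw [C.D_smul (fun y => (y - w) ^ (n + 1)) _ x hxP
    ((analyticAt_id.fun_sub analyticAt_const).fun_pow (n + 1)) hxe, hd.deriv, pow_succ,
    mul_smul ((x - w) ^ n) (x - w) (C.D _ x), hx]
  simp only [Finset.smul_sum, smul_add]
  push_cast
  have : ∀ l, (x - w) ^ n • (x - w) • L.H l k x • L.e l x =
      L.H l k x • ((x - w) ^ n * (x - w)) • L.e l x := fun l => by module
  simp only [this]
  module

namespace DSub

variable {N : C.DSub}

/-- By `LogFrame.D_pow_smul` the derivative of (x-w)^(n+1) e_k is (n+1+μ_k)(x-w)^n e_k modulo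
(x-w)^(n+1) E. The scalar is nonzero, since μ_k is not the negative integer -(n+1), so the exponent
can be lowered one at a time. -/
lemma germ_of_pow_smul {w : ℂ} (L : C.LogFrame w) (n : ℕ)
    (h : ∀ k, N.Germ w (fun x => (x - w) ^ n • L.e k x)) (k : Fin r) :
    N.Germ w (fun x => L.e k x) := by
  induction n generalizing k with
  | zero => simpa using h k
  | succ n ih =>
    refine ih (fun k => ?_) k
    have hne : (n + 1 : ℂ) + L.μ k ≠ 0 := fun h0 => by
      refine L.μ_ne k (-(n + 1 : ℤ)) (by omega) ?_
      push_cast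
      linear_combination h0
    have h1 := germ_D (h k)
    have h2 : N.Germ w (fun x => ∑ l, L.H l k x • (x - w) ^ (n + 1) • L.e l x) :=
      OSub.Germ.sum _ fun l _ => OSub.Germ.smul (L.holAt_H l k) (h l)
    refine ((h1.add (h2.smul (HolAt.const (-1) _))).smul
      (HolAt.const ((n + 1 : ℂ) + L.μ k)⁻¹ _)).congr ?_
    filter_upwards [L.D_pow_smul n k] with x hx
    rw [hx, neg_one_smul, add_neg_cancel_right, inv_smul_smul₀ hne]

lemma germ_of_extendsAt {z : OnePoint ℂ} {e : Fin r → ∀ x, E.Fib x} (he : E.IsFrameAt e z)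
    (h : ∀ k, N.Germ z (fun x => e k x)) {s : ∀ x : ℂ, E.Fib x} (hs : C.ExtendsAt s z) :
    N.Germ z s := by
  obtain ⟨c, hc, hs⟩ := hs.exists_coeff he
  exact (OSub.Germ.sum Finset.univ fun k _ => (h k).smul (hc k)).congr
    (hs.mono fun x hx => hx.symm)

lemma germ_of_fil {w : ℂ} (h : ∀ s, C.ExtendsAt s w → N.Germ w s) {n : ℕ} {s : ∀ x : ℂ, E.Fib x}
    (hs : C.Fil w n s) : N.Germ w s := by
  induction n generalizing s with
  | zero => exact h s hs
  | succ n ih =>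
    obtain ⟨a, b, ha, hb, e⟩ := hs
    exact ((ih ha).add (germ_D (ih hb))).congr (e.mono fun x hx => hx.symm)

/-- Applying ∂_t = -x²∂_x to x^m e_k gives -(m+ν_k) x^(m+1) e_k - α_k x^(m+2) e_k modulo x^m E. One
of the two terms always gives access to the next power of x. -/
lemma germ_zpow_smul (hC : C.ResonanceFree) (L : C.IrrFrame) (m : ℤ)
    (h : ∀ k, N.Germ OnePoint.infty (fun x => x ^ m • L.e k x)) (k : Fin r) :
    N.Germ OnePoint.infty (fun x => x ^ (m + 1) • L.e k x) := by
  have h1 := germ_D_infty (h k)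
  have h2 : N.Germ OnePoint.infty (fun x => ∑ l, L.H l k x • x ^ m • L.e l x) :=
    OSub.Germ.sum _ fun l _ => OSub.Germ.smul (L.holAt_H l k) (h l)
  have h3 : ∀ᶠ x in C.near OnePoint.infty, (-(x ^ 2)) • C.D (fun y => y ^ m • L.e k y) x =
      (-(m + C.ν k)) • x ^ (m + 1) • L.e k x + (-C.α k) • x ^ (m + 2) • L.e k x -
        ∑ l, L.H l k x • x ^ m • L.e l x := by
    filter_upwards [L.D_e k, holSecC_near (L.isFrame.hol k), C.near_notMem _,
      near_infty_le (eventually_ne_cocompact 0)] with x hx hxe hxP hx0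
    rw [C.D_smul (fun y => y ^ m) _ x hxP (analyticAt_id.fun_zpow hx0) hxe,
      (hasDerivAt_zpow m x (Or.inl hx0)).deriv, hx]
    simp only [smul_add, Finset.smul_sum, smul_smul, sub_eq_add_neg, ← Finset.sum_neg_distrib,
      ← neg_smul]
    rw [← add_assoc, ← add_smul, ← add_smul]
    congr 1
    · congr 1
      rw [zpow_add₀ hx0, zpow_add₀ hx0, zpow_add₀ hx0, zpow_neg_one]
      norm_cast
      field_simp
      ring
    · refine Finset.sum_congr rfl fun l _ => ?_
      congr 1
      field_simp
  -- For α_k = 0 the coefficient -(m+ν_k) is inverted. Otherwise division by x turns the top term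
  -- into -α_k x^(m+1) e_k and the other into a multiple of x^m e_k, already available.
  by_cases hα : C.α k = 0
  · have hne : -(m + C.ν k) ≠ 0 := fun h0 => by
      refine hC.re_inf k (-m) ?_
      have : C.ν k = ((-m : ℤ) : ℂ) := by push_cast; linear_combination -h0
      rw [this]
      exact Complex.intCast_re _
    refine ((h1.add h2).smul (HolAt.const (-(m + C.ν k))⁻¹ _)).congr ?_
    filter_upwards [h3] with x hx
    rw [hx, hα, neg_zero, zero_smul, add_zero, sub_add_cancel, inv_smul_smul₀ hne]
  · refine ((((h1.add h2).smul holAt_invFun).add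
      ((h k).smul (HolAt.const (m + C.ν k) _))).smul (HolAt.const (-C.α k)⁻¹ _)).congr ?_
    filter_upwards [h3, near_infty_le (eventually_ne_cocompact 0)] with x hx hx0
    rw [hx, sub_add_cancel]
    change (-C.α k)⁻¹ • (x⁻¹ • _ + _) = _
    simp only [smul_smul, ← add_smul]
    congr 1
    rw [zpow_add₀ hx0, zpow_add₀ hx0]
    norm_cast
    field_simp
    ring

/-- A `𝒟`-module that contains `E` up to a power of the local equation at `z` contains the germs
at `z` of the `𝒟`-module generated by `E`. -/
lemma germ_of_minSystem (hC : C.ResonanceFree) {z : OnePoint ℂ} {n : ℕ}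
    (h : ∀ s, C.ExtendsAt s z → N.Germ z (fun x => unif z x ^ n • s x)) {s : ∀ x : ℂ, E.Fib x}
    (hs : C.minSystem.mem z s) : N.Germ z s := by
  induction z using OnePoint.rec with
  | infty =>
    obtain ⟨L⟩ := C.exists_irrFrame
    -- Starting from x^(-n) E, all higher powers of x are reached; a germ with a pole of order m at
    -- infinity is then a holomorphic combination of the x^m e_k.
    have h1 : ∀ m : ℕ, ∀ k, N.Germ OnePoint.infty (fun x => x ^ (-(n : ℤ) + m) • L.e k x) := by
      intro m
      induction m with
      | zero =>
        intro k
        refine (h _ (extendsAt_frame L.isFrame k)).congr (Eventually.of_forall fun x => ?_)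
        rw [Nat.cast_zero, add_zero, zpow_neg, zpow_natCast, ← inv_pow]
        rfl
      | succ m ih =>
        intro k
        have := germ_zpow_smul hC L _ ih k
        simpa [add_assoc] using this
    obtain ⟨m, -, hm⟩ := minSystem_infty.1 hs
    obtain ⟨c, hc, hm⟩ := hm.exists_coeff L.isFrame
    refine (OSub.Germ.sum Finset.univ fun k _ => (h1 (n + m) k).smul (hc k)).congr ?_
    filter_upwards [hm, near_infty_le (eventually_ne_cocompact 0)] with x hx hx0
    have e1 : (x ^ m) • (x⁻¹) ^ m • s x = s x := by
      rw [smul_smul, ← mul_pow, mul_inv_cancel₀ hx0, one_pow, one_smul]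
    change (x⁻¹) ^ m • s x = _ at hx
    rw [← e1, hx, Finset.smul_sum]
    refine Finset.sum_congr rfl fun k _ => ?_
    rw [smul_comm, Nat.cast_add, neg_add_cancel_left, zpow_natCast]
  | coe w =>
    obtain ⟨L⟩ := hC.exists_logFrame w
    obtain ⟨m, hm⟩ := minSystem_coe.1 hs
    refine germ_of_fil (fun t ht => germ_of_extendsAt L.isFrame (germ_of_pow_smul L n fun k => ?_) ht) hm
    exact h _ (extendsAt_frame L.isFrame k)

lemma IsExtension.exists_germ (h : N.IsExtension) (z : OnePoint ℂ) :
    ∃ n : ℕ, ∀ s, C.ExtendsAt s z → N.Germ z (fun x => unif z x ^ n • s x) := by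
  obtain ⟨i, hi⟩ := E.cover z
  have h1 : ∀ k, ∃ n : ℕ, N.Germ z (fun x => unif z x ^ n • E.frame i x k) := by
    intro k
    obtain ⟨W, hW, hz, n, -, hn⟩ := h (E.dom i) (C.ofFun _ fun x => E.frame i x k) (fun y hy =>
      MeroAt.congr (extendsAt_frame (HolBundle.isFrameAt_frame hy) k).meroAt
        ((extend_ofFun_near _ hy).mono fun x hx => hx.symm)) z hi
    exact ⟨n, OSub.germ_of_ofFun hz hn⟩
  choose n hn using h1
  refine ⟨Finset.univ.sup n, fun s hs => ?_⟩
  obtain ⟨c, hc, hs⟩ := hs.exists_coeff (HolBundle.isFrameAt_frame hi)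
  refine (OSub.Germ.sum Finset.univ fun k _ => ((hn k).smul
    ((holAt_unifFun z).pow (Finset.univ.sup n - n k))).smul (hc k)).congr ?_
  filter_upwards [hs] with x hx
  rw [hx, Finset.smul_sum]
  refine Finset.sum_congr rfl fun k _ => ?_
  rw [unifFun_coe, smul_smul (unif z x ^ _), ← pow_add,
    Nat.sub_add_cancel (Finset.le_sup (Finset.mem_univ k)), smul_comm]

lemma minExt_le (hC : C.ResonanceFree)
    (h : ∀ z, ∃ n : ℕ, ∀ s, C.ExtendsAt s z → N.Germ z (fun x => unif z x ^ n • s x)) :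
    C.minExt.Le N.toOSub := fun U s hs => OSub.mem_of_germ fun z hz => by
  obtain ⟨n, hn⟩ := h z
  exact germ_of_minSystem hC hn (hs z hz)

end DSub

lemma minExt_isExtension : C.minExt.IsExtension := by
  intro U s hs z hz
  obtain ⟨k, hk, h⟩ := hs z hz
  obtain ⟨W, hWU, hzW, hW⟩ := (germ_minExt.2 h.minSystem).exists_ofFun_le hz
  refine ⟨W, hWU, hzW, k, hk, ?_⟩
  convert hW using 1
  funext x
  change _ • s ⟨x.1, _⟩ = _ • C.extend s x.1
  rw [extend_apply s ⟨x.1, hWU x.2.1, x.2.2⟩]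

/-- On the domain of a frame, the `𝒟`-module generated by `E` is generated by the frame. -/
lemma minExt_le_of_frame (hC : C.ResonanceFree) {N : C.DSub} {i : E.ι} {W : Opens (OnePoint ℂ)}
    (hW : W ≤ E.dom i) (h : ∀ k, C.ofFun W (fun x => E.frame i x k) ∈ N.carrier W)
    {V : Opens (OnePoint ℂ)} (hV : V ≤ W) : C.minExt.carrier V ≤ N.carrier V := by
  intro s hs
  refine OSub.mem_of_germ fun z hz => DSub.germ_of_minSystem (n := 0) hC (fun t ht => ?_) (hs z hz)
  simp only [pow_zero, one_smul]
  exact DSub.germ_of_extendsAt (HolBundle.isFrameAt_frame (hW (hV hz)))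
    (fun k => OSub.germ_of_ofFun (hV hz) (h k)) ht

lemma ofFun_frame_mem {N : C.DSub} (h : ∀ z s, C.ExtendsAt s z → N.Germ z s) {i : E.ι}
    {W : Opens (OnePoint ℂ)} (hW : W ≤ E.dom i) (k : Fin r) :
    C.ofFun W (fun x => E.frame i x k) ∈ N.carrier W :=
  OSub.mem_of_germ fun z hz => (h z _ (extendsAt_frame (HolBundle.isFrameAt_frame (hW hz)) k)).congr
    ((extend_ofFun_near _ hz).mono fun _ hx => hx.symm)

/-- The r sections of a local frame generate: by `minExt_le_of_frame` every 𝒟-module containing them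
contains `minExt` on the domain of the frame. -/
lemma minExt_isCoherent (hC : C.ResonanceFree) : C.minExt.IsCoherent := by
  classical
  intro z
  obtain ⟨i, hi⟩ := E.cover z
  refine ⟨E.dom i, hi, Finset.univ.image fun k => C.ofFun _ fun x => E.frame i x k, ?_, ?_⟩
  · intro s hs
    obtain ⟨k, -, rfl⟩ := Finset.mem_image.1 hs
    exact ofFun_frame_mem (fun z s h => germ_minExt.2 h.minSystem) le_rfl k
  · intro N' h V hV
    exact minExt_le_of_frame hC le_rfl
      (fun k => h _ (Finset.mem_image_of_mem _ (Finset.mem_univ k))) hV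

/-- Sections of a sheaf of holomorphic sections are determined outside of a point. -/
lemma OSub.eq_bot_of_support (K : C.OSub) (z : OnePoint ℂ) (h : ∀ U, z ∉ U → K.carrier U = ⊥)
    (U : Opens (OnePoint ℂ)) : K.carrier U = ⊥ := by
  rw [eq_bot_iff]
  intro s hs
  have h1 : ∀ x : C.Punct U, (x.1 : OnePoint ℂ) ≠ z → s x = 0 := by
    intro x hx
    let V : Opens (OnePoint ℂ) := U ⊓ ⟨{z}ᶜ, isOpen_compl_singleton⟩
    have h2 : C.restr (inf_le_left : V ≤ U) s ∈ K.carrier V := K.res_mem U V inf_le_left s hs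
    rw [h V fun h => h.2 rfl] at h2
    exact congrFun ((Submodule.mem_bot ℂ).1 h2) ⟨x.1, ⟨x.2.1, hx⟩, x.2.2⟩
  refine (Submodule.mem_bot ℂ).2 (funext fun x => ?_)
  by_cases hx : (x.1 : OnePoint ℂ) = z
  · obtain ⟨i, hi⟩ := E.cover x.1
    have h2 := K.hol U s hs x i hi
    have h3 : ∀ᶠ y in 𝓝[≠] x.1, C.extend s y = 0 := by
      filter_upwards [self_mem_nhdsWithin] with y hy
      by_cases h : (y : OnePoint ℂ) ∈ U ∧ y ∉ C.P
      · rw [extend_apply s ⟨y, h⟩]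
        exact h1 ⟨y, h⟩ fun h' => hy (OnePoint.coe_injective (h'.trans hx.symm))
      · exact dif_neg h
    -- The value at the remaining point is zero by continuity of the coordinates.
    refine (E.frame i x.1).repr.map_eq_zero_iff.1 (Finsupp.ext fun k => ?_)
    have h4 := ((h2 k).continuousAt.eventuallyEq_nhds_iff_eventuallyEq_nhdsNE
      (g := fun _ => 0) continuousAt_const).1 (h3.mono fun y hy => by simp [hy])
    have h5 := h4.self_of_nhds
    simp only [extend_apply s x] at h5
    exact h5
  · exact h1 x hx

end SingConn

/-! ### Coherent submodules and meromorphic matrices. -/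

lemma meromorphicAt_det {n : Type*} [Fintype n] [DecidableEq n] {m : ℂ → Matrix n n ℂ} {u : ℂ}
    (h : ∀ k j, MeromorphicAt (fun v => m v k j) u) : MeromorphicAt (fun v => (m v).det) u := by
  simp only [Matrix.det_apply']
  exact MeromorphicAt.fun_sum fun σ _ => (MeromorphicAt.const _ u).fun_mul
    (MeromorphicAt.fun_prod fun i _ => h _ _)

/-- Cramer's rule: the entries are cofactors divided by the determinant. -/
lemma meromorphicAt_matrix_inv {n : Type*} [Fintype n] [DecidableEq n] {m : ℂ → Matrix n n ℂ}
    {u : ℂ} (h : ∀ k j, MeromorphicAt (fun v => m v k j) u) (k j : n) :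
    MeromorphicAt (fun v => (m v)⁻¹ k j) u := by
  simp only [Matrix.inv_def, Ring.inverse_eq_inv', Matrix.smul_apply, smul_eq_mul,
    Matrix.adjugate_apply]
  refine (meromorphicAt_det h).fun_inv.fun_mul (meromorphicAt_det fun a b => ?_)
  by_cases ha : a = j
  · subst ha
    simp only [Matrix.updateRow_self]
    exact MeromorphicAt.const _ u
  · simp only [Matrix.updateRow_ne ha]
    exact h a b

namespace SingConn

variable {r : ℕ} {E : HolBundle r} {C : SingConn E}

lemma tendsto_coord_near {z : OnePoint ℂ} (hz : C.IsSing z) :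
    Tendsto (fun x : ℂ => coord z x) (C.near z) (𝓝[≠] base z) := by
  refine tendsto_nhdsWithin_iff.2 ⟨fun s hs => near_of_nhds (C := C) (tendsto_coord z hs), ?_⟩
  filter_upwards [unif_ne_zero z hz] with x hx h
  refine hx ?_
  rw [← unifFun_coe, unifFun, sub_eq_zero]
  exact h

variable (C) in
lemma affine_coord (z : OnePoint ℂ) : ∀ᶠ x : ℂ in C.near z, affine z (coord z x) = x := by
  refine Eventually.of_forall fun x => ?_
  induction z using OnePoint.rec with
  | infty => exact inv_inv x
  | coe w => rfl

/-- Meromorphic sections that agree in a punctured neighbourhood of `z` agree near `z`. -/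
lemma near_eq_of_punctured {z : OnePoint ℂ} {s t : ∀ x : ℂ, E.Fib x} (hs : C.MeroAt s z)
    (ht : C.MeroAt t z) (h : ∀ᶠ u in 𝓝[≠] base z, s (affine z u) = t (affine z u)) :
    ∀ᶠ x in C.near z, s x = t x := by
  by_cases hz : C.IsSing z
  · filter_upwards [(tendsto_coord_near hz).eventually h, affine_coord C z] with x hx hx'
    rwa [hx'] at hx
  · have hs' := hs.extendsAt hz
    have ht' := ht.extendsAt hz
    obtain ⟨w, rfl, hw⟩ := exists_coe_of_not_isSing hz
    rw [extendsAt_coe hw] at hs' ht'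
    rw [C.near_coe hw]
    obtain ⟨i, hi⟩ := E.cover w
    have h1 : ∀ k, ∀ᶠ x : ℂ in 𝓝 w, (E.frame i x).repr (s x) k = (E.frame i x).repr (t x) k :=
      fun k => ((hs' i hi k).continuousAt.eventuallyEq_nhds_iff_eventuallyEq_nhdsNE
        (ht' i hi k).continuousAt).1
        (Eventually.mono h fun x (hx : s x = t x) => by simp only [hx])
    filter_upwards [eventually_all.2 h1] with x hx
    exact (E.frame i x).repr.injective (Finsupp.ext hx)

/-- The coordinates of a meromorphic section in a frame are meromorphic. -/
lemma MeroAt.meromorphicAt {z : OnePoint ℂ} {s : ∀ x : ℂ, E.Fib x} (h : C.MeroAt s z) {i : E.ι}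
    (hi : z ∈ E.dom i) (k : Fin r) : MeromorphicAt
      (fun u => (E.frame i (affine z u)).repr (s (affine z u)) k) (base z) := by
  obtain ⟨n, -, σ, h1, h2⟩ := h
  have h3 : AnalyticAt ℂ (fun u => (E.frame i (param z u)).repr (σ (param z u)) k) (base z) :=
    h1 i hi k
  have h4 : MeromorphicAt (fun u : ℂ => (u - base z) ^ n) (base z) :=
    ((analyticAt_id.fun_sub analyticAt_const).fun_pow n).meromorphicAt
  refine (h4.fun_inv.fun_mul h3.meromorphicAt).congr ?_
  filter_upwards [(tendsto_affine C z).eventually h2, self_mem_nhdsWithin] with u hu hu'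
  have hu0 : (u - base z) ^ n ≠ 0 := pow_ne_zero n (sub_ne_zero.2 hu')
  have h5 : unif z (affine z u) = u - base z := by
    rw [← unifFun_coe, ← param_eq_affine hu', unifFun, coord_param]
  rw [h5] at hu
  rw [param_eq_affine hu', ← hu, map_smul, Finsupp.smul_apply, smul_eq_mul,
    inv_mul_cancel_left₀ hu0]

lemma analyticAt_affine {z : OnePoint ℂ} {u : ℂ} (hu : u ≠ base z) :
    AnalyticAt ℂ (affine z) u := by
  induction z using OnePoint.rec with
  | infty => exact analyticAt_inv hu
  | coe w => exact analyticAt_id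

variable (C) in
/-- The iterated derivatives of the members of `T`. -/
inductive IsDeriv (T : (∀ x : ℂ, E.Fib x) → Prop) : (∀ x : ℂ, E.Fib x) → Prop
  | base {s} : T s → IsDeriv T s
  | D {s} : IsDeriv T s → IsDeriv T (C.D s)

variable (C) in
/-- The germs at `z` of holomorphic combinations of the sections in `Q`. -/
inductive SpanAt (Q : (∀ x : ℂ, E.Fib x) → Prop) (z : OnePoint ℂ) : (∀ x : ℂ, E.Fib x) → Prop
  | of {s} : Q s → SpanAt Q z s
  | zero : SpanAt Q z fun _ => 0
  | add {s t} : SpanAt Q z s → SpanAt Q z t → SpanAt Q z fun x => s x + t x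
  | smul {s} {f : OnePoint ℂ → ℂ} : HolAt f z → SpanAt Q z s → SpanAt Q z fun x => f x • s x
  | congr {s t} : SpanAt Q z s → (∀ᶠ x in C.near z, s x = t x) → SpanAt Q z t

namespace SpanAt

variable {Q : (∀ x : ℂ, E.Fib x) → Prop} {s : ∀ x : ℂ, E.Fib x}

lemma extendsAt {z : OnePoint ℂ} (hQ : ∀ σ, Q σ → C.ExtendsAt σ z) (h : C.SpanAt Q z s) :
    C.ExtendsAt s z := by
  induction h with
  | of h => exact hQ _ h
  | zero => exact ExtendsAt.zero z
  | add _ _ h h' => exact h.add h'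
  | smul hf _ h => exact h.smul hf
  | congr _ e h => exact h.congr e

/-- Since `Q` is closed under ∂, Leibniz keeps the derivative of a combination inside the span. This
makes the span a 𝒟-module against which generators can be tested. -/
lemma D {w : ℂ} (hQ : ∀ σ, Q σ → C.ExtendsAt σ w) (hD : ∀ σ, Q σ → Q (C.D σ))
    (h : C.SpanAt Q w s) : C.SpanAt Q w (C.D s) := by
  induction h with
  | of h => exact of (hD _ h)
  | zero => exact zero.congr ((C.near_notMem w).mono fun x hx => (D_zero hx).symm)
  | add h1 h2 h h' =>
    refine (h.add h').congr ?_
    filter_upwards [(h1.extendsAt hQ).holSecC_near, (h2.extendsAt hQ).holSecC_near,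
      C.near_notMem w] with x hx hx' hxP
    exact (D_add' hxP hx hx').symm
  | smul hf h1 h =>
    refine ((h1.smul hf.derivFun_coe).add (h.smul hf)).congr ?_
    filter_upwards [(h1.extendsAt hQ).holSecC_near, C.near_le w hf.eventually,
      C.near_notMem w] with x hx hx' hxP
    exact (C.D_smul _ _ x hxP hx' hx).symm
  | congr _ e h => exact h.congr (D_congr_near e)

/-- At a nonsingular point `C.near w` is the full neighbourhood filter, so equality of germs
includes equality of the values at `w`. -/
lemma apply_mem {w : ℂ} (hw : w ∉ C.P) (h : C.SpanAt Q w s) :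
    s w ∈ Submodule.span ℂ {v | ∃ σ, Q σ ∧ σ w = v} := by
  induction h with
  | of h => exact Submodule.subset_span ⟨_, h, rfl⟩
  | zero => exact zero_mem _
  | add _ _ h h' => exact add_mem h h'
  | smul _ _ h => exact Submodule.smul_mem _ _ h
  | congr _ e h =>
    rw [C.near_coe hw] at e
    rwa [← e.self_of_nhds]

end SpanAt

/-- The meromorphic sections which on `S` are holomorphic combinations of the sections in `Q`. -/
def spanSystem (Q : (∀ x : ℂ, E.Fib x) → Prop) (S : Set (OnePoint ℂ))
    (hS : OnePoint.infty ∉ S) (hQ : ∀ z ∈ S, ∀ σ, Q σ → C.ExtendsAt σ z)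
    (hD : ∀ σ, Q σ → Q (C.D σ)) : C.GermSystem where
  mem z s := C.MeroAt s z ∧ (z ∈ S → C.SpanAt Q z s)
  congr h e := ⟨h.1.congr e, fun hz => (h.2 hz).congr e⟩
  zero z := ⟨(ExtendsAt.zero z).meroAt, fun _ => SpanAt.zero⟩
  add h h' := ⟨h.1.add h'.1, fun hz => (h.2 hz).add (h'.2 hz)⟩
  smul hf h := ⟨h.1.smul hf, fun hz => (h.2 hz).smul hf⟩
  mero h := h.1
  del h := ⟨h.1.D_coe, fun hz => (h.2 hz).D (hQ _ hz) hD⟩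
  del' h := ⟨h.1.D_infty, fun hz => absurd hz hS⟩

namespace DSub

/-- At infinity ∂_x = -x⁻² · (-x² ∂_x), and x⁻² is holomorphic there. -/
lemma germ_D_all {N : C.DSub} {z : OnePoint ℂ} {s : ∀ x : ℂ, E.Fib x} (h : N.Germ z s) :
    N.Germ z (C.D s) := by
  induction z using OnePoint.rec with
  | infty =>
    refine ((germ_D_infty h).smul ((HolAt.const (-1) _).mul (holAt_invFun.pow 2))).congr ?_
    filter_upwards [near_infty_le (eventually_ne_cocompact 0)] with x hx
    change (-1 * (x⁻¹) ^ 2) • (-(x ^ 2)) • C.D s x = C.D s x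
    rw [smul_smul]
    convert one_smul ℂ _
    field_simp
  | coe w => exact germ_D h

/-- Finitely generated submodules of full rank at one point have full rank on a connected
neighbourhood: if `K` has members whose values form a basis of the fibre at a point of a punctured
disc around `z` on which they are holomorphic, `K` contains `E` at `z` up to a power of the local
equation. -/
lemma exists_germ_of_linearIndependent {K : C.DSub} {z : OnePoint ℂ} {i : E.ι} (hi : z ∈ E.dom i)
    {σ : Fin r → ∀ x : ℂ, E.Fib x} (hσ : ∀ j, K.Germ z (σ j)) {ε : ℝ} (hε : 0 < ε)
    (hdom : ∀ u ∈ Metric.ball (base z) ε, u ≠ base z → (affine z u : OnePoint ℂ) ∈ E.dom i)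
    (hhol : ∀ u ∈ Metric.ball (base z) ε, u ≠ base z → ∀ j, E.HolSecC (σ j) (affine z u))
    {u₀ : ℂ} (hu₀ : u₀ ∈ Metric.ball (base z) ε) (hne : u₀ ≠ base z)
    (hli : LinearIndependent ℂ fun j => σ j (affine z u₀)) :
    ∃ n : ℕ, ∀ s, C.ExtendsAt s z → K.Germ z (fun x => unif z x ^ n • s x) := by
  let m : ℂ → Matrix (Fin r) (Fin r) ℂ := fun u =>
    (E.frame i (affine z u)).toMatrix fun j => σ j (affine z u)
  have hm : ∀ k j, MeromorphicAt (fun u => m u k j) (base z) := fun k j =>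
    (meroAt_of_germ (hσ j)).meromorphicAt hi k
  have hm' : ∀ u ∈ Metric.ball (base z) ε, u ≠ base z → ∀ k j, AnalyticAt ℂ (fun u => m u k j) u :=
    fun u hu hub k j => AnalyticAt.fun_comp (f := affine z)
      (g := fun x : ℂ => (E.frame i x).repr (σ j x) k) (hhol u hu hub j i (hdom u hu hub) k)
      (analyticAt_affine hub)
  have hdet : MeromorphicOn (fun u => (m u).det) (Metric.ball (base z) ε) := fun u hu =>
    meromorphicAt_det fun k j => by
      by_cases hub : u = base z
      · subst hub; exact hm k j
      · exact (hm' u hu hub k j).meromorphicAt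
  have h0 : (m u₀).det ≠ 0 := by
    have : Module.Finite ℂ (E.Fib (affine z u₀)) := Module.Finite.of_basis (E.frame i _)
    have := ((E.frame i (affine z u₀)).is_basis_iff_det (v := fun j => σ j (affine z u₀))).1
      ⟨hli, hli.span_eq_top_of_card_eq_finrank' (by
        rw [Module.finrank_eq_card_basis (E.frame i (affine z u₀))])⟩
    rw [Module.Basis.det_apply] at this
    exact this.ne_zero
  -- The determinant is continuous and nonzero at `u₀`, so it does not vanish identically there;
  -- connectedness of the disc carries this to the centre.
  have h1 : meromorphicOrderAt (fun u => (m u).det) u₀ ≠ ⊤ := by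
    rw [meromorphicOrderAt_ne_top_iff_eventually_ne_zero (hdet u₀ hu₀)]
    have hc : ContinuousAt (fun u => (m u).det) u₀ := by
      simp only [Matrix.det_apply']
      exact tendsto_finsetSum _ fun τ _ => tendsto_const_nhds.mul
        (tendsto_finsetProd _ fun a _ => (hm' u₀ hu₀ hne _ _).continuousAt)
    exact nhdsWithin_le_nhds (hc.eventually_ne h0)
  have h2 := hdet.meromorphicOrderAt_ne_top_of_isPreconnected
    (convex_ball (base z) ε).isPreconnected hu₀ (Metric.mem_ball_self hε) h1
  rw [meromorphicOrderAt_ne_top_iff_eventually_ne_zero (hdet _ (Metric.mem_ball_self hε))] at h2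
  -- Finite pole order of the entries of the inverse matrix; `M` below is a common bound.
  have h3 : ∀ j k, ∃ n : ℕ, AnalyticAt ℂ (fun u => (u - base z) ^ n • (m u)⁻¹ j k) (base z) :=
    fun j k => meromorphicAt_matrix_inv hm j k
  choose n hn using h3
  let M := Finset.univ.sup fun q : Fin r × Fin r => n q.1 q.2
  have h4 : ∀ j k, AnalyticAt ℂ (fun u => (u - base z) ^ M * (m u)⁻¹ j k) (base z) := by
    intro j k
    have hle : n j k ≤ M := Finset.le_sup (f := fun q : Fin r × Fin r => n q.1 q.2)
      (Finset.mem_univ (j, k))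
    refine (((analyticAt_id.fun_sub (analyticAt_const (v := base z))).fun_pow (M - n j k)).fun_mul
      (hn j k)).congr (Eventually.of_forall fun u => ?_)
    change (u - base z) ^ (M - n j k) * ((u - base z) ^ n j k * _) = _
    rw [← mul_assoc, ← pow_add, Nat.sub_add_cancel hle]
  have h5 : ∀ k, K.Germ z (fun x => unif z x ^ M • E.frame i x k) := by
    intro k
    have h6 : K.Germ z (fun x => ∑ j, ((coord z x - base z) ^ M * (m (coord z x))⁻¹ j k) • σ j x) :=
      OSub.Germ.sum _ fun j _ => (hσ j).smul (HolAt.of_coord (h4 j k))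
    -- The matrix identity is available only off the centre. If `z` is nonsingular, equality at `z`
    -- itself must be recovered by continuity.
    refine h6.congr (near_eq_of_punctured (meroAt_of_germ h6)
      ((extendsAt_frame (HolBundle.isFrameAt_frame hi) k).unif_pow_smul M).meroAt ?_)
    filter_upwards [h2, self_mem_nhdsWithin] with u hu hub
    have h7 : coord z (affine z u) = u := by rw [← param_eq_affine hub, coord_param]
    have h8 : unif z (affine z u) = u - base z := by rw [← unifFun_coe, unifFun, h7]
    rw [h7, h8]
    simp only [mul_smul, ← Finset.smul_sum]
    congr 1
    have h9 : m u * (m u)⁻¹ = 1 := Matrix.mul_nonsing_inv _ (isUnit_iff_ne_zero.2 hu)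
    refine (E.frame i (affine z u)).repr.injective (Finsupp.ext fun l => ?_)
    have h10 := congrFun (congrFun h9 l) k
    rw [Matrix.mul_apply] at h10
    simp only [map_sum, map_smul, Finsupp.finsetSum_apply, Finsupp.smul_apply, smul_eq_mul,
      Module.Basis.repr_self]
    rw [Finsupp.single_apply, show (if k = l then (1 : ℂ) else 0) = (1 : Matrix _ _ ℂ) l k by
      simp only [Matrix.one_apply, eq_comm], ← h10]
    exact Finset.sum_congr rfl fun j _ => mul_comm _ _
  refine ⟨M, fun s hs => ?_⟩
  obtain ⟨c, hc, hs⟩ := hs.exists_coeff (HolBundle.isFrameAt_frame hi)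
  refine (OSub.Germ.sum Finset.univ fun k _ => (h5 k).smul (hc k)).congr ?_
  filter_upwards [hs] with x hx
  rw [hx, Finset.smul_sum]
  exact Finset.sum_congr rfl fun k _ => smul_comm _ _ _

/-- A coherent submodule that contains `E` in a punctured neighbourhood of `z` contains `E` at `z`
up to a power of the local equation. -/
lemma IsCoherent.exists_germ {K : C.DSub} (hK : K.IsCoherent) (z : OnePoint ℂ)
    (h : ∀ y ≠ z, ∀ s, C.ExtendsAt s y → K.Germ y s) :
    ∃ n : ℕ, ∀ s, C.ExtendsAt s z → K.Germ z (fun x => unif z x ^ n • s x) := by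
  obtain ⟨i, hi⟩ := E.cover z
  obtain ⟨W₀, hz₀, T, hT, hgen⟩ := hK z
  obtain ⟨W₂, hz₂, hW₂⟩ := C.exists_opens_isSing z
  -- A punctured neighbourhood without singular points, so that all derivatives of the generators
  -- are holomorphic on it.
  let V : Opens (OnePoint ℂ) := (W₀ ⊓ E.dom i ⊓ W₂) ⊓ ⟨{z}ᶜ, isOpen_compl_singleton⟩
  have hns : ∀ y ∈ V, ¬ C.IsSing y := fun y hy hs => hy.2 (hW₂ y hy.1.2 hs)
  let Q := C.IsDeriv fun s => ∃ τ ∈ T, C.extend τ = s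
  have hQK : ∀ σ, Q σ → ∀ y ∈ W₀, K.Germ y σ := by
    intro σ hσ y hy
    induction hσ with
    | base h => obtain ⟨τ, hτ, rfl⟩ := h; exact OSub.germ_of_mem (hT τ hτ) hy
    | D _ ih => exact germ_D_all ih
  have hQ : ∀ y ∈ (V : Set (OnePoint ℂ)), ∀ σ, Q σ → C.ExtendsAt σ y := fun y hy σ hσ =>
    (meroAt_of_germ (hQK σ hσ y hy.1.1.1)).extendsAt (hns y hy)
  -- The test module: on `V`, holomorphic combinations of iterated derivatives of the generators;
  -- elsewhere, no condition beyond meromorphy. It contains the generators, hence by coherence all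
  -- of `K` over `W₀`.
  let G := spanSystem Q (V : Set (OnePoint ℂ)) (fun h => hns _ h (Or.inl rfl)) hQ
    fun σ hσ => IsDeriv.D hσ
  have hTG : ∀ τ ∈ T, τ ∈ G.toDSub.carrier W₀ := fun τ hτ y hy =>
    ⟨meroAt_of_germ (OSub.germ_of_mem (hT τ hτ) hy), fun _ => SpanAt.of (IsDeriv.base ⟨τ, hτ, rfl⟩)⟩
  -- On `V` the frame belongs to `K`, hence to the test module; evaluating at `x` writes the frame
  -- vectors as combinations of values of derivatives of the generators.
  have hspan : ∀ x : ℂ, (x : OnePoint ℂ) ∈ V →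
      Submodule.span ℂ {v | ∃ σ, Q σ ∧ σ x = v} = ⊤ := by
    intro x hx
    have hxP : x ∉ C.P := not_isSing_coe.1 (hns _ hx)
    rw [eq_top_iff, ← (E.frame i x).span_eq, Submodule.span_le]
    rintro _ ⟨k, rfl⟩
    have h1 : C.ofFun V (fun x => E.frame i x k) ∈ K.carrier V :=
      OSub.mem_of_germ fun y hy => (h y hy.2 _
        (extendsAt_frame (HolBundle.isFrameAt_frame hy.1.1.2) k)).congr
          ((extend_ofFun_near _ hy).mono fun _ hx => hx.symm)
    have h2 := (hgen G.toDSub hTG V (inf_le_left.trans (inf_le_left.trans inf_le_left)) h1 _ hx).2 hx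
    have h3 := h2.apply_mem hxP
    rwa [extend_ofFun _ hx hxP] at h3
  have hev : ∀ᶠ u in 𝓝 (base z), param z u ∈ W₀ ⊓ E.dom i ⊓ W₂ :=
    (tendsto_param z).eventually ((W₀ ⊓ E.dom i ⊓ W₂).isOpen.mem_nhds ⟨⟨hz₀, hi⟩, hz₂⟩)
  obtain ⟨ε, hε, hball⟩ := Metric.eventually_nhds_iff_ball.1 hev
  have hV : ∀ u ∈ Metric.ball (base z) ε, u ≠ base z → (affine z u : OnePoint ℂ) ∈ V := by
    intro u hu hub
    rw [← param_eq_affine hub]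
    refine ⟨hball u hu, fun h' => hub ?_⟩
    rw [← coord_param z u, show param z u = z from h', coord_self]
  obtain ⟨u₀, hu₀, hne⟩ : ∃ u₀ ∈ Metric.ball (base z) ε, u₀ ≠ base z :=
    (Eventually.and (f := 𝓝[≠] base z) (nhdsWithin_le_nhds (Metric.ball_mem_nhds (base z) hε))
      self_mem_nhdsWithin).exists
  have hx := hspan _ (hV u₀ hu₀ hne)
  have hr : Module.finrank ℂ (Submodule.span ℂ {v | ∃ σ, Q σ ∧ σ (affine z u₀) = v}) = r := by
    rw [hx, finrank_top, Module.finrank_eq_card_basis (E.frame i (affine z u₀)), Fintype.card_fin]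
  obtain ⟨f, hf, hli⟩ : ∃ f : Fin r → E.Fib (affine z u₀),
      (∀ j, f j ∈ {v | ∃ σ, Q σ ∧ σ (affine z u₀) = v}) ∧ LinearIndependent ℂ f := by
    have : Module.Finite ℂ (E.Fib (affine z u₀)) := Module.Finite.of_basis (E.frame i _)
    obtain ⟨f, hf, -, hli⟩ := Submodule.exists_fun_fin_finrank_span_eq ℂ
      {v | ∃ σ, Q σ ∧ σ (affine z u₀) = v}
    exact ⟨f ∘ Fin.cast hr.symm, fun j => hf _, hli.comp _ (Fin.cast_injective _)⟩
  choose σ hσ hσf using hf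
  refine exists_germ_of_linearIndependent hi (fun j => hQK _ (hσ j) z hz₀) hε
    (fun u hu hub => (hV u hu hub).1.1.2) (fun u hu hub j => ?_) hu₀ hne ?_
  · exact (hQ _ (hV u hu hub) _ (hσ j)).holSecC (not_isSing_coe.1 (hns _ (hV u hu hub)))
  · simpa only [hσf] using hli

lemma germ_of_carrier_eq {N K : C.DSub} {z y : OnePoint ℂ}
    (h : ∀ U, z ∉ U → K.carrier U = N.carrier U) (hy : y ≠ z) {s : ∀ x : ℂ, E.Fib x}
    (hs : N.Germ y s) : K.Germ y s := by
  obtain ⟨W, hW, hyW, hs⟩ := hs.exists_ofFun_le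
    (U := ⟨{z}ᶜ, isOpen_compl_singleton⟩) hy
  rw [← h W fun h => hW h rfl] at hs
  exact OSub.germ_of_ofFun hyW hs

/-- Generators restrict to generators on smaller open sets. -/
lemma le_of_generators {N : C.DSub} {W W' : Opens (OnePoint ℂ)} {T : Finset (C.Sec W)}
    (hT : ∀ s ∈ T, s ∈ N.carrier W)
    (hgen : ∀ N' : C.DSub, (∀ s ∈ T, s ∈ N'.carrier W) → ∀ V ≤ W, N.carrier V ≤ N'.carrier V)
    (hW : W' ≤ W) {N' : C.DSub} (h : ∀ s ∈ T, C.restr hW s ∈ N'.carrier W')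
    {V : Opens (OnePoint ℂ)} (hV : V ≤ W') : N.carrier V ≤ N'.carrier V := by
  intro s hs
  -- Imposing `N'` only on `W'` gives a module that contains the original generators on all of `W`,
  -- so the generation property of `W` can be applied to it.
  let G := (GermSystem.ofDSub N').on (W' : Set (OnePoint ℂ))
  have h1 : ∀ τ ∈ T, τ ∈ G.toDSub.carrier W := fun τ hτ y hy =>
    ⟨meroAt_of_germ (OSub.germ_of_mem (hT τ hτ) hy), fun hy' =>
      (OSub.germ_of_mem (h τ hτ) hy').congr (extend_restr_near hW τ hy')⟩
  have h2 := hgen _ h1 V (hV.trans hW) hs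
  exact OSub.mem_of_germ fun y hy => (h2 y hy).2 (hV hy)

end DSub

/-! ### Existence and uniqueness of the minimal extension. -/

open DSub in
-- A coherent submodule agreeing with `minExt` off z contains E off z, hence E up to a power of the
-- local equation at z; by `minExt_le` this already forces it to be everything.
lemma minExt_isMinimalExtension (hC : C.ResonanceFree) : C.minExt.IsMinimalExtension where
  coherent := minExt_isCoherent hC
  extension := minExt_isExtension
  no_sub K _ _ z h := K.eq_bot_of_support z h
  no_quot K hK hle z h := by
    have h1 : ∀ y ≠ z, ∀ s, C.ExtendsAt s y → K.Germ y s := fun y hy s hs =>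
      germ_of_carrier_eq h hy (germ_minExt.2 hs.minSystem)
    refine ext_of_le hle (minExt_le hC fun y => ?_)
    by_cases hy : y = z
    · subst hy
      exact hK.exists_germ y h1
    · exact ⟨0, fun s hs => by simpa using h1 y hy s hs⟩

open DSub in
-- If `N` were larger than `minExt` at some point z, the submodule with germs of `N` off z and of
-- `minExt` at z would give a nonzero quotient of `N` supported at z.
lemma DSub.IsMinimalExtension.eq_minExt (hC : C.ResonanceFree) {N : C.DSub}
    (hN : N.IsMinimalExtension) : N = C.minExt := by
  classical
  have hle : C.minExt.Le N.toOSub := minExt_le hC hN.extension.exists_germ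
  have hreg : ∀ {y s}, ¬ C.IsSing y → N.Germ y s → C.minSystem.mem y s := fun hy hs =>
    ((meroAt_of_germ hs).extendsAt hy).minSystem
  refine ext_of_le (OSub.le_of_germ fun z s hs => ?_) hle
  -- Germs of `N` everywhere, required at z to lie in `minExt`.
  let K : C.DSub := ((GermSystem.ofDSub N).inf (C.minSystem.on {z})).toDSub
  have hKN : K.Le N.toOSub := fun U s hs => OSub.mem_of_germ fun y hy => (hs y hy).1
  have hoff : ∀ U, z ∉ U → K.carrier U = N.carrier U := fun U hU => by
    refine le_antisymm (hKN U) fun s hs y hy => ?_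
    have h1 := OSub.germ_of_mem hs hy
    exact ⟨h1, meroAt_of_germ h1, fun hyz => absurd (hyz ▸ hy) hU⟩
  have hcoh : K.IsCoherent := by
    intro y
    by_cases hy : y = z
    · subst hy
      obtain ⟨i, hi⟩ := E.cover y
      obtain ⟨W₂, hz₂, hW₂⟩ := C.exists_opens_isSing y
      refine ⟨E.dom i ⊓ W₂, ⟨hi, hz₂⟩,
        Finset.univ.image fun k => C.ofFun _ fun x => E.frame i x k, ?_, ?_⟩
      · intro s hs
        obtain ⟨k, -, rfl⟩ := Finset.mem_image.1 hs
        intro x hx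
        have h1 := ofFun_frame_mem (N := C.minExt) (fun z s h => germ_minExt.2 h.minSystem)
          (inf_le_left : E.dom i ⊓ W₂ ≤ E.dom i) k
        exact ⟨OSub.germ_of_mem (hle _ h1) hx, C.minSystem.mero (h1 x hx), fun _ => h1 x hx⟩
      · intro N' h V hV
        -- On this neighbourhood `K` lies in `minExt`: at z by construction, elsewhere because all
        -- points are nonsingular and germs of `N` are holomorphic there. So the frame generates
        -- `K`.
        refine le_trans (b := C.minExt.carrier V) (fun s hs x hx => ?_) (minExt_le_of_frame hC (N := N')
          (inf_le_left : E.dom i ⊓ W₂ ≤ E.dom i)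
          (fun k => h _ (Finset.mem_image_of_mem _ (Finset.mem_univ k))) hV)
        by_cases hxy : x = y
        · exact (hs x hx).2.2 hxy
        · exact hreg (fun h => hxy (hW₂ x (hV hx).2 h)) (hs x hx).1
    · obtain ⟨W, hyW, T, hT, hgen⟩ := hN.coherent y
      let W' : Opens (OnePoint ℂ) := W ⊓ ⟨{z}ᶜ, isOpen_compl_singleton⟩
      have hzW : z ∉ W' := fun h => h.2 rfl
      refine ⟨W', ⟨hyW, hy⟩, T.image (C.restr (inf_le_left : W' ≤ W)), ?_, ?_⟩
      · intro s hs
        obtain ⟨τ, hτ, rfl⟩ := Finset.mem_image.1 hs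
        rw [hoff W' hzW]
        exact N.res_mem W W' inf_le_left τ (hT τ hτ)
      · intro N' h V hV
        rw [hoff V fun hz => hzW (hV hz)]
        exact le_of_generators hT hgen inf_le_left
          (fun s hs => h _ (Finset.mem_image_of_mem _ hs)) hV
  have hKN' := hN.no_quot K hcoh hKN z hoff
  obtain ⟨W, hz, h⟩ := hs.exists_ofFun
  rw [← hKN'] at h
  exact germ_minExt.2 (C.minSystem.congr ((h z hz).2.2 rfl) (extend_ofFun_near s hz))

end SingConn

namespace SingConn

variable {r : ℕ} {E : HolBundle r} {C : SingConn E}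

/-! ### Leading coefficients -/

variable (C) in
/-- `s` has at `z` a pole of order at most `n`, with leading coefficients `v` in the frame `e`. -/
def Lead (e : Fin r → ∀ x, E.Fib x) (z : OnePoint ℂ) (n : ℕ) (s : ∀ x : ℂ, E.Fib x)
    (v : Fin r → ℂ) : Prop :=
  ∃ c : Fin r → OnePoint ℂ → ℂ, (∀ k, HolAt (c k) z) ∧ (∀ k, c k z = v k) ∧
    ∀ᶠ x : ℂ in C.near z, unif z x ^ n • s x = ∑ k, c k x • e k x

namespace Lead

variable {e : Fin r → ∀ x, E.Fib x} {z : OnePoint ℂ} {n : ℕ} {s t : ∀ x : ℂ, E.Fib x}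
  {v w : Fin r → ℂ}

lemma congr (h : C.Lead e z n s v) (e' : ∀ᶠ x in C.near z, s x = t x) : C.Lead e z n t v := by
  obtain ⟨c, hc, hv, h⟩ := h
  exact ⟨c, hc, hv, by filter_upwards [h, e'] with x h1 h2; rw [← h2, h1]⟩

lemma add (h : C.Lead e z n s v) (h' : C.Lead e z n t w) :
    C.Lead e z n (fun x => s x + t x) (v + w) := by
  obtain ⟨c, hc, hv, h⟩ := h
  obtain ⟨c', hc', hv', h'⟩ := h'
  refine ⟨fun k x => c k x + c' k x, fun k => (hc k).add (hc' k), fun k => ?_, ?_⟩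
  · simp only [hv, hv', Pi.add_apply]
  · filter_upwards [h, h'] with x h1 h2
    simp only [smul_add, h1, h2, add_smul, Finset.sum_add_distrib]

/-- A pole of order at most n, viewed as one of order at most n+1, has vanishing leading
coefficients. Pole orders are compared below by combining this with `Lead.unique`. -/
lemma lift (h : C.Lead e z n s v) : C.Lead e z (n + 1) s 0 := by
  obtain ⟨c, hc, hv, h⟩ := h
  refine ⟨fun k x => unifFun z x * c k x, fun k => (holAt_unifFun z).mul (hc k), fun k => ?_, ?_⟩
  · simp [unifFun_self]
  · filter_upwards [h] with x hx
    rw [pow_succ', mul_smul, hx, Finset.smul_sum]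
    exact Finset.sum_congr rfl fun k _ => by rw [smul_smul, unifFun_coe]

lemma of_extendsAt (he : E.IsFrameAt e z) (h : C.ExtendsAt (fun x => unif z x ^ n • s x) z) :
    ∃ v, C.Lead e z n s v := by
  obtain ⟨c, hc, h⟩ := h.exists_coeff he
  exact ⟨_, c, hc, fun k => rfl, h⟩

/-- The values at `z` of the two holomorphic extensions agree by continuity, and the frame is
independent at `z`. -/
lemma unique (he : E.IsFrameAt e z) (h : C.Lead e z n s v) (h' : C.Lead e z n s w) : v = w := by
  obtain ⟨c, hc, hv, h⟩ := h
  obtain ⟨c', hc', hv', h'⟩ := h'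
  obtain ⟨i, hi⟩ := E.cover z
  have h1 : ∀ {d : Fin r → OnePoint ℂ → ℂ}, (∀ k, HolAt (d k) z) → ∀ l,
      HolAt (fun x => (E.frame i x).repr (∑ k, d k x • e k x) l) z := fun hd l =>
    HolBundle.HolSec.sum _ (fun k _ => HolBundle.HolSec.smul (hd k) (he.hol k)) i hi l
  have h2 : ∑ k, c k z • e k z = ∑ k, c' k z • e k z := by
    refine (E.frame i z).repr.injective (Finsupp.ext fun l => eq_of_near (C := C) (h1 hc l)
      (h1 hc' l) ?_)
    filter_upwards [h, h'] with x hx hx'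
    rw [← hx, ← hx']
  have h3 : ∑ k, (c k z - c' k z) • e k z = 0 := by
    simp only [sub_smul, Finset.sum_sub_distrib, h2, sub_self]
  funext k
  have h4 := Fintype.linearIndependent_iff.1 he.indep _ h3 k
  rw [← hv, ← hv']
  exact sub_eq_zero.1 h4

/-- Coefficients vanishing at `z` are divisible by the local equation, which can be cancelled
because it has no zeros among the nonsingular points near a singular `z`. -/
lemma drop (hz : C.IsSing z) (he : E.IsFrameAt e z) (h : C.Lead e z (n + 1) s 0) :
    C.ExtendsAt (fun x => unif z x ^ n • s x) z := by
  obtain ⟨c, hc, hv, h⟩ := h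
  have h1 := fun k => (hc k).exists_div (hv k)
  choose g hg h1 using h1
  refine extendsAt_of_coeff he hg ?_
  filter_upwards [h, near_of_nhds (C := C) (eventually_all.2 h1), unif_ne_zero z hz] with x hx hx' hu
  have h2 : unif z x • unif z x ^ n • s x = unif z x • ∑ k, g k x • e k x := by
    rw [smul_smul, ← pow_succ', hx, Finset.smul_sum]
    exact Finset.sum_congr rfl fun k _ => by rw [hx' k, smul_smul, unifFun_coe]
  exact smul_right_injective _ hu h2

end Lead

/-- Computation of `∇` of a combination of a frame. -/
lemma D_combination {z : OnePoint ℂ} {e : Fin r → ∀ x, E.Fib x} (he : E.IsFrameAt e z)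
    {t : ∀ x : ℂ, E.Fib x} {c : Fin r → OnePoint ℂ → ℂ} (hc : ∀ k, HolAt (c k) z)
    (h : ∀ᶠ x : ℂ in C.near z, t x = ∑ k, c k x • e k x) :
    ∀ᶠ x in C.near z, C.D t x =
      ∑ k, (derivFun (c k) x • e k x + c k x • C.D (fun y => e k y) x) := by
  have h2 : ∀ᶠ x in C.near z, ∀ k, AnalyticAt ℂ (fun u : ℂ => c k u) x :=
    eventually_all.2 fun k => C.near_le z (hc k).eventually
  have h3 : ∀ᶠ x in C.near z, ∀ k, E.HolSecC (fun y => e k y) x :=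
    eventually_all.2 fun k => holSecC_near (he.hol k)
  filter_upwards [C.near_eventually h, h2, h3, C.near_notMem z] with x hx hc' he' hxP
  rw [C.D_congr _ (fun y => ∑ k, c k y • e k y) x hxP hx,
    (D_sum (s := fun k y => c k y • e k y) Finset.univ hxP fun k _ =>
      HolBundle.HolSecC.smul (hc' k) (he' k)).1]
  refine Finset.sum_congr rfl fun k _ => ?_
  rw [C.D_smul (fun y => c k y) (fun y => e k y) x hxP (hc' k) (he' k)]
  rfl

/-- The term μ_k comes from the residue of ∇, the term -n from differentiating (x-w)^(-n); the
remaining contributions carry a further factor x - w. -/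
lemma Lead.D {w : ℂ} {L : C.LogFrame w} {n : ℕ} {s : ∀ x : ℂ, E.Fib x} {v : Fin r → ℂ}
    (hs : ∀ᶠ x in C.near w, E.HolSecC s x) (h : C.Lead L.e w n s v) :
    C.Lead L.e w (n + 1) (C.D s) (fun k => (L.μ k - n) * v k) := by
  obtain ⟨c, hc, hv, h⟩ := h
  have hu := holAt_subFun w w
  refine ⟨fun k x => subFun w x * derivFun (c k) x + (L.μ k - n) * c k x +
    subFun w x * ∑ l, L.H k l x * c l x, fun k => ?_, fun k => ?_, ?_⟩
  · exact ((hu.mul (hc k).derivFun_coe).add ((HolAt.const _ _).mul (hc k))).add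
      (hu.mul (HolAt.sum _ fun l _ => (L.holAt_H k l).mul (hc l)))
  · have : subFun w (w : OnePoint ℂ) = 0 := sub_self w
    simp only [this, zero_mul, zero_add, add_zero, hv]
  · filter_upwards [h, D_combination L.isFrame hc h, eventually_all.2 L.D_e, hs, C.near_notMem w]
      with x hx hD he hsx hxP
    have hd : HasDerivAt (fun y => unif (w : OnePoint ℂ) y ^ n) (n * (x - w) ^ (n - 1) * 1) x :=
      ((hasDerivAt_id x).sub_const w).fun_pow n
    rw [C.D_smul (fun y => unif (w : OnePoint ℂ) y ^ n) s x hxP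
      ((analyticAt_id.fun_sub analyticAt_const).fun_pow n) hsx, hd.deriv] at hD
    change (x - w) ^ n • s x = _ at hx
    change (x - w) ^ (n + 1) • C.D s x = _
    have h1 : (x - w) ^ (n + 1) • C.D s x = (x - w) • ((n * (x - w) ^ (n - 1) * 1 : ℂ) • s x +
        (x - w) ^ n • C.D s x) - (n : ℂ) • (x - w) ^ n • s x := by
      rcases n with _ | n
      · simp
      · simp only [Nat.add_sub_cancel]; module
    have h2 : (x - w) • ∑ k, (derivFun (c k) x • L.e k x + c k x • C.D (fun y => L.e k y) x) =
        ∑ k, (((x - w) * derivFun (c k) x + L.μ k * c k x) • L.e k x) +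
          ∑ k, ∑ l, ((x - w) * (L.H l k x * c k x)) • L.e l x := by
      rw [Finset.smul_sum, ← Finset.sum_add_distrib]
      refine Finset.sum_congr rfl fun k _ => ?_
      rw [smul_add, smul_comm (x - w) (c k x), he k, smul_add, Finset.smul_sum, Finset.smul_sum]
      have : ∀ l, c k x • (x - w) • L.H l k x • L.e l x =
          ((x - w) * (L.H l k x * c k x)) • L.e l x := fun l => by module
      simp only [this]
      module
    rw [h1, hx]
    refine (congrArg (fun q => (x - w) • q - (n : ℂ) • ∑ k, c k x • L.e k x) hD).trans ?_
    rw [h2, Finset.sum_comm, Finset.smul_sum, ← Finset.sum_add_distrib, ← Finset.sum_sub_distrib]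
    refine Finset.sum_congr rfl fun k _ => ?_
    rw [← Finset.sum_smul, ← Finset.mul_sum]
    change _ = ((x - w) * _ + _ + (x - w) * _) • _
    module

/-- Only diag(α) - ξ survives at infinity: the terms with ν, with H and with the derivative of x^n
carry a factor 1/x, and derivatives with respect to x of the coefficients vanish at infinity. The
pole order does not rise. -/
lemma Lead.nabla_infty {L : C.IrrFrame} {n : ℕ} {s : ∀ x : ℂ, E.Fib x} {v : Fin r → ℂ} (ξ : ℂ)
    (hs : ∀ᶠ x in C.near OnePoint.infty, E.HolSecC s x) (h : C.Lead L.e OnePoint.infty n s v) :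
    C.Lead L.e OnePoint.infty n (fun x => C.D s x - ξ • s x) (fun k => (C.α k - ξ) * v k) := by
  obtain ⟨c, hc, hv, h⟩ := h
  have hi := holAt_invFun
  refine ⟨fun k x => derivFun (c k) x + (C.α k - ξ) * c k x + invFun x * ((C.ν k + n) * c k x) +
    invFun x ^ 2 * ∑ l, L.H k l x * c l x, fun k => ?_, fun k => ?_, ?_⟩
  · exact (((hc k).derivFun_infty.add ((HolAt.const _ _).mul (hc k))).add
      (hi.mul ((HolAt.const _ _).mul (hc k)))).add
      ((hi.pow 2).mul (HolAt.sum _ fun l _ => (L.holAt_H k l).mul (hc l)))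
  · have h1 : invFun OnePoint.infty = 0 := rfl
    have h2 : derivFun (c k) OnePoint.infty = 0 := rfl
    simp [h1, h2, hv]
  · filter_upwards [h, D_combination L.isFrame hc h, eventually_all.2 L.D_e, hs, C.near_notMem _,
      near_infty_le (eventually_ne_cocompact 0)] with x hx hD he hsx hxP hx0
    have hd : HasDerivAt (fun y => unif OnePoint.infty y ^ n)
        (n * (x⁻¹) ^ (n - 1) * (-(x ^ 2)⁻¹)) x := (hasDerivAt_inv hx0).fun_pow n
    rw [C.D_smul (fun y => unif OnePoint.infty y ^ n) s x hxP
      ((analyticAt_inv hx0).fun_pow n) hsx, hd.deriv] at hD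
    change (x⁻¹) ^ n • s x = _ at hx
    change (x⁻¹) ^ n • (C.D s x - ξ • s x) = _
    have h1 : (x⁻¹) ^ n • (C.D s x - ξ • s x) =
        ((n * (x⁻¹) ^ (n - 1) * (-(x ^ 2)⁻¹) : ℂ) • s x + (x⁻¹) ^ n • C.D s x) +
          (n * x⁻¹ - ξ) • (x⁻¹) ^ n • s x := by
      rcases n with _ | n
      · simp; module
      · simp only [Nat.add_sub_cancel]
        rw [← inv_pow]
        module
    have h2 : ∑ k, (derivFun (c k) x • L.e k x + c k x • C.D (fun y => L.e k y) x) =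
        ∑ k, ((derivFun (c k) x + (C.α k + C.ν k * x⁻¹) * c k x) • L.e k x) +
          ∑ k, ∑ l, ((x⁻¹) ^ 2 * (L.H l k x * c k x)) • L.e l x := by
      rw [← Finset.sum_add_distrib]
      refine Finset.sum_congr rfl fun k _ => ?_
      rw [he k, smul_add, Finset.smul_sum]
      have : ∀ l, c k x • ((x⁻¹) ^ 2 * L.H l k x) • L.e l x =
          ((x⁻¹) ^ 2 * (L.H l k x * c k x)) • L.e l x := fun l => by module
      simp only [this, div_eq_mul_inv]
      module
    rw [h1, hx]
    refine (congrArg (fun q => q + (n * x⁻¹ - ξ) • ∑ k, c k x • L.e k x) hD).trans ?_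
    rw [h2, Finset.sum_comm, Finset.smul_sum, ← Finset.sum_add_distrib, ← Finset.sum_add_distrib]
    refine Finset.sum_congr rfl fun k _ => ?_
    rw [← Finset.sum_smul, ← Finset.mul_sum]
    change _ = (_ + _ + x⁻¹ * _ + x⁻¹ ^ 2 * _) • _
    module

lemma Fil.exists_lead {w : ℂ} (L : C.LogFrame w) {n : ℕ} {s : ∀ x : ℂ, E.Fib x}
    (h : C.Fil w n s) : ∃ v, C.Lead L.e w n s v := by
  induction n generalizing s with
  | zero => exact Lead.of_extendsAt L.isFrame (by simpa [Fil] using h)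
  | succ n ih =>
    obtain ⟨a, b, ha, hb, h⟩ := h
    obtain ⟨v, hv⟩ := ih ha
    obtain ⟨v', hv'⟩ := ih hb
    exact ⟨_, (hv.lift.add (hv'.D hb.holSecC_near)).congr (h.mono fun x hx => hx.symm)⟩

/-- A germ in the `(n+1)`-st step of the filtration with vanishing leading coefficients is in the
`n`-th step. -/
lemma Fil.drop {p : ℂ} (hp : p ∈ C.P) (L : C.LogFrame p) {n : ℕ} {s : ∀ x : ℂ, E.Fib x}
    (h : C.Fil p (n + 1) s) (hl : C.Lead L.e p (n + 1) s 0) : C.Fil p n s := by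
  induction n generalizing s with
  | zero => simpa [Fil] using Lead.drop (Or.inr ⟨p, hp, rfl⟩) L.isFrame hl
  | succ n ih =>
    obtain ⟨a, b, ha, hb, h⟩ := h
    obtain ⟨v, hv⟩ := ha.exists_lead L
    obtain ⟨v', hv'⟩ := hb.exists_lead L
    have h1 := (hv.lift.add (hv'.D hb.holSecC_near)).congr (h.mono fun x hx => hx.symm)
    -- The part `a` has pole order at most n+1 and does not contribute at order n+2, so (μ_k -
    -- (n+1)) v'_k = 0. The factor is nonzero, so `b` drops a step by induction. At order one this
    -- fails when μ_k = 0, which is why the base case uses divisibility instead.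
    have h2 : v' = 0 := funext fun k => by
      have h3 := congrFun (h1.unique L.isFrame hl) k
      simp only [Pi.add_apply, Pi.zero_apply, zero_add] at h3
      refine (mul_eq_zero.1 h3).resolve_left fun h4 => L.μ_ne k (n + 1 : ℤ) (by omega) ?_
      push_cast at h4 ⊢
      linear_combination h4
    rw [h2] at hv'
    exact (ha.add (ih hb hv').D).congr (h.mono fun x hx => hx.symm)

/-! ### The sheaf `F` and the filtration -/

/-- Here s = ∇s - ∇_1 s, a difference of two elements of F. -/
lemma fCond_of_extendsAt {z : OnePoint ℂ} {s : ∀ x : ℂ, E.Fib x} (h : C.ExtendsAt s z) :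
    C.FCond s z := by
  refine ((h.fCond_nabla 0).add ((h.fCond_nabla 1).smul (HolAt.const (-1) z))).congr
    (Eventually.of_forall fun x => ?_)
  module

lemma fCond_of_fil {w : ℂ} {s : ∀ x : ℂ, E.Fib x} (h : C.Fil w 1 s) : C.FCond s w := by
  obtain ⟨a, b, ha, hb, h⟩ := h
  refine ((fCond_of_extendsAt ha).add (ExtendsAt.fCond_nabla 0 hb)).congr ?_
  filter_upwards [h] with x hx
  rw [hx, zero_smul, sub_zero]

/-- At infinity dx has a double pole, so s dx has at most a double pole exactly when s is
holomorphic. -/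
lemma FCond.extendsAt {z : OnePoint ℂ} {s : ∀ x : ℂ, E.Fib x} (h : C.FCond s z)
    (hz : ∀ p ∈ C.P, z ≠ (p : OnePoint ℂ)) : C.ExtendsAt s z := by
  by_cases hzi : z = OnePoint.infty
  · subst hzi
    refine ((h.inf rfl).smul (HolAt.const (-1) _)).congr ?_
    filter_upwards [near_infty_le (eventually_ne_cocompact 0)] with x hx
    rw [smul_smul, smul_smul]
    convert one_smul ℂ _
    field_simp
  · exact h.reg fun hs => hs.elim hzi fun ⟨p, hp, hzp⟩ => hz p hp hzp

/-- The residue of s is that of some ∇τ with τ in E, so s - ∇τ has zero residue and is holomorphic.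
Thus s lies in E + ∂E, which is why the residue condition in F is the right one. -/
lemma FCond.fil {w : ℂ} {s : ∀ x : ℂ, E.Fib x} (h : C.FCond s w) : C.Fil w 1 s := by
  by_cases hw : w ∈ C.P
  · obtain ⟨v, ⟨σ, hσ, hσv⟩, τ, hτ, σ', hσ', hσv'⟩ := h.fin w hw rfl
    refine ⟨fun x => s x - C.D (fun y => τ y) x, fun y => τ y, ?_, ⟨τ, hτ, Eventually.of_forall
      fun _ => rfl⟩, Eventually.of_forall fun x => (sub_add_cancel _ _).symm⟩
    obtain ⟨i, hi⟩ := E.cover w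
    have h1 := (hσ.add (hσ'.smul (HolAt.const (-1) _)))
    have h2 := Lead.drop (n := 0) (s := fun x => s x - C.D (fun y => τ y) x)
      (Or.inr ⟨w, hw, rfl⟩) (HolBundle.isFrameAt_frame hi)
      ⟨fun k x => (E.frame i x).repr (σ x + (-1 : ℂ) • σ' x) k, fun k => h1.1 i hi k, fun k => by
        simp [hσv, hσv'], by
          filter_upwards [h1.2] with x hx
          rw [(E.frame i x).sum_repr, ← hx]
          change (x - w) ^ (0 + 1) • _ = _
          module⟩
    simpa [Fil] using h2
  · exact Fil.succ (h.reg (not_isSing_coe.2 hw))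

lemma FCond.minSystem {z : OnePoint ℂ} {s : ∀ x : ℂ, E.Fib x} (h : C.FCond s z) :
    C.minSystem.mem z s := by
  induction z using OnePoint.rec with
  | infty => exact (h.extendsAt fun p _ => (OnePoint.coe_ne_infty p).symm).minSystem
  | coe w => exact minSystem_coe.2 ⟨1, h.fil⟩

variable (C) in
lemma sheafE_le_minExt : C.sheafE.Le C.minExt.toOSub := fun _ _ hs z hz => (hs z hz).minSystem

variable (C) in
lemma sheafF_le_minExt : C.sheafF.Le C.minExt.toOSub := fun _ _ hs z hz => (hs z hz).minSystem

/-- A section of the minimal extension whose twisted derivative is in `F` is in `E`. -/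
lemma extendsAt_of_fCond_nabla (hC : C.ResonanceFree) {ξ : ℂ} (hξ : ξ ∉ C.Phat) {z : OnePoint ℂ}
    {s : ∀ x : ℂ, E.Fib x} (hs : C.minSystem.mem z s)
    (h : C.FCond (fun x => C.D s x - ξ • s x) z) : C.ExtendsAt s z := by
  induction z using OnePoint.rec with
  | infty =>
    obtain ⟨L⟩ := C.exists_irrFrame
    obtain ⟨n, -, hn⟩ := minSystem_infty.1 hs
    have hh := (minSystem_infty.1 hs).holSecC_near
    replace h := h.extendsAt fun p _ => (OnePoint.coe_ne_infty p).symm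
    induction n with
    | zero => simpa using hn
    | succ n ih =>
      refine ih ?_
      obtain ⟨v, hv⟩ := Lead.of_extendsAt L.isFrame hn
      -- The image is holomorphic, so its coefficient at order n+1 vanishes; on the other hand it
      -- equals (α_k - ξ) v_k, and α_k ≠ ξ.
      obtain ⟨v', hv'⟩ := Lead.of_extendsAt L.isFrame (h.unif_pow_smul n)
      have h2 : v = 0 := funext fun k => by
        have h1 := congrFun ((hv.nabla_infty ξ hh).unique L.isFrame hv'.lift) k
        exact (mul_eq_zero.1 h1).resolve_left fun h3 => hξ ⟨k, sub_eq_zero.1 h3⟩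
      rw [h2] at hv
      exact hv.drop (Or.inl rfl) L.isFrame
  | coe w =>
    obtain ⟨n, hn⟩ := minSystem_coe.1 hs
    by_cases hw : w ∈ C.P
    · obtain ⟨L⟩ := hC.exists_logFrame w
      replace h := h.fil
      induction n with
      | zero => exact hn
      | succ n ih =>
        refine ih ?_
        obtain ⟨v, hv⟩ := hn.exists_lead L
        -- ∂s has pole order at most n+1, while its coefficient at order n+2 is (μ_k - (n+1)) v_k.
        -- Hence v = 0 and `Fil.drop` lowers the step.
        have h1 : C.Fil w (n + 1) (C.D s) := by
          refine ((h.mono (Nat.le_add_left 1 n)).add (hn.smul (HolAt.const ξ _))).congr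
            (Eventually.of_forall fun x => sub_add_cancel _ _)
        obtain ⟨v', hv'⟩ := h1.exists_lead L
        have h2 : v = 0 := funext fun k => by
          have h3 := congrFun ((hv.D hn.holSecC_near).unique L.isFrame hv'.lift) k
          refine (mul_eq_zero.1 h3).resolve_left fun h4 => L.μ_ne k (n + 1 : ℤ) (by omega) ?_
          push_cast at h4 ⊢
          linear_combination h4
        rw [h2] at hv
        exact hn.drop hw L hv
    · exact hn.extendsAt hw

end SingConn

/-! ### Holomorphic functions with a parameter -/

namespace HolAt₂

variable {c d : OnePoint ℂ → ℂ → ℂ} {z : OnePoint ℂ} {ξ : ℂ}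

lemma add (hc : HolAt₂ c z ξ) (hd : HolAt₂ d z ξ) : HolAt₂ (fun x ζ => c x ζ + d x ζ) z ξ :=
  AnalyticAt.fun_add hc hd

lemma mul (hc : HolAt₂ c z ξ) (hd : HolAt₂ d z ξ) : HolAt₂ (fun x ζ => c x ζ * d x ζ) z ξ :=
  AnalyticAt.fun_mul hc hd

lemma const (a : ℂ) : HolAt₂ (fun _ _ => a) z ξ := analyticAt_const

lemma neg (hc : HolAt₂ c z ξ) : HolAt₂ (fun x ζ => -c x ζ) z ξ := AnalyticAt.fun_neg hc

lemma sum {ι : Type*} (t : Finset ι) {f : ι → OnePoint ℂ → ℂ → ℂ}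
    (hf : ∀ i ∈ t, HolAt₂ (f i) z ξ) : HolAt₂ (fun x ζ => ∑ i ∈ t, f i x ζ) z ξ :=
  Finset.analyticAt_fun_sum t hf

lemma of_left {f : OnePoint ℂ → ℂ} (hf : HolAt f z) : HolAt₂ (fun x _ => f x) z ξ :=
  AnalyticAt.fun_comp (f := fun q : ℂ × ℂ => q.1) (g := fun u => f (param z u)) hf analyticAt_fst

lemma of_right {g : ℂ → ℂ} (hg : AnalyticAt ℂ g ξ) : HolAt₂ (fun _ ζ => g ζ) z ξ :=
  AnalyticAt.fun_comp (f := fun q : ℂ × ℂ => q.2) hg analyticAt_snd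

lemma holAt (hc : HolAt₂ c z ξ) : HolAt (fun x => c x ξ) z :=
  AnalyticAt.fun_comp (f := fun u : ℂ => (u, ξ)) (g := fun q : ℂ × ℂ => c (param z q.1) q.2) hc
    (analyticAt_id.prod analyticAt_const)

/-- Analyticity is an open condition in the chart at `z`. If `z` is infinity, affine points near it
use the other chart, which requires the change of coordinate t = 1/x. -/
lemma exists_opens (hc : HolAt₂ c z ξ) : ∃ W : Opens (OnePoint ℂ), z ∈ W ∧ ∃ V : Set ℂ,
    IsOpen V ∧ ξ ∈ V ∧ ∀ y ∈ W, ∀ ζ ∈ V, HolAt₂ c y ζ := by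
  have h := hc.eventually_analyticAt
  obtain ⟨A, hA, B, hB, hAB⟩ := mem_nhds_prod_iff.1 h
  obtain ⟨V, hVB, hV, hξ⟩ := mem_nhds_iff.1 hB
  obtain ⟨W, hW, hWo, hz⟩ := mem_nhds_iff.1 (inter_mem (tendsto_coord z hA) (param_coord z))
  have key : ∀ y : ℂ, (y : OnePoint ℂ) ∈ W → ∀ ζ ∈ V, HolAt₂ c y ζ := by
    intro y hy ζ hζ
    obtain ⟨h1, h2⟩ := hW hy
    have h3 := hAB (Set.mk_mem_prod h1 (hVB hζ))
    induction z using OnePoint.rec with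
    | infty =>
      have hy0 : y ≠ 0 := by
        rintro rfl
        change invPt (0 : ℂ)⁻¹ = _ at h2
        rw [inv_zero, invPt_zero] at h2
        exact OnePoint.infty_ne_coe 0 h2
      have h4 : AnalyticAt ℂ (fun q : ℂ × ℂ => (q.1⁻¹, q.2)) (y, ζ) :=
        AnalyticAt.prod (AnalyticAt.fun_inv analyticAt_fst hy0) analyticAt_snd
      have h5 := AnalyticAt.fun_comp (f := fun q : ℂ × ℂ => (q.1⁻¹, q.2))
        (g := fun q : ℂ × ℂ => c (invPt q.1) q.2) (x := (y, ζ)) h3 h4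
      refine AnalyticAt.congr h5 ?_
      have h6 : ∀ᶠ q : ℂ × ℂ in 𝓝 (y, ζ), q.1 ≠ 0 :=
        continuousAt_fst.eventually_ne (x := (y, ζ)) hy0
      filter_upwards [h6] with q hq
      rw [invPt_of_ne (inv_ne_zero hq), inv_inv]
      rfl
    | coe w => exact h3
  by_cases hzi : z = OnePoint.infty
  · subst hzi
    refine ⟨⟨W, hWo⟩, hz, V, hV, hξ, fun y hy ζ hζ => ?_⟩
    induction y using OnePoint.rec with
    | infty => exact hAB (Set.mk_mem_prod (mem_of_mem_nhds hA) (hVB hζ))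
    | coe y => exact key y hy ζ hζ
  · refine ⟨⟨W, hWo⟩ ⊓ ⟨{OnePoint.infty}ᶜ, isOpen_compl_singleton⟩, ⟨hz, hzi⟩, V, hV, hξ,
      fun y hy ζ hζ => ?_⟩
    induction y using OnePoint.rec with
    | infty => exact absurd rfl hy.2
    | coe y => exact key y hy.1 ζ hζ

end HolAt₂

/-- The derivative with respect to `x`, with value zero at infinity. -/
def derivFun₂ (c : OnePoint ℂ → ℂ → ℂ) (x : OnePoint ℂ) (ξ : ℂ) : ℂ :=
  derivFun (fun y => c y ξ) x

lemma analyticAt_partial_deriv {g : ℂ × ℂ → ℂ} {q₀ : ℂ × ℂ} (hg : AnalyticAt ℂ g q₀) :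
    AnalyticAt ℂ (fun q : ℂ × ℂ => deriv (fun u => g (u, q.2)) q.1) q₀ := by
  have h1 : AnalyticAt ℂ (fun q => fderiv ℂ g q (1, 0)) q₀ :=
    AnalyticAt.fun_comp (g := fun T : ℂ × ℂ →L[ℂ] ℂ => T (1, 0))
      ((ContinuousLinearMap.apply ℂ ℂ ((1 : ℂ), (0 : ℂ))).analyticAt _) hg.fderiv
  refine h1.congr ?_
  filter_upwards [hg.eventually_analyticAt] with q hq
  have h2 : HasDerivAt (fun u : ℂ => (u, q.2)) ((1 : ℂ), (0 : ℂ)) q.1 :=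
    (hasDerivAt_id q.1).prodMk (hasDerivAt_const q.1 q.2)
  have h3 : HasFDerivAt g (fderiv ℂ g q) (q.1, q.2) := hq.differentiableAt.hasFDerivAt
  exact (h3.comp_hasDerivAt q.1 h2).deriv.symm

lemma HolAt₂.derivFun₂_coe {c : OnePoint ℂ → ℂ → ℂ} {w ξ : ℂ} (hc : HolAt₂ c w ξ) :
    HolAt₂ (derivFun₂ c) w ξ := analyticAt_partial_deriv hc

/-- The Euler operator `x d/dx`, with value zero at infinity. -/
def eulerFun₂ (c : OnePoint ℂ → ℂ → ℂ) (x : OnePoint ℂ) (ξ : ℂ) : ℂ :=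
  subFun 0 x * derivFun₂ c x ξ

/-- In the coordinate t = 1/x one has x d/dx = -t d/dt, which is holomorphic at t = 0. -/
lemma HolAt₂.eulerFun₂_infty {c : OnePoint ℂ → ℂ → ℂ} {ξ : ℂ}
    (hc : HolAt₂ c OnePoint.infty ξ) : HolAt₂ (eulerFun₂ c) OnePoint.infty ξ := by
  have h1 := (analyticAt_fst (𝕜 := ℂ) (p := ((0 : ℂ), ξ))).fun_neg.fun_mul
    (analyticAt_partial_deriv hc)
  refine AnalyticAt.congr h1 ?_
  filter_upwards [hc.eventually_analyticAt] with q hq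
  change -q.1 * deriv (fun u => c (invPt u) q.2) q.1 = eulerFun₂ c (invPt q.1) q.2
  by_cases h0 : q.1 = 0
  · rw [h0, invPt_zero]; simp [eulerFun₂, subFun]
  · rw [invPt_of_ne h0]
    change _ = (q.1⁻¹ - 0) * deriv (fun u : ℂ => c u q.2) q.1⁻¹
    have e : (fun u : ℂ => c u q.2) =ᶠ[𝓝 q.1⁻¹] ((fun t => c (invPt t) q.2) ∘ fun u : ℂ => u⁻¹) := by
      filter_upwards [eventually_ne_nhds (inv_ne_zero h0)] with u hu
      simp [invPt_of_ne (inv_ne_zero hu)]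
    rw [e.deriv_eq]
    have h3 : AnalyticAt ℂ (fun t => c (invPt t) q.2) q.1 :=
      AnalyticAt.fun_comp (f := fun u : ℂ => (u, q.2))
        (g := fun q : ℂ × ℂ => c (invPt q.1) q.2) hq (analyticAt_id.prod analyticAt_const)
    have h2 : HasDerivAt (fun t => c (invPt t) q.2) (deriv (fun t => c (invPt t) q.2) q.1)
        (q.1⁻¹)⁻¹ := by
      rw [inv_inv]; exact h3.differentiableAt.hasDerivAt
    rw [(h2.comp (q.1⁻¹) (hasDerivAt_inv (inv_ne_zero h0))).deriv]
    field_simp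
    ring

/-! ### Germs depending on the parameter ξ, and their reduction to F. -/

namespace SingConn

variable {r : ℕ} {E : HolBundle r} {C : SingConn E}

lemma near_prod_eventually {z : OnePoint ℂ} {ξ₀ : ℂ} {p : ℂ × ℂ → Prop}
    (h : ∀ᶠ q in C.near z ×ˢ 𝓝 ξ₀, p q) :
    ∀ᶠ q in C.near z ×ˢ 𝓝 ξ₀, ∀ᶠ y in 𝓝 q.1, p (y, q.2) := by
  obtain ⟨pa, ha, pb, hb, h⟩ := eventually_prod_iff.1 h
  filter_upwards [(C.near_eventually ha).prod_inl (𝓝 ξ₀), hb.prod_inr (C.near z)] with q h1 h2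
  exact h1.mono fun y hy => h hy h2

lemma near_prod_holAt₂ {z : OnePoint ℂ} {ξ₀ : ℂ} {c : OnePoint ℂ → ℂ → ℂ} (hc : HolAt₂ c z ξ₀) :
    ∀ᶠ q : ℂ × ℂ in C.near z ×ˢ 𝓝 ξ₀, HolAt₂ c q.1 q.2 := by
  obtain ⟨W, hz, V, hV, hξ, h⟩ := hc.exists_opens
  filter_upwards [(near_mem (C := C) hz).prod_inl (𝓝 ξ₀),
    Eventually.prod_inr (hV.mem_nhds hξ) (C.near z)] with q h1 h2 using h _ h1 _ h2

/-! ### Families of germs -/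

variable (C) in
/-- `Φ` is near `(z, ξ₀)` a combination of sections in `Γ` with coefficients that are holomorphic
in both variables. -/
def Fam (Γ : (∀ x : ℂ, E.Fib x) → Prop) (z : OnePoint ℂ) (ξ₀ : ℂ)
    (Φ : ℂ → ∀ x : ℂ, E.Fib x) : Prop :=
  ∃ (ι : Type) (_ : Fintype ι) (s : ι → ∀ x : ℂ, E.Fib x) (c : ι → OnePoint ℂ → ℂ → ℂ),
    (∀ j, Γ (s j)) ∧ (∀ j, HolAt₂ (c j) z ξ₀) ∧
      ∀ᶠ q : ℂ × ℂ in C.near z ×ˢ 𝓝 ξ₀, Φ q.2 q.1 = ∑ j, c j q.1 q.2 • s j q.1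

namespace Fam

variable {Γ Γ' : (∀ x : ℂ, E.Fib x) → Prop} {z : OnePoint ℂ} {ξ₀ : ℂ}
  {Φ Ψ : ℂ → ∀ x : ℂ, E.Fib x}

lemma mono (h : ∀ s, Γ s → Γ' s) (hΦ : C.Fam Γ z ξ₀ Φ) : C.Fam Γ' z ξ₀ Φ := by
  obtain ⟨ι, hι, s, c, hs, hc, e⟩ := hΦ
  exact ⟨ι, hι, s, c, fun j => h _ (hs j), hc, e⟩

lemma zero : C.Fam Γ z ξ₀ (fun _ _ => 0) :=
  ⟨PEmpty, inferInstance, fun j => j.elim, fun j => j.elim, fun j => j.elim, fun j => j.elim,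
    Eventually.of_forall fun _ => by simp⟩

lemma add (h : C.Fam Γ z ξ₀ Φ) (h' : C.Fam Γ z ξ₀ Ψ) :
    C.Fam Γ z ξ₀ (fun ξ x => Φ ξ x + Ψ ξ x) := by
  obtain ⟨ι, hι, s, c, hs, hc, e⟩ := h
  obtain ⟨ι', hι', s', c', hs', hc', e'⟩ := h'
  refine ⟨ι ⊕ ι', inferInstance, Sum.elim s s', Sum.elim c c', ?_, ?_, ?_⟩
  · rintro (j | j)
    exacts [hs j, hs' j]
  · rintro (j | j)
    exacts [hc j, hc' j]
  · filter_upwards [e, e'] with q h1 h2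
    simp [h1, h2]

lemma of_sum {ι : Type} [Fintype ι] {s : ι → ∀ x : ℂ, E.Fib x} {c : ι → OnePoint ℂ → ℂ → ℂ}
    (hs : ∀ j, Γ (s j)) (hc : ∀ j, HolAt₂ (c j) z ξ₀) :
    C.Fam Γ z ξ₀ (fun ξ x => ∑ j, c j x ξ • s j x) :=
  ⟨ι, inferInstance, s, c, hs, hc, Eventually.of_forall fun _ => rfl⟩

lemma congr (h : C.Fam Γ z ξ₀ Φ)
    (e : ∀ᶠ q : ℂ × ℂ in C.near z ×ˢ 𝓝 ξ₀, Φ q.2 q.1 = Ψ q.2 q.1) : C.Fam Γ z ξ₀ Ψ := by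
  obtain ⟨ι, hι, s, c, hs, hc, e'⟩ := h
  exact ⟨ι, hι, s, c, hs, hc, by filter_upwards [e, e'] with q h1 h2; rw [← h1, h2]⟩

end Fam

/-- Holomorphy and derivative of a combination with coefficients depending on a parameter. -/
lemma D_sum_param {z : OnePoint ℂ} {ξ₀ : ℂ} {ι : Type} [Fintype ι] {s : ι → ∀ x : ℂ, E.Fib x}
    {c : ι → OnePoint ℂ → ℂ → ℂ} (hs : ∀ j, ∀ᶠ x in C.near z, E.HolSecC (s j) x)
    (hc : ∀ j, HolAt₂ (c j) z ξ₀) :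
    ∀ᶠ q : ℂ × ℂ in C.near z ×ˢ 𝓝 ξ₀,
      E.HolSecC (fun x => ∑ j, c j x q.2 • s j x) q.1 ∧
      C.D (fun x => ∑ j, c j x q.2 • s j x) q.1 =
        ∑ j, (derivFun₂ (c j) q.1 q.2 • s j q.1 + c j q.1 q.2 • C.D (s j) q.1) := by
  filter_upwards [(eventually_all.2 hs).prod_inl (𝓝 ξ₀),
    eventually_all.2 fun j => near_prod_holAt₂ (C := C) (hc j),
    (C.near_notMem z).prod_inl (𝓝 ξ₀)] with q h1 h2 hP
  have h3 := D_sum (C := C) (s := fun j x => c j x q.2 • s j x) Finset.univ hP fun j _ =>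
    HolBundle.HolSecC.smul (h2 j).holAt (h1 j)
  refine ⟨h3.2, h3.1.trans (Finset.sum_congr rfl fun j _ => ?_)⟩
  exact C.D_smul (fun x => c j x q.2) (s j) q.1 hP (h2 j).holAt (h1 j)

lemma Fam.holSecC {Γ : (∀ x : ℂ, E.Fib x) → Prop} {z : OnePoint ℂ} {ξ₀ : ℂ}
    {Φ : ℂ → ∀ x : ℂ, E.Fib x} (hΓ : ∀ s, Γ s → ∀ᶠ x in C.near z, E.HolSecC s x)
    (h : C.Fam Γ z ξ₀ Φ) : ∀ᶠ q : ℂ × ℂ in C.near z ×ˢ 𝓝 ξ₀, E.HolSecC (Φ q.2) q.1 := by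
  obtain ⟨ι, hι, s, c, hs, hc, e⟩ := h
  filter_upwards [near_prod_eventually e, D_sum_param (fun j => hΓ _ (hs j)) hc] with q h1 h2
  exact h2.1.congr (h1.mono fun y hy => hy.symm)

/-- `Φ` is cohomologous to a family of germs of `F`, by a family of germs of the minimal
extension. -/
def Fam.Solvable (C : SingConn E) (z : OnePoint ℂ) (ξ₀ : ℂ) (Φ : ℂ → ∀ x : ℂ, E.Fib x) : Prop :=
  ∃ γ β : ℂ → ∀ x : ℂ, E.Fib x, C.Fam (C.minSystem.mem z) z ξ₀ γ ∧
    C.Fam (fun s => C.FCond s z) z ξ₀ β ∧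
    ∀ᶠ q : ℂ × ℂ in C.near z ×ˢ 𝓝 ξ₀,
      Φ q.2 q.1 = (C.D (γ q.2) q.1 - q.2 • γ q.2 q.1) + β q.2 q.1

lemma holSecC_of_minSystem {z : OnePoint ℂ} (s : ∀ x : ℂ, E.Fib x) (h : C.minSystem.mem z s) :
    ∀ᶠ x in C.near z, E.HolSecC s x := (C.minSystem.mero h).holSecC_near

/-- Lets the pole order be lowered successively: the solutions γ of the individual steps add up. -/
lemma Fam.Solvable.step {z : OnePoint ℂ} {ξ₀ : ℂ} {Φ γ Ψ : ℂ → ∀ x : ℂ, E.Fib x}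
    (hγ : C.Fam (C.minSystem.mem z) z ξ₀ γ) (hΨ : Fam.Solvable C z ξ₀ Ψ)
    (e : ∀ᶠ q : ℂ × ℂ in C.near z ×ˢ 𝓝 ξ₀,
      Φ q.2 q.1 = (C.D (γ q.2) q.1 - q.2 • γ q.2 q.1) + Ψ q.2 q.1) : Fam.Solvable C z ξ₀ Φ := by
  obtain ⟨γ', β, hγ', hβ, e'⟩ := hΨ
  refine ⟨_, β, hγ.add hγ', hβ, ?_⟩
  filter_upwards [e, e', hγ.holSecC holSecC_of_minSystem, hγ'.holSecC holSecC_of_minSystem,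
    (C.near_notMem z).prod_inl (𝓝 ξ₀)] with q h1 h2 h3 h4 hP
  rw [h1, h2, D_add' hP h3 h4, smul_add]
  abel

/-- For s = a + ∂b one has c s = ∇_ξ(c b) + c a + (ξ c - ∂_x c) b. The remainder involves only a and
b, one step lower, and its coefficients remain holomorphic in (x, ξ). Step 1 is already contained in
F. -/
lemma Fam.solvable_fil {w ξ₀ : ℂ} {n : ℕ} {Φ : ℂ → ∀ x : ℂ, E.Fib x}
    (h : C.Fam (C.Fil w (n + 1)) w ξ₀ Φ) : Fam.Solvable C w ξ₀ Φ := by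
  induction n generalizing Φ with
  | zero =>
    refine ⟨fun _ _ => 0, Φ, Fam.zero, h.mono fun s hs => fCond_of_fil hs, ?_⟩
    filter_upwards [(C.near_notMem w).prod_inl (𝓝 ξ₀)] with q hP
    rw [D_zero hP, smul_zero, sub_zero, zero_add]
  | succ n ih =>
    obtain ⟨ι, hι, s, c, hs, hc, e⟩ := h
    choose a b ha hb hab using hs
    have hγ : C.Fam (C.Fil w (n + 1)) w ξ₀ (fun ξ x => ∑ j, c j x ξ • b j x) := Fam.of_sum hb hc
    have h1 : C.Fam (C.Fil w (n + 1)) w ξ₀ (fun ξ x => ∑ j, c j x ξ • a j x) := Fam.of_sum ha hc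
    have h2 : C.Fam (C.Fil w (n + 1)) w ξ₀
        (fun ξ x => ∑ j, (-derivFun₂ (c j) x ξ + ξ * c j x ξ) • b j x) :=
      Fam.of_sum (c := fun j x ξ => -derivFun₂ (c j) x ξ + ξ * c j x ξ) hb fun j =>
        (hc j).derivFun₂_coe.neg.add ((HolAt₂.of_right analyticAt_id).mul (hc j))
    refine Fam.Solvable.step (hγ.mono fun s hs => minSystem_coe.2 ⟨_, hs⟩) (ih (h1.add h2)) ?_
    filter_upwards [e, D_sum_param (fun j => (hb j).holSecC_near) hc,
      (eventually_all.2 hab).prod_inl (𝓝 ξ₀)] with q h3 h4 h5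
    rw [h3, h4.2, Finset.smul_sum, ← Finset.sum_sub_distrib, ← Finset.sum_add_distrib,
      ← Finset.sum_add_distrib]
    refine Finset.sum_congr rfl fun j _ => ?_
    rw [h5 j]
    module

/-- On x^(n+1) e_k the operator ∇_ξ is multiplication by α_k - ξ up to terms of order x^n. Dividing
by α_k - ξ, which is invertible and holomorphic in ξ near ξ₀, removes the top pole; order 0 is in F.
-/
lemma Fam.solvable_pow (L : C.IrrFrame) {ξ₀ : ℂ} (hξ : ξ₀ ∉ C.Phat) {n : ℕ}
    {g : Fin r → OnePoint ℂ → ℂ → ℂ} (hg : ∀ k, HolAt₂ (g k) OnePoint.infty ξ₀)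
    {Φ : ℂ → ∀ x : ℂ, E.Fib x} (h : ∀ᶠ q : ℂ × ℂ in C.near OnePoint.infty ×ˢ 𝓝 ξ₀,
      Φ q.2 q.1 = ∑ k, g k q.1 q.2 • q.1 ^ n • L.e k q.1) :
    Fam.Solvable C OnePoint.infty ξ₀ Φ := by
  have hb : ∀ (m : ℕ) (k : Fin r), C.minSystem.mem OnePoint.infty (fun x => x ^ m • L.e k x) := by
    intro m k
    refine minSystem_infty.2 ⟨m, fun h => absurd (Or.inl rfl) h,
      (extendsAt_frame L.isFrame k).congr ?_⟩
    filter_upwards [near_infty_le (eventually_ne_cocompact 0)] with x hx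
    change _ = (x⁻¹) ^ m • x ^ m • L.e k x
    rw [smul_smul, ← mul_pow, inv_mul_cancel₀ hx, one_pow, one_smul]
  induction n generalizing g Φ with
  | zero =>
    refine ⟨fun _ _ => 0, Φ, Fam.zero, (Fam.of_sum (s := fun k x => L.e k x) (fun k =>
      fCond_of_extendsAt (extendsAt_frame L.isFrame k)) hg).congr ?_, ?_⟩
    · filter_upwards [h] with q hq
      rw [hq]; simp
    · filter_upwards [(C.near_notMem _).prod_inl (𝓝 ξ₀)] with q hP
      rw [D_zero hP, smul_zero, sub_zero, zero_add]
  | succ n ih =>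
    let h' : Fin r → OnePoint ℂ → ℂ → ℂ := fun k x ξ => g k x ξ * (C.α k - ξ)⁻¹
    have hαξ : ∀ k, C.α k - ξ₀ ≠ 0 := fun k h0 => hξ ⟨k, sub_eq_zero.1 h0⟩
    have hh : ∀ k, HolAt₂ (h' k) OnePoint.infty ξ₀ := fun k => (hg k).mul (HolAt₂.of_right
      ((analyticAt_const.fun_sub analyticAt_id).fun_inv (hαξ k)))
    have hi : HolAt₂ (fun x _ => invFun x) OnePoint.infty ξ₀ := HolAt₂.of_left holAt_invFun
    -- The new coefficients collect the terms of order x^n in ∇_ξ(h' x^(n+1) e). The derivative of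
    -- h' enters as x ∂_x h', because one factor x is split off from x^(n+1).
    refine Fam.Solvable.step (Fam.of_sum (c := h') (hb (n + 1)) hh)
      (ih (Φ := fun ξ x => ∑ k, (-(eulerFun₂ (h' k) x ξ + (n + 1 + C.ν k) * h' k x ξ +
          ∑ l, invFun x * (L.H k l x * h' l x ξ))) • x ^ n • L.e k x)
        (g := fun k x ξ => -(eulerFun₂ (h' k) x ξ + (n + 1 + C.ν k) * h' k x ξ +
          ∑ l, invFun x * (L.H k l x * h' l x ξ)))
        (fun k => ?_) (Eventually.of_forall fun _ => rfl)) ?_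
    · exact (((hh k).eulerFun₂_infty.add ((HolAt₂.const _).mul (hh k))).add
        (HolAt₂.sum _ fun l _ => hi.mul ((HolAt₂.of_left (L.holAt_H k l)).mul (hh l)))).neg
    · have hne : ∀ᶠ ξ in 𝓝 ξ₀, ∀ k, C.α k - ξ ≠ 0 := eventually_all.2 fun k =>
        (continuousAt_const.sub continuousAt_id).eventually_ne (hαξ k)
      have hD : ∀ᶠ x in C.near OnePoint.infty, ∀ k, C.D (fun y => y ^ (n + 1) • L.e k y) x =
          (((n + 1 : ℂ) + C.ν k) * x ^ n + C.α k * x ^ (n + 1)) • L.e k x +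
            ∑ l, (x⁻¹ * L.H l k x) • x ^ n • L.e l x := by
        filter_upwards [eventually_all.2 L.D_e,
          eventually_all.2 fun k => holSecC_near (C := C) (L.isFrame.hol k), C.near_notMem _,
          near_infty_le (eventually_ne_cocompact 0)] with x hx hxe hxP hx0 k
        rw [C.D_smul (fun y => y ^ (n + 1)) _ x hxP (analyticAt_id.fun_pow _) (hxe k),
          (hasDerivAt_pow (n + 1) x).deriv, hx k, smul_add, Finset.smul_sum, smul_smul, ← add_assoc,
          ← add_smul]
        congr 1
        · congr 1
          rw [Nat.add_sub_cancel]
          push_cast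
          field_simp
          ring
        · refine Finset.sum_congr rfl fun l _ => ?_
          rw [smul_smul, smul_smul]
          congr 1
          field_simp
          ring
      filter_upwards [h, D_sum_param (fun k => holSecC_of_minSystem _ (hb (n + 1) k)) hh,
        hne.prod_inr _, hD.prod_inl _] with q h1 h2 h3 h4
      have h5 : ∀ k, g k q.1 q.2 = (C.α k - q.2) * h' k q.1 q.2 := fun k => by
        have := h3 k
        simp only [h']
        field_simp
      have h7 : ∀ k, eulerFun₂ (h' k) q.1 q.2 = q.1 * derivFun₂ (h' k) q.1 q.2 := fun k => by
        simp [eulerFun₂, subFun]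
      have h8 : ∑ k, ∑ l, h' k q.1 q.2 • (q.1⁻¹ * L.H l k q.1) • q.1 ^ n • L.e l q.1 =
          ∑ k, (∑ l, invFun q.1 * (L.H k l q.1 * h' l q.1 q.2)) • q.1 ^ n • L.e k q.1 := by
        rw [Finset.sum_comm]
        refine Finset.sum_congr rfl fun k _ => ?_
        rw [Finset.sum_smul]
        refine Finset.sum_congr rfl fun l _ => ?_
        change _ = (q.1⁻¹ * _) • _
        module
      have h9 : ∑ k, (derivFun₂ (h' k) q.1 q.2 • q.1 ^ (n + 1) • L.e k q.1 +
            h' k q.1 q.2 • C.D (fun y => y ^ (n + 1) • L.e k y) q.1) =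
          ∑ k, (derivFun₂ (h' k) q.1 q.2 • q.1 ^ (n + 1) • L.e k q.1 + h' k q.1 q.2 •
            (((n + 1 : ℂ) + C.ν k) * q.1 ^ n + C.α k * q.1 ^ (n + 1)) • L.e k q.1 +
            (∑ l, invFun q.1 * (L.H k l q.1 * h' l q.1 q.2)) • q.1 ^ n • L.e k q.1) := by
        rw [Finset.sum_add_distrib (f := fun k => _ + _), ← h8, ← Finset.sum_add_distrib]
        refine Finset.sum_congr rfl fun k _ => ?_
        rw [h4 k, smul_add, Finset.smul_sum]
        exact (add_assoc _ _ _).symm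
      rw [h1, h2.2, h9, Finset.smul_sum, ← Finset.sum_sub_distrib, ← Finset.sum_add_distrib]
      refine Finset.sum_congr rfl fun k _ => ?_
      rw [h5, h7]
      module

end SingConn

/-! ### Solvability at every point of the sphere. -/

namespace SingConn

variable {r : ℕ} {E : HolBundle r} {C : SingConn E}

/-- Every family of germs of the minimal extension is cohomologous to a family of germs
of `F`. -/
lemma Fam.solvable {z : OnePoint ℂ} {ξ₀ : ℂ} (hξ : ξ₀ ∉ C.Phat) {Φ : ℂ → ∀ x : ℂ, E.Fib x}
    (h : C.Fam (C.minSystem.mem z) z ξ₀ Φ) : Fam.Solvable C z ξ₀ Φ := by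
  obtain ⟨ι, hι, s, c, hs, hc, e⟩ := h
  induction z using OnePoint.rec with
  | infty =>
    obtain ⟨L⟩ := C.exists_irrFrame
    choose k _ hk using fun j => minSystem_infty.1 (hs j)
    -- A common pole order for the finitely many sections of the family.
    let n := Finset.univ.sup k
    choose a ha hsa using fun j => ((hk j).unif_pow_mono
      (Finset.le_sup (f := k) (Finset.mem_univ j)) :
        C.ExtendsAt (fun x => unif OnePoint.infty x ^ n • s j x) OnePoint.infty).exists_coeff
          L.isFrame
    refine Fam.solvable_pow L hξ (n := n) (g := fun k x ξ => ∑ j, c j x ξ * a j k x)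
      (fun k => HolAt₂.sum _ fun j _ => (hc j).mul (HolAt₂.of_left (ha j k))) ?_
    filter_upwards [e, (eventually_all.2 hsa).prod_inl (𝓝 ξ₀),
      Eventually.prod_inl (near_infty_le (C := C) (eventually_ne_cocompact 0)) (𝓝 ξ₀)] with q h1 h2 h3
    rw [h1]
    simp only [Finset.sum_smul]
    rw [Finset.sum_comm]
    refine Finset.sum_congr rfl fun j _ => ?_
    have h4 : s j q.1 = q.1 ^ n • ∑ k, a j k q.1 • L.e k q.1 := by
      rw [← h2 j]
      change _ = q.1 ^ n • (q.1⁻¹) ^ n • s j q.1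
      rw [smul_smul, ← mul_pow, mul_inv_cancel₀ h3, one_pow, one_smul]
    rw [h4, Finset.smul_sum, Finset.smul_sum]
    refine Finset.sum_congr rfl fun k _ => ?_
    module
  | coe w =>
    choose k hk using fun j => minSystem_coe.1 (hs j)
    exact Fam.solvable_fil (n := Finset.univ.sup k) ⟨ι, hι, s, c, fun j => (hk j).mono
      ((Finset.le_sup (f := k) (Finset.mem_univ j)).trans (Nat.le_succ _)), hc, e⟩

lemma germ_sheafF {z : OnePoint ℂ} {s : ∀ x : ℂ, E.Fib x} :
    C.sheafF.Germ z s ↔ C.FCond s z := by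
  refine ⟨fun ⟨W, hz, s', hs', e⟩ => (hs' z hz).congr e, fun h => ?_⟩
  obtain ⟨W, hz, hW⟩ := exists_opens_of_near (C.minSystem.mero h.minSystem).holSecC_near
  obtain ⟨W', hz', hW'⟩ := C.exists_opens_isSing z
  refine OSub.germ_of_ofFun (W := W ⊓ W') ⟨hz, hz'⟩ fun y hy => ?_
  by_cases hyz : y = z
  · subst hyz
    exact h.congr ((extend_ofFun_near s hy).mono fun x hx => hx.symm)
  · obtain ⟨w, rfl, hw⟩ := exists_coe_of_not_isSing fun hs => hyz (hW' y hy.2 hs)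
    refine fCond_of_extendsAt (ExtendsAt.congr ((extendsAt_coe hw).2 (hW w hy.1 hw)) ?_)
    exact (extend_ofFun_near s hy).mono fun x hx => hx.symm

/-- Off the singular points the minimal extension coincides with E. This puts the A-components of
the modified cocycles in E, since intersections of two different members of the cover will contain
no singular point. -/
lemma germ_sheafE_of_minExt {z : OnePoint ℂ} (hz : ¬ C.IsSing z) {s : ∀ x : ℂ, E.Fib x}
    (h : C.minExt.Germ z s) : C.sheafE.Germ z s := by
  have hs := C.minSystem.mero (germ_minExt.1 h)
  obtain ⟨W, hzW, hW⟩ := exists_opens_of_near hs.holSecC_near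
  obtain ⟨W', hz', hW'⟩ := C.exists_opens_isSing z
  refine OSub.germ_of_ofFun (W := W ⊓ W') ⟨hzW, hz'⟩ fun y hy => ?_
  obtain ⟨w, rfl, hw⟩ := exists_coe_of_not_isSing fun hs => hz (hW' y hy.2 hs ▸ hs)
  refine ExtendsAt.congr ((extendsAt_coe hw).2 (hW w hy.1 hw)) ?_
  exact (extend_ofFun_near s hy).mono fun x hx => hx.symm

/-! ### Families of germs and families of sections -/

/-- Only finitely many germs and coefficients occur, so one neighbourhood of (z, ξ₀) serves for all
of them. -/
lemma Fam.exists_opens {A : C.OSub} {z : OnePoint ℂ} {ξ₀ : ℂ} {Φ : ℂ → ∀ x : ℂ, E.Fib x}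
    (h : C.Fam (A.Germ z) z ξ₀ Φ) : ∃ W : Opens (OnePoint ℂ), z ∈ W ∧ ∃ V : Set ℂ,
      IsOpen V ∧ ξ₀ ∈ V ∧ ∃ (n : ℕ) (s : Fin n → ∀ x : ℂ, E.Fib x)
        (c : Fin n → OnePoint ℂ → ℂ → ℂ), (∀ j, C.ofFun W (s j) ∈ A.carrier W) ∧
        (∀ j, ∀ y ∈ W, ∀ ξ ∈ V, HolAt₂ (c j) y ξ) ∧
        ∀ x : ℂ, (x : OnePoint ℂ) ∈ W → x ∉ C.P → ∀ ξ ∈ V, Φ ξ x = ∑ j, c j x ξ • s j x := by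
  obtain ⟨ι, hι, s, c, hs, hc, e⟩ := h
  choose W₁ hz₁ hW₁ using fun j => (hs j).exists_ofFun
  choose W₂ hz₂ V₂ hV₂ hξ₂ h₂ using fun j => (hc j).exists_opens
  obtain ⟨pa, ha, pb, hb, e⟩ := eventually_prod_iff.1 e
  obtain ⟨W₃, hz₃, hW₃⟩ := exists_opens_of_near ha
  obtain ⟨V₃, hVb, hV₃, hξ₃⟩ := mem_nhds_iff.1 hb
  let W : Opens (OnePoint ℂ) := ⟨⋂ j, ((W₁ j ⊓ W₂ j ⊓ W₃ : Opens (OnePoint ℂ)) : Set (OnePoint ℂ)),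
    isOpen_iInter_of_finite fun j => (W₁ j ⊓ W₂ j ⊓ W₃).isOpen⟩ ⊓ W₃
  have hW : ∀ j, W ≤ W₁ j ⊓ W₂ j ⊓ W₃ := fun j x hx => Set.mem_iInter.1 hx.1 j
  let f := Fintype.equivFin ι
  refine ⟨W, ⟨Set.mem_iInter.2 fun j => ⟨⟨hz₁ j, hz₂ j⟩, hz₃⟩, hz₃⟩, (⋂ j, V₂ j) ∩ V₃,
    (isOpen_iInter_of_finite hV₂).inter hV₃, ⟨Set.mem_iInter.2 hξ₂, hξ₃⟩, _, fun j => s (f.symm j),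
    fun j => c (f.symm j), fun j => ?_, fun j y hy ξ hξ => ?_, fun x hx hxP ξ hξ => ?_⟩
  · exact A.res_mem (W₁ _) W ((hW (f.symm j)).trans (inf_le_left.trans inf_le_left)) _ (hW₁ _)
  · exact h₂ _ y (hW (f.symm j) hy).1.2 ξ (Set.mem_iInter.1 hξ.1 _)
  · rw [e (hW₃ x hx.2 hxP) (hVb hξ.2)]
    exact (f.symm.sum_comp fun j => c j x ξ • s j x).symm

lemma Fam.germ {A : C.OSub} {z : OnePoint ℂ} {ξ₀ : ℂ} {Φ : ℂ → ∀ x : ℂ, E.Fib x}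
    (h : C.Fam (A.Germ z) z ξ₀ Φ) : A.Germ z (Φ ξ₀) := by
  obtain ⟨ι, hι, s, c, hs, hc, e⟩ := h
  refine (OSub.Germ.sum (s := fun j x => c j x ξ₀ • s j x) Finset.univ fun j _ =>
    OSub.Germ.smul (hc j).holAt (hs j)).congr ?_
  filter_upwards [e.curry] with x hx using hx.self_of_nhds.symm

lemma Fam.eventually {A : C.OSub} {z : OnePoint ℂ} {ξ₀ : ℂ} {Φ : ℂ → ∀ x : ℂ, E.Fib x}
    (h : C.Fam (A.Germ z) z ξ₀ Φ) : ∃ W : Opens (OnePoint ℂ), z ∈ W ∧ ∃ V : Set ℂ,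
      IsOpen V ∧ ξ₀ ∈ V ∧ ∀ y ∈ W, ∀ ξ ∈ V, C.Fam (A.Germ y) y ξ Φ := by
  obtain ⟨W, hz, V, hV, hξ, n, s, c, hs, hc, e⟩ := h.exists_opens
  refine ⟨W, hz, V, hV, hξ, fun y hy ξ hξ => ⟨Fin n, inferInstance, s, c,
    fun j => OSub.germ_of_ofFun hy (hs j), fun j => hc j y hy ξ hξ, ?_⟩⟩
  filter_upwards [(near_mem (C := C) hy).prod_inl (𝓝 ξ), (C.near_notMem y).prod_inl (𝓝 ξ),
    Eventually.prod_inr (hV.mem_nhds hξ) (C.near y)] with q h1 h2 h3 using e _ h1 h2 _ h3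

namespace OSub

variable {A B : C.OSub} {U W : Opens (OnePoint ℂ)} {V V' : Set ℂ}

/-- Allows the pointwise solution of ∇_ξ γ + β = b to be applied to holomorphic families of
sections, and its result to be turned back into such families. -/
lemma holFamily_iff {m : ℂ → A.carrier U} : A.HolFamily U V m ↔
    ∀ z ∈ U, ∀ ξ ∈ V, C.Fam (A.Germ z) z ξ (fun ξ => C.extend (m ξ).1) := by
  constructor
  · intro h z hz ξ hξ
    obtain ⟨W, hW, hzW, n, s, c, hc, e⟩ := h z hz ξ hξ
    refine ⟨Fin n, inferInstance, fun j => C.extend (s j).1, c, fun j =>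
      germ_of_mem (s j).2 hzW, hc, ?_⟩
    filter_upwards [(near_mem (C := C) hzW).prod_inl (𝓝 ξ), (C.near_notMem z).prod_inl (𝓝 ξ),
      e.prod_inr (C.near z)] with q h1 h2 h3
    rw [← extend_restr hW _ h1, extend_apply (C.restr hW _) ⟨q.1, h1, h2⟩, h3 ⟨q.1, h1, h2⟩]
    refine Finset.sum_congr rfl fun j _ => ?_
    rw [extend_apply (s j).1 ⟨q.1, h1, h2⟩]
  · intro h z hz ξ hξ
    obtain ⟨W, hzW, V₀, hV₀, hξ₀, n, s, c, hs, hc, e⟩ := (h z hz ξ hξ).exists_opens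
    refine ⟨W ⊓ U, inf_le_right, ⟨hzW, hz⟩, n, fun j => ⟨C.ofFun _ (s j),
      A.res_mem W (W ⊓ U) inf_le_left _ (hs j)⟩, c, fun j => hc j z hzW ξ hξ₀, ?_⟩
    filter_upwards [hV₀.mem_nhds hξ₀] with ζ hζ x
    exact (extend_apply (m ζ).1 ⟨x.1, x.2.1.2, x.2.2⟩).symm.trans (e x.1 x.2.1.1 x.2.2 ζ hζ)

lemma HolFamily.const (s : A.carrier U) : A.HolFamily U V (fun _ => s) :=
  holFamily_iff.2 fun z hz ξ _ => ⟨Unit, inferInstance, fun _ => C.extend s.1, fun _ _ _ => 1,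
    fun _ => germ_of_mem s.2 hz, fun _ => HolAt₂.const 1, Eventually.of_forall fun _ => by simp⟩

lemma HolFamily.incl (h : A.Le B) {m : ℂ → A.carrier U} (hm : A.HolFamily U V m) :
    B.HolFamily U V (fun ξ => Submodule.inclusion (h U) (m ξ)) :=
  holFamily_iff.2 fun z hz ξ hξ => (holFamily_iff.1 hm z hz ξ hξ).mono fun _ => h.germ

variable (A U) in
/-- The family of sections over `U` given by `Φ`, where these are sections of `A`. -/
def secOf (Φ : ℂ → ∀ x : ℂ, E.Fib x) (ξ : ℂ) : A.carrier U :=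
  open Classical in
    if h : C.ofFun U (Φ ξ) ∈ A.carrier U then ⟨_, h⟩ else 0

variable {Φ : ℂ → ∀ x : ℂ, E.Fib x}

lemma coe_secOf {ξ : ℂ} (h : ∀ z ∈ U, A.Germ z (Φ ξ)) :
    (A.secOf U Φ ξ).1 = C.ofFun U (Φ ξ) := by
  have : C.ofFun U (Φ ξ) ∈ A.carrier U := mem_of_germ fun z hz =>
    (h z hz).congr ((extend_ofFun_near _ hz).mono fun _ hx => hx.symm)
  rw [secOf, dif_pos this]

lemma holFamily_secOf (hV : IsOpen V) (h : ∀ z ∈ U, ∀ ξ ∈ V, C.Fam (A.Germ z) z ξ Φ) :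
    A.HolFamily U V (A.secOf U Φ) := holFamily_iff.2 fun z hz ξ hξ => by
  refine (h z hz ξ hξ).congr ?_
  filter_upwards [Eventually.prod_inr (hV.mem_nhds hξ) (C.near z),
    (near_mem (C := C) hz).prod_inl (𝓝 ξ), (C.near_notMem z).prod_inl (𝓝 ξ)] with q h1 h2 h3
  rw [coe_secOf fun y hy => (h y hy _ h1).germ, extend_ofFun _ h2 h3]

end OSub

/-- Local solution of `b = ∇_ξ γ + β` with parameter `ξ`, for sections `b`, `γ` of the minimal
extension and `β` of `F`; at nonsingular points one may take `γ = 0`. -/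
lemma exists_solution {U : Opens (OnePoint ℂ)} {V : Set ℂ} (hV : IsOpen V)
    {b : ℂ → C.minExt.carrier U} (hb : C.minExt.HolFamily U V b) {z : OnePoint ℂ} (hz : z ∈ U)
    {ξ₀ : ℂ} (hξ : ξ₀ ∈ V) (hξ' : ξ₀ ∉ C.Phat) :
    ∃ W, ∃ h : W ≤ U, z ∈ W ∧ (∀ y ∈ W, C.IsSing y → y = z) ∧ ∃ V₀ : Set ℂ, IsOpen V₀ ∧ ξ₀ ∈ V₀ ∧
      (¬ C.IsSing z → V₀ = V) ∧
      ∃ (γ : ℂ → C.minExt.carrier W) (β : ℂ → C.sheafF.carrier W),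
        C.minExt.HolFamily W V₀ γ ∧ C.sheafF.HolFamily W V₀ β ∧
        ∀ ξ ∈ V₀, C.restr h (b ξ).1 = C.nabla ξ (γ ξ).1 + (β ξ).1 := by
  obtain ⟨W', hz', hW'⟩ := C.exists_opens_isSing z
  have hb' := OSub.holFamily_iff.1 hb
  by_cases hzs : C.IsSing z
  · obtain ⟨γ, β, hγ, hβ, e⟩ := ((hb' z hz ξ₀ hξ).mono fun s hs =>
      germ_minExt.1 hs).solvable hξ'
    obtain ⟨W₁, hz₁, V₁, hV₁, hξ₁, h₁⟩ :=
      (hγ.mono (Γ' := C.minExt.Germ z) fun s hs => germ_minExt.2 hs).eventually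
    obtain ⟨W₂, hz₂, V₂, hV₂, hξ₂, h₂⟩ :=
      (hβ.mono (Γ' := C.sheafF.Germ z) fun s hs => germ_sheafF.2 hs).eventually
    obtain ⟨pa, ha, pb, hpb, e⟩ := eventually_prod_iff.1 e
    obtain ⟨W₃, hz₃, hW₃⟩ := exists_opens_of_near ha
    obtain ⟨V₃, hVb, hV₃, hξ₃⟩ := mem_nhds_iff.1 hpb
    let W := U ⊓ W' ⊓ W₁ ⊓ W₂ ⊓ W₃
    have hγW : ∀ y ∈ W, ∀ ξ ∈ V₁ ∩ V₂ ∩ V₃, C.Fam (C.minExt.Germ y) y ξ γ := fun y hy ξ hξ =>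
      h₁ y hy.1.1.2 ξ hξ.1.1
    have hβW : ∀ y ∈ W, ∀ ξ ∈ V₁ ∩ V₂ ∩ V₃, C.Fam (C.sheafF.Germ y) y ξ β := fun y hy ξ hξ =>
      h₂ y hy.1.2 ξ hξ.1.2
    have hVo : IsOpen (V₁ ∩ V₂ ∩ V₃) := (hV₁.inter hV₂).inter hV₃
    refine ⟨W, fun y hy => hy.1.1.1.1, ⟨⟨⟨⟨hz, hz'⟩, hz₁⟩, hz₂⟩, hz₃⟩,
      fun y hy => hW' y hy.1.1.1.2, V₁ ∩ V₂ ∩ V₃, hVo, ⟨⟨hξ₁, hξ₂⟩, hξ₃⟩, fun h => absurd hzs h,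
      C.minExt.secOf W γ, C.sheafF.secOf W β, OSub.holFamily_secOf hVo hγW,
      OSub.holFamily_secOf hVo hβW, fun ξ hξ => ?_⟩
    rw [OSub.coe_secOf fun y hy => (hγW y hy ξ hξ).germ,
      OSub.coe_secOf fun y hy => (hβW y hy ξ hξ).germ]
    funext x
    have h4 := e (hW₃ x.1 x.2.1.2 x.2.2) (hVb hξ.2)
    dsimp only at h4
    rw [extend_apply (b ξ).1 ⟨x.1, x.2.1.1.1.1.1, x.2.2⟩] at h4
    refine h4.trans ?_
    have h5 : C.D (C.extend (C.ofFun W (γ ξ))) x.1 = C.D (γ ξ) x.1 := by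
      refine C.D_congr _ _ x.1 x.2.2 ?_
      have := extend_ofFun_near (C := C) (γ ξ) (z := x.1) x.2.1
      rwa [C.near_coe x.2.2] at this
    change _ = (C.D (C.extend (C.ofFun W (γ ξ))) x.1 - ξ • γ ξ x.1) + β ξ x.1
    rw [h5]
  -- At a nonsingular point b is already in F, so no shrinking of the parameter domain is needed.
  -- With only finitely many singular points, a common domain then exists for all members of the
  -- cover.
  · have hns : ∀ y ∈ U ⊓ W', ¬ C.IsSing y := fun y hy hs => hzs (hW' y hy.2 hs ▸ hs)
    have hβ : ∀ y ∈ U ⊓ W', ∀ ξ ∈ V,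
        C.Fam (C.sheafF.Germ y) y ξ (fun ξ => C.extend (b ξ).1) := fun y hy ξ hξ =>
      (hb' y hy.1 ξ hξ).mono fun s hs => germ_sheafF.2 (fCond_of_extendsAt
        ((C.minSystem.mero (germ_minExt.1 hs)).extendsAt (hns y hy)))
    refine ⟨U ⊓ W', inf_le_left, ⟨hz, hz'⟩, fun y hy => hW' y hy.2, V, hV, hξ, fun _ => rfl,
      fun _ => 0, C.sheafF.secOf (U ⊓ W') fun ξ => C.extend (b ξ).1, OSub.HolFamily.const 0,
      OSub.holFamily_secOf hV hβ, fun ξ hξ => ?_⟩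
    rw [OSub.coe_secOf fun y hy => (hβ y hy ξ hξ).germ]
    have h0 : C.nabla ξ (0 : C.Sec (U ⊓ W')) = 0 := congrArg Subtype.val
      (map_zero ((C.minExt.mapsTo ξ).linearMap (U ⊓ W')))
    change _ = C.nabla ξ 0 + _
    rw [h0, zero_add]
    funext x
    exact (extend_apply (b ξ).1 ⟨x.1, x.2.1.1, x.2.2⟩).symm

end SingConn

section TwoTerm

variable {X : TopCat.{0}} {A B A' B' : TopCat.Sheaf (ModuleCat.{0} ℂ) X}

/-! ### Comparison of Čech hypercohomologies -/

instance : Nonempty (PCover X) := ⟨⟨fun _ => ⊤, fun _ => trivial⟩⟩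

instance : IsDirectedOrder (PCover X) :=
  ⟨fun 𝒰 𝒱 => ⟨⟨fun x => 𝒰.nbhd x ⊓ 𝒱.nbhd x, fun x => ⟨𝒰.mem x, 𝒱.mem x⟩⟩,
    fun _ => inf_le_left, fun _ => inf_le_right⟩⟩

lemma rho_self {U : Opens X} (h : U ≤ U) (a : A.obj.obj (op U)) : rho A h a = a :=
  congrArg (fun f => f.hom a) (A.obj.map_id (op U))

instance (d : A ⟶ B) : DirectedSystem (CoverH1 d) fun _ _ h => coverH1Res d _ _ h where
  map_self 𝒰 c := by
    obtain ⟨c, rfl⟩ := Submodule.Quotient.mk_surjective _ c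
    exact congrArg Submodule.Quotient.mk (Subtype.ext (Prod.ext (funext fun x => rho_self _ _)
      (funext fun x => funext fun y => rho_self _ _)))
  map_map 𝒲 𝒱 𝒰 h h' c := by
    obtain ⟨c, rfl⟩ := Submodule.Quotient.mk_surjective _ c
    exact congrArg Submodule.Quotient.mk (Subtype.ext (Prod.ext (funext fun x => rho_rho _ _ _)
      (funext fun x => funext fun y => rho_rho _ _ _)))

lemma H1.exists_mk {d : A ⟶ B} (η : H1 d) : ∃ 𝒰 c, H1.mk d 𝒰 c = η := by
  classical
  obtain ⟨𝒰, c, rfl⟩ := Module.DirectLimit.exists_of η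
  obtain ⟨c, rfl⟩ := Submodule.Quotient.mk_surjective _ c
  exact ⟨𝒰, c, rfl⟩

lemma H1.exists_mk₂ {d : A ⟶ B} (η η' : H1 d) :
    ∃ 𝒰 c c', H1.mk d 𝒰 c = η ∧ H1.mk d 𝒰 c' = η' := by
  classical
  obtain ⟨𝒰, c, c', rfl, rfl⟩ := Module.DirectLimit.exists_of₂ η η'
  obtain ⟨c, rfl⟩ := Submodule.Quotient.mk_surjective _ c
  obtain ⟨c', rfl⟩ := Submodule.Quotient.mk_surjective _ c'
  exact ⟨𝒰, c, c', rfl, rfl⟩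

lemma H1.mk_res (d : A ⟶ B) {𝒰 𝒱 : PCover X} (h : 𝒰 ≤ 𝒱) (c : cocycles d 𝒰) :
    H1.mk d 𝒱 (cocyclesRes d h c) = H1.mk d 𝒰 c := by
  classical
  exact Module.DirectLimit.of_f (f := coverH1Res d) (hij := h) (x := Submodule.Quotient.mk c)

lemma H1.mk_eq_of_sub {d : A ⟶ B} {𝒰 : PCover X} {c c' : cocycles d 𝒰}
    (a : ∀ x, A.obj.obj (op (𝒰.nbhd x))) (h : coboundary d 𝒰 a = c - c') :
    H1.mk d 𝒰 c = H1.mk d 𝒰 c' := by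
  have h' : (Submodule.Quotient.mk c : CoverH1 d 𝒰) = Submodule.Quotient.mk c' :=
    (Submodule.Quotient.eq _).2 (LinearMap.mem_range.2 ⟨a, h⟩)
  rw [H1.mk, H1.mk, h']

lemma H1.exists_coboundary {d : A ⟶ B} {𝒰 : PCover X} {c c' : cocycles d 𝒰}
    (h : H1.mk d 𝒰 c = H1.mk d 𝒰 c') :
    ∃ 𝒱, ∃ h : 𝒰 ≤ 𝒱, ∃ a, coboundary d 𝒱 a = cocyclesRes d h (c - c') := by
  classical
  obtain ⟨𝒱, hUV, h⟩ := Module.DirectLimit.exists_eq_of_of_eq (f := coverH1Res d) h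
  obtain ⟨a, ha⟩ := (Submodule.Quotient.eq _).1 h
  exact ⟨𝒱, hUV, a, ha.trans (map_sub _ _ _).symm⟩

variable {d : A ⟶ B} {d' : A' ⟶ B'} {α : A ⟶ A'} {β : B ⟶ B'} (w : α ≫ d' = d ≫ β)

lemma H1.map_mk (𝒰 : PCover X) (c : cocycles d 𝒰) :
    H1.map α β w (H1.mk d 𝒰 c) = H1.mk d' 𝒰 (cocyclesMap α β w 𝒰 c) := by
  classical
  exact Module.DirectLimit.map_apply_of _ _ _

/-- If the images differ by the coboundary of (a'_x) on a finer cover, then d' a'_x lies in B; by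
`hinj` the a'_x lie in A, and the classes already agree in the subcomplex. -/
lemma H1.map_injective (hα : ∀ U, Function.Injective (onSec α U))
    (hβ : ∀ U, Function.Injective (onSec β U))
    (hinj : ∀ U (a' : A'.obj.obj (op U)) (b : B.obj.obj (op U)),
      onSec d' U a' = onSec β U b → ∃ a, onSec α U a = a') :
    Function.Injective (H1.map α β w) := by
  intro η η' hη
  obtain ⟨𝒰, c, c', rfl, rfl⟩ := H1.exists_mk₂ η η'
  rw [H1.map_mk, H1.map_mk] at hη
  obtain ⟨𝒱, h, a', ha'⟩ := H1.exists_coboundary hη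
  rw [← map_sub] at ha'
  have h1 : ∀ x, onSec d' _ (a' x) = onSec β _ (rho B (h x) ((c - c').1.1 x)) := fun x =>
    (congrFun (congrArg (fun t => t.1.1) ha') x).trans (onSec_rho β (h x) _).symm
  choose a ha using fun x => hinj _ _ _ (h1 x)
  rw [← H1.mk_res d h, ← H1.mk_res d h c']
  refine H1.mk_eq_of_sub a ?_
  rw [← map_sub]
  refine Subtype.ext (Prod.ext (funext fun x => hβ _ ?_)
    (funext fun x => funext fun y => hα _ ?_))
  · exact (onSec_comm w _ _).symm.trans ((congrArg (onSec d' _) (ha x)).trans (h1 x))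
  · have h3 := congrFun (congrFun (congrArg (fun t => t.1.2) ha') x) y
    change rho A' _ (a' y) - rho A' _ (a' x) = rho A' _ (onSec α _ ((c - c').1.2 x y)) at h3
    change onSec α _ (rho A _ (a y) - rho A _ (a x)) = onSec α _ (rho A _ ((c - c').1.2 x y))
    rw [map_sub, onSec_rho, onSec_rho, ha, ha, h3, onSec_rho]

/-- A cocycle that is modified by a coboundary to take values in a subcomplex. -/
lemma H1.exists_map_eq (hα : ∀ U, Function.Injective (onSec α U))
    (hβ : ∀ U, Function.Injective (onSec β U)) {𝒰 𝒱 : PCover X} (h : 𝒰 ≤ 𝒱)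
    (c : cocycles d' 𝒰) (γ : ∀ x, A'.obj.obj (op (𝒱.nbhd x))) (c₁ : Cochain1 A B 𝒱)
    (h₁ : ∀ x, onSec β _ (c₁.1 x) = rho B' (h x) (c.1.1 x) - onSec d' _ (γ x))
    (h₂ : ∀ x y, onSec α _ (c₁.2 x y) = rho A' (inf_le_inf (h x) (h y)) (c.1.2 x y) -
      (rho A' inf_le_right (γ y) - rho A' inf_le_left (γ x))) :
    ∃ hc : c₁ ∈ cocycles d 𝒱, H1.map α β w (H1.mk d 𝒱 ⟨c₁, hc⟩) = H1.mk d' 𝒰 c := by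
  have hr := (cocyclesRes d' h c).2
  have hg := (coboundary d' 𝒱 γ).2
  have hs := sub_mem hr hg
  have hc : c₁ ∈ cocycles d 𝒱 := by
    refine ⟨fun x y => hβ _ ?_, fun x y z => hα _ ?_⟩
    · rw [map_sub, onSec_rho, onSec_rho, h₁, h₁, ← onSec_comm w, h₂]
      exact hs.1 x y
    · rw [map_add, onSec_rho, onSec_rho, onSec_rho, h₂, h₂, h₂]
      exact hs.2 x y z
  refine ⟨hc, ?_⟩
  rw [H1.map_mk, ← H1.mk_res d' h c]
  refine (H1.mk_eq_of_sub γ ?_).symm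
  refine Subtype.ext (Prod.ext (funext fun x => ?_) (funext fun x => funext fun y => ?_))
  · exact (sub_eq_iff_eq_add.2 (sub_eq_iff_eq_add'.1 (h₁ x).symm)).symm
  · exact (sub_eq_iff_eq_add.2 (sub_eq_iff_eq_add'.1 (h₂ x y).symm)).symm

end TwoTerm

namespace SingConn

variable {r : ℕ} {E : HolBundle r} {C : SingConn E}

/-! ### The comparison with the twisted de Rham complex -/

lemma onSec_incl_injective {A B : C.OSub} (h : A.Le B) (U : Opens (OnePoint ℂ)) :
    Function.Injective (onSec (OSub.incl h) U) := Submodule.inclusion_injective (h U)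

lemma exists_onSec_incl_eq (hC : C.ResonanceFree) {ξ : ℂ} (hξ : ξ ∉ C.Phat)
    (U : Opens (OnePoint ℂ)) (a : C.minExt.toSheaf.obj.obj (op U))
    (b : C.sheafF.toSheaf.obj.obj (op U))
    (h : onSec (C.minExt.mapsTo ξ).hom U a = onSec (OSub.incl C.sheafF_le_minExt) U b) :
    ∃ e, onSec (OSub.incl C.sheafE_le_minExt) U e = a := by
  have h' : C.nabla ξ a.1 = b.1 := congrArg Subtype.val h
  refine ⟨⟨a.1, fun z hz => extendsAt_of_fCond_nabla hC hξ (a.2 z hz) ?_⟩, rfl⟩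
  have hb : C.FCond (C.extend b.1) z := b.2 z hz
  rw [← h'] at hb
  exact hb.congr (extend_nabla ξ a.1 hz)

/-- Local surjectivity is the parametrised solution applied to the constant family `b` and evaluated
at ξ. -/
lemma quasiIso_compare (hC : C.ResonanceFree) {ξ : ℂ} (hξ : ξ ∉ C.Phat) :
    QuasiIso (C.minExt.compare C.sheafE_le_minExt C.sheafF_le_minExt ξ) := by
  refine quasiIso_twoTermMap_of_sections _ _ _ (onSec_incl_injective _) (onSec_incl_injective _)
    (exists_onSec_incl_eq hC hξ) fun U b z hz => ?_
  obtain ⟨W, h, hzW, _, V₀, _, hξ₀, _, γ, β, _, _, e⟩ := exists_solution isOpen_univ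
    (OSub.HolFamily.const b) hz (Set.mem_univ ξ) hξ
  exact ⟨W, h, hzW, γ ξ, β ξ, Subtype.ext (e ξ hξ₀)⟩

lemma compareH1_injective (hC : C.ResonanceFree) {ξ : ℂ} (hξ : ξ ∉ C.Phat) :
    Function.Injective (C.minExt.compareH1 C.sheafE_le_minExt C.sheafF_le_minExt ξ) :=
  H1.map_injective _ (onSec_incl_injective _) (onSec_incl_injective _)
    (exists_onSec_incl_eq hC hξ)

lemma finite_isSing : {z | C.IsSing z}.Finite := by
  refine (((C.P.finite_toSet).image fun p : ℂ => (p : OnePoint ℂ)).insert OnePoint.infty).subset ?_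
  rintro z (rfl | ⟨p, hp, rfl⟩)
  · exact Set.mem_insert _ _
  · exact Set.mem_insert_of_mem _ ⟨p, hp, rfl⟩

/-- The cocycle relation on x, x, x reads a_xx + a_xx = a_xx. -/
lemma cocycles_self {A B : C.OSub} {ξ : ℂ} {h : C.MapsTo ξ A B}
    {𝒰 : PCover (TopCat.of (OnePoint ℂ))} (c : cocycles h.hom 𝒰) (x : OnePoint ℂ) :
    c.1.2 x x = 0 := by
  refine Subtype.ext (funext fun p => ?_)
  have h1 := congrFun (congrArg Subtype.val (c.2.2 x x x)) ⟨p.1, ⟨p.2.1, p.2.1.1⟩, p.2.2⟩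
  exact add_eq_left.1 h1

/-- A holomorphic family of cochains of the twisted de Rham complex is, on a finer cover,
cohomologous to a holomorphic family of cochains of `E → F`, wherever it consists of cocycles. -/
lemma exists_family {V : Set ℂ} (hV : IsOpen V) {ξ₀ : ℂ} (hξ : ξ₀ ∈ V) (hξ' : ξ₀ ∉ C.Phat)
    {𝒰 : PCover (TopCat.of (OnePoint ℂ))} {b : ∀ x, ℂ → C.minExt.carrier (𝒰.nbhd x)}
    {a : ∀ x y, ℂ → C.minExt.carrier (𝒰.nbhd x ⊓ 𝒰.nbhd y)}
    (hb : ∀ x, C.minExt.HolFamily (𝒰.nbhd x) V (b x))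
    (ha : ∀ x y, C.minExt.HolFamily (𝒰.nbhd x ⊓ 𝒰.nbhd y) V (a x y)) :
    ∃ V' ⊆ V, IsOpen V' ∧ ξ₀ ∈ V' ∧ ∃ 𝒱 : PCover (TopCat.of (OnePoint ℂ)),
    ∃ (b' : ∀ x, ℂ → C.sheafF.carrier (𝒱.nbhd x))
      (a' : ∀ x y, ℂ → C.sheafE.carrier (𝒱.nbhd x ⊓ 𝒱.nbhd y)),
      (∀ x, C.sheafF.HolFamily (𝒱.nbhd x) V' (b' x)) ∧
      (∀ x y, C.sheafE.HolFamily (𝒱.nbhd x ⊓ 𝒱.nbhd y) V' (a' x y)) ∧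
      ∀ ξ ∈ V', ∀ hc : ((fun x => b x ξ, fun x y => a x y ξ) :
          Cochain1 C.minExt.toSheaf C.minExt.toSheaf 𝒰) ∈ cocycles (C.minExt.mapsTo ξ).hom 𝒰,
        ∃ hc' : ((fun x => b' x ξ, fun x y => a' x y ξ) :
          Cochain1 C.sheafE.toSheaf C.sheafF.toSheaf 𝒱) ∈ cocycles (C.mapsTo_E_F ξ).hom 𝒱,
          C.minExt.compareH1 C.sheafE_le_minExt C.sheafF_le_minExt ξ
            (H1.mk (C.mapsTo_E_F ξ).hom 𝒱 ⟨_, hc'⟩) =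
          H1.mk (C.minExt.mapsTo ξ).hom 𝒰 ⟨_, hc⟩ := by
  classical
  choose W hW hxW hWs V₀ hV₀ hξ₀ hns γ β hγ hβ e using fun x =>
    exists_solution hV (hb x) (𝒰.mem x) hξ hξ'
  -- Only the finitely many singular points restrict the parameter, so the intersection is open.
  let V' : Set ℂ := V ∩ ⋂ z ∈ {z | C.IsSing z}, V₀ z
  have hV' : IsOpen V' := hV.inter (C.finite_isSing.isOpen_biInter fun z _ => hV₀ z)
  have hV'₀ : ∀ x, V' ⊆ V₀ x := fun x ξ h => by
    by_cases hx : C.IsSing x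
    · exact Set.mem_iInter₂.1 h.2 x hx
    · rw [hns x hx]; exact h.1
  let 𝒱 : PCover (TopCat.of (OnePoint ℂ)) := ⟨W, hxW⟩
  -- The cocycle a_xy corrected by the coboundary of γ. On the diagonal, where singular points may
  -- occur, it is set to zero, which is correct as soon as a is a cocycle.
  let Φ : OnePoint ℂ → OnePoint ℂ → ℂ → ∀ p : ℂ, E.Fib p := fun x y ξ p =>
    if x = y then 0 else C.extend (a x y ξ).1 p + (-C.extend (γ y ξ).1 p + C.extend (γ x ξ).1 p)
  have hΦ : ∀ x y, ∀ z ∈ W x ⊓ W y, ∀ ξ ∈ V', C.Fam (C.sheafE.Germ z) z ξ (Φ x y) := by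
    intro x y z hz ξ hξ
    by_cases hxy : x = y
    · simpa only [Φ, if_pos hxy] using Fam.zero
    -- `W x` contains no singular point other than x, so a singular point in the intersection would
    -- force x = y.
    · have hzs : ¬ C.IsSing z := fun h => hxy ((hWs x z hz.1 h).symm.trans (hWs y z hz.2 h))
      simp only [Φ, if_neg hxy]
      refine Fam.mono (Γ := C.minExt.Germ z) (fun s => germ_sheafE_of_minExt hzs)
        ((OSub.holFamily_iff.1 (ha x y) z ⟨hW x hz.1, hW y hz.2⟩ ξ hξ.1).add (Fam.add ?_
          (OSub.holFamily_iff.1 (hγ x) z hz.1 ξ (hV'₀ x hξ))))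
      obtain ⟨ι, hι, s, c, hs, hc, h⟩ := OSub.holFamily_iff.1 (hγ y) z hz.2 ξ (hV'₀ y hξ)
      refine ⟨ι, hι, s, fun j x ξ => -c j x ξ, hs, fun j => (hc j).neg, h.mono fun q hq => ?_⟩
      simp only [hq, neg_smul, Finset.sum_neg_distrib]
  refine ⟨V', Set.inter_subset_left, hV', ⟨hξ, Set.mem_iInter₂.2 fun z _ => hξ₀ z⟩, 𝒱, β,
    fun x y => C.sheafE.secOf (W x ⊓ W y) (Φ x y), fun x z hz ξ hξ => hβ x z hz ξ (hV'₀ x hξ),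
    fun x y => OSub.holFamily_secOf hV' (hΦ x y), fun ξ hξ hc => ?_⟩
  refine H1.exists_map_eq _ (onSec_incl_injective _) (onSec_incl_injective _) (𝒱 := 𝒱) hW ⟨_, hc⟩
    (fun x => γ x ξ) _ (fun x => ?_) fun x y => ?_
  · exact Subtype.ext (eq_sub_of_add_eq' (e x ξ (hV'₀ x hξ)).symm)
  · refine Subtype.ext (funext fun p => ?_)
    change (C.sheafE.secOf (W x ⊓ W y) (Φ x y) ξ).1 p = (a x y ξ).1 ⟨p.1, _⟩ -
      ((γ y ξ).1 ⟨p.1, p.2.1.2, p.2.2⟩ - (γ x ξ).1 ⟨p.1, p.2.1.1, p.2.2⟩)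
    rw [OSub.coe_secOf fun z hz => (hΦ x y z hz ξ hξ).germ]
    change Φ x y ξ p.1 = _
    by_cases hxy : x = y
    · subst hxy
      have h0 : a x x ξ = 0 := cocycles_self ⟨_, hc⟩ x
      simp [Φ, h0]
    · simp only [Φ, if_neg hxy]
      rw [extend_apply (a x y ξ).1 ⟨p.1, ⟨hW x p.2.1.1, hW y p.2.1.2⟩, p.2.2⟩,
        extend_apply (γ y ξ).1 ⟨p.1, p.2.1.2, p.2.2⟩,
        extend_apply (γ x ξ).1 ⟨p.1, p.2.1.1, p.2.2⟩]
      abel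

/-- Surjectivity at a single ξ comes from `exists_family` applied to the constant families given by
the components of a cocycle. -/
lemma compareH1_bijective (hC : C.ResonanceFree) {ξ : ℂ} (hξ : ξ ∉ C.Phat) :
    Function.Bijective (C.minExt.compareH1 C.sheafE_le_minExt C.sheafF_le_minExt ξ) := by
  refine ⟨compareH1_injective hC hξ, fun η => ?_⟩
  obtain ⟨𝒰, c, rfl⟩ := H1.exists_mk η
  obtain ⟨V', _, _, hξ', 𝒱, b', a', _, _, h⟩ := exists_family isOpen_univ (Set.mem_univ ξ) hξ
    (fun x => OSub.HolFamily.const (c.1.1 x)) (fun x y => OSub.HolFamily.const (c.1.2 x y))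
  obtain ⟨hc', h⟩ := h ξ hξ' c.2
  exact ⟨_, h⟩

/-- Inclusion carries holomorphic cocycles to holomorphic cocycles. Conversely, a holomorphic family
of de Rham cocycles is replaced by one of E → F with the same image in hypercohomology, and
injectivity identifies its class with η ξ. -/
lemma isHolSection_iff (hC : C.ResonanceFree) {V : Set ℂ} (hV : V ⊆ C.Phatᶜ)
    (η : ∀ ξ, H1 (C.mapsTo_E_F ξ).hom) :
    IsHolSection C.mapsTo_E_F V η ↔ IsHolSection C.minExt.mapsTo V
      (fun ξ => C.minExt.compareH1 C.sheafE_le_minExt C.sheafF_le_minExt ξ (η ξ)) := by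
  constructor
  · intro h ξ₀ hξ₀
    obtain ⟨V', hV', hVo, hξ', 𝒰, b, a, hb, ha, h⟩ := h ξ₀ hξ₀
    refine ⟨V', hV', hVo, hξ', 𝒰, _, _, fun x => (hb x).incl C.sheafF_le_minExt,
      fun x y => (ha x y).incl C.sheafE_le_minExt, fun ξ hξ => ?_⟩
    obtain ⟨hc, h⟩ := h ξ hξ
    refine ⟨(cocyclesMap _ _ ((C.mapsTo_E_F ξ).hom_incl (C.minExt.mapsTo ξ) C.sheafE_le_minExt
      C.sheafF_le_minExt) 𝒰 ⟨_, hc⟩).2, ?_⟩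
    exact (congrArg (C.minExt.compareH1 C.sheafE_le_minExt C.sheafF_le_minExt ξ) h).trans
      (H1.map_mk _ _ _)
  · intro h ξ₀ hξ₀
    obtain ⟨V₁, hV₁, hVo, hξ₁, 𝒰, b, a, hb, ha, h⟩ := h ξ₀ hξ₀
    obtain ⟨V', hV', hVo', hξ', 𝒱, b', a', hb', ha', h'⟩ :=
      exists_family hVo hξ₁ (hV hξ₀) hb ha
    refine ⟨V', hV'.trans hV₁, hVo', hξ', 𝒱, b', a', hb', ha', fun ξ hξ => ?_⟩
    obtain ⟨hc, h⟩ := h ξ (hV' hξ)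
    obtain ⟨hc', h'⟩ := h' ξ hξ hc
    exact ⟨hc', compareH1_injective hC (hV (hV₁ (hV' hξ))) (h.trans h'.symm)⟩

end SingConn

end TwistedDeRham

end

theorem proposition5p1 {r : ℕ} {E : TwistedDeRham.HolBundle r} (C : TwistedDeRham.SingConn E)
    (hC : C.ResonanceFree) :
    (∃! N : C.DSub, N.IsMinimalExtension) ∧
    ∀ N : C.DSub, N.IsMinimalExtension →
      ∃ (hE : C.sheafE.Le N.toOSub) (hF : C.sheafF.Le N.toOSub),
        (∀ ξ : ℂ, ξ ∉ C.Phat →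
          QuasiIso (N.compare hE hF ξ) ∧ Function.Bijective (N.compareH1 hE hF ξ)) ∧
        ∀ V : Set ℂ, IsOpen V → V ⊆ C.Phatᶜ →
          ∀ η : ∀ ξ, TwistedDeRham.H1 (C.mapsTo_E_F ξ).hom,
            TwistedDeRham.SingConn.IsHolSection C.mapsTo_E_F V η ↔
              TwistedDeRham.SingConn.IsHolSection N.mapsTo V
                (fun ξ => N.compareH1 hE hF ξ (η ξ)) := by
  refine ⟨⟨C.minExt, C.minExt_isMinimalExtension hC, fun N hN => hN.eq_minExt hC⟩,
    fun N hN => ?_⟩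
  obtain rfl := hN.eq_minExt hC
  exact ⟨C.sheafE_le_minExt, C.sheafF_le_minExt, fun ξ hξ =>
    ⟨TwistedDeRham.SingConn.quasiIso_compare hC hξ,
      TwistedDeRham.SingConn.compareH1_bijective hC hξ⟩,
    fun V _ hV η => TwistedDeRham.SingConn.isHolSection_iff hC hV η⟩
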